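/- **Conventions.** For a separable complete metric space $X$, $\mathcal P(X)$ denotes the Borel probability measures on $X$. A coupling of two probability measures is a probability measure on the product with the given marginals. For probability measures $\mu_1,\mu_2$ on a metric space $(Z,d)$ put $d_{W_1}^Z(\mu_1,\mu_2)=\inf_q\int d\,dq\in[0,\infty]$, where $q$ runs over all couplings. Let $\Phi(x)=\int_{-\infty}^x(4\pi)^{-1/2}e^{-y^2/4}\,dy$. $|\cdot|$ is Lebesgue measure on $\mathbb R$, and "measurable" for subsets of $\mathbb{R}$ means Lebesgue measurable. **Metric flows.** A metric flow $\mathcal X$ over $A\subset\mathbb R$ consists of complete separable metric spaces $(\mathcal X_t,d_t)$, $t\in A$, and measures $\nu_{x;s}\in\mathcal P(\mathcal X_s)$ for $x\in\mathcal X_t$, $s,t\in A$, $s\le t$, such that 1. $\nu_{x;t}=\delta_x$ for all $x\in\mathcal X_t$; 2. for all $s<t$ in $A$, $T\ge0$ and measurable $u:\mathcal X_s\to[0,1]$ such that, if $T>0$, $u=\Phi\circ f$ for some $T^{-1/2}$-Lipschitz $f:\mathcal X_s\to\mathbb R$, the function $x\mapsto\int u\,d\nu_{x;s}$ on $\mathcal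 X_t$ is either constant or equal to $\Phi\circ g$ for some $(t-s+T)^{-1/2}$-Lipschitz $g:\mathcal X_t\to\mathbb R$; 3. $\nu_{x;t_1}(S)=\int_{\mathcal X_{t_2}}\nu_{y;t_1}(S)\,d\nu_{x;t_2}(y)$ for all $t_1\le t_2\le t_3$ in $A$, $x\in\mathcal X_{t_3}$ and Borel $S\subset\mathcal X_{t_1}$. **Metric flow pairs.** Let $I\subset\mathbb R$ be an interval and $J\subset I$ an arbitrary subset. A metric flow pair over $I$ is a pair $(\mathcal X,(\mu_t)_{t\in I'})$, where $I'\subset I$ with $|I\setminus I'|=0$, $\mathcal X$ is a metric flow over $I'$, and $\mu_t\in\mathcal P(\mathcal X_t)$ satisfy $\operatorname{supp}\mu_t=\mathcal X_t$ for all $t\in I'$ and $\mu_s=\int_{\mathcal X_t}\nu_{x;s}\,d\mu_t(x)$ for all $s\le t$ in $I'$. It is fully defined over $J$ if $J\subset I'$. Two metric flow pairs $(\mathcal X^i,(\mu^i_t)_{t\in I'^{,i}})$, $i=1,2$, fully defined over $J$, are equivalent if there are $S$ with $J\subset S\subset I'^{,1}\cap I'^{,2}$ and $|I'^{,i}\setminus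 S|=0$ for $i=1,2$, and bijective isometries $\phi_t:\mathcal X^1_t\to\mathcal X^2_t$, $t\in S$, with $(\phi_t)_*\mu^1_t=\mu^2_t$ for all $t\in S$ and $(\phi_s)_*\nu^1_{x;s}=\nu^2_{\phi_t(x);s}$ for all $s\le t$ in $S$ and $x\in\mathcal X^1_t$. Let $\mathbb F_I^J$ be the set of equivalence classes. **The $\mathbb F$-distance.** A correspondence $\mathfrak C$ over $I$ between $\mathcal X^1$ and $\mathcal X^2$, fully defined over $J$, consists of metric spaces $(Z_t,d^Z_t)_{t\in I}$, subsets $I''^{,i}\subset I'^{,i}$ with $J\subset I''^{,i}$, and isometric embeddings $\varphi^i_t:\mathcal X^i_t\to Z_t$ for $t\in I''^{,i}$, $i=1,2$. Define $d_{\mathbb F}^{\mathfrak C,J}\in[0,\infty]$ as the infimum of all $r>0$ for which there are a measurable $E\subset I$ with $J\subset I\setminus E\subset I''^{,1}\cap I''^{,2}$ and $|E|\le r^2$ and couplings $q_t$ of $\mu^1_t,\mu^2_t$ for $t\in I\setminus E$ such that for all $s\le t$ in $I\setminus E$ $$\int_{\mathcal X^1_t\times\mathcal X^2_t}d_{W_1}^{Z_s}\big((\varphi^1_s)_*\nu^1_{x^1;s},(\varphi^2_s)_*\nu^2_{x^2;s}\big)\,dq_t(x^1,x^2)\le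 r .$$ The distance $d_{\mathbb F}^J$ of two metric flow pairs is the infimum of $d_{\mathbb F}^{\mathfrak C,J}$ over all such $\mathfrak C$; it depends only on the equivalence classes and so defines $d^J_{\mathbb F}:\mathbb F_I^J\times\mathbb F_I^J\to[0,\infty]$. **Theorem.** For every interval $I\subset\mathbb R$ and every subset $J\subset I$, $(\mathbb F_I^J,d_{\mathbb F}^J)$ is a metric space (in which distances may be infinite), and it is complete. -/

import Mathlib

open MeasureTheory
open scoped ENNReal NNReal

universe u

/-! ### Couplings and the `W₁`-distance -/

/-- `q` is a coupling between `μ` and `ν`: its marginals are `μ` and `ν`. -/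
def IsCoupling {X Y : Type*} [MeasurableSpace X] [MeasurableSpace Y]
    (q : Measure (X × Y)) (μ : Measure X) (ν : Measure Y) : Prop :=
  q.map Prod.fst = μ ∧ q.map Prod.snd = ν

/-- The `W₁`-Wasserstein distance, with values in `[0, ∞]`: the infimum of `∫ d(x₁, x₂) dq` over
all couplings `q`. -/
noncomputable def W1 {Z : Type*} [PseudoEMetricSpace Z] [MeasurableSpace Z]
    (μ ν : Measure Z) : ℝ≥0∞ :=
  ⨅ (q : Measure (Z × Z)) (_ : IsCoupling q μ ν), ∫⁻ z, edist z.1 z.2 ∂q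

/-! ### Metric flows -/

/-- The antiderivative `Φ : ℝ → (0, 1)` of `(4π)^{-1/2} exp (-x² / 4)` that tends to `0` at `-∞`
(and to `1` at `∞`). -/
noncomputable def Phi (x : ℝ) : ℝ :=
  ∫ y in Set.Iic x, (4 * Real.pi) ^ (-(1 / 2) : ℝ) * Real.exp (-y ^ 2 / 4)

/-- A metric flow over `A ⊆ ℝ`. The set of points is the disjoint union of the time-slices,
and the time-function sends a point of `slice t` to `t`. -/
structure MetricFlow (A : Set ℝ) where
  /-- the time-slice `𝒳_t` -/
  slice : A → Type u
  [metric : ∀ t, MetricSpace (slice t)]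
  [meas : ∀ t, MeasurableSpace (slice t)]
  [borel : ∀ t, BorelSpace (slice t)]
  [complete : ∀ t, CompleteSpace (slice t)]
  [separable : ∀ t, TopologicalSpace.SeparableSpace (slice t)]
  /-- the conjugate heat kernel: `ν h x` is `ν_{x;s}` for `x ∈ 𝒳_t` and `h : s ≤ t` -/
  ν : ∀ {s t : A}, s ≤ t → slice t → Measure (slice s)
  prob : ∀ {s t : A} (h : s ≤ t) (x : slice t), IsProbabilityMeasure (ν h x)
  ν_self : ∀ (t : A) (x : slice t), ν (le_refl t) x = Measure.dirac x
  /-- the sharp gradient estimate for solutions of the heat equation -/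
  gradient : ∀ {s t : A} (h : s < t) (T : ℝ≥0) (v : slice s → ℝ), Measurable v →
    (∀ y, v y ∈ Set.Icc (0 : ℝ) 1) →
    (0 < T → ∃ f : slice s → ℝ, LipschitzWith (T ^ (-(1 / 2) : ℝ)) f ∧ ∀ y, v y = Phi (f y)) →
    (∃ c : ℝ, ∀ x : slice t, ∫ y, v y ∂(ν h.le x) = c) ∨
    ∃ f : slice t → ℝ,
      LipschitzWith ((Real.toNNReal ((t : ℝ) - (s : ℝ)) + T) ^ (-(1 / 2) : ℝ)) f ∧
      ∀ x : slice t, ∫ y, v y ∂(ν h.le x) = Phi (f x)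
  /-- the reproduction formula -/
  reproduction : ∀ {t₁ t₂ t₃ : A} (h₁₂ : t₁ ≤ t₂) (h₂₃ : t₂ ≤ t₃) (x : slice t₃)
    (S : Set (slice t₁)), MeasurableSet S →
    ν (h₁₂.trans h₂₃) x S = ∫⁻ y, ν h₁₂ y S ∂(ν h₂₃ x)

attribute [instance] MetricFlow.metric MetricFlow.meas MetricFlow.borel MetricFlow.complete
  MetricFlow.separable

/-- A conjugate heat flow on `X`: a family of probability measures `μ_t` on the time-slices with
`μ_s = ∫ ν_{x;s} dμ_t(x)` for all `s ≤ t`. -/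
def IsConjugateHeatFlow {A : Set ℝ} (X : MetricFlow.{u} A)
    (μ : ∀ t : A, Measure (X.slice t)) : Prop :=
  (∀ t, IsProbabilityMeasure (μ t)) ∧
  ∀ (s t : A) (h : s ≤ t) (S : Set (X.slice s)), MeasurableSet S →
    μ s S = ∫⁻ x, X.ν h x S ∂(μ t)

/-- A metric flow pair over `I`; it is defined on a subset `dom` of `I` of full measure. -/
structure MetricFlowPair (I : Set ℝ) where
  /-- the set of times `I'` -/
  dom : Set ℝ
  dom_subset : dom ⊆ I
  null : volume (I \ dom) = 0
  flow : MetricFlow.{u} dom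
  μ : ∀ t : dom, Measure (flow.slice t)
  conj : IsConjugateHeatFlow flow μ
  full_support : ∀ t, (μ t).support = Set.univ

/-- The metric flow pair is fully defined over `J`. -/
def MetricFlowPair.FullyDefined {I : Set ℝ} (P : MetricFlowPair.{u} I) (J : Set ℝ) : Prop :=
  J ⊆ P.dom

/-! ### Almost always isometries and the set of equivalence classes -/

/-- An almost always isometry between two metric flow pairs that is fully defined over `J`: a flow
isometry over a set of times `S` with `J ⊆ S`, whose complement in the two domains is a null set,
and which maps the one conjugate heat flow to the other. -/
structure AlmostAlwaysIsometry {I : Set ℝ} (P Q : MetricFlowPair.{u} I) (J : Set ℝ) where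
  S : Set ℝ
  sub₁ : S ⊆ P.dom
  sub₂ : S ⊆ Q.dom
  null₁ : volume (P.dom \ S) = 0
  null₂ : volume (Q.dom \ S) = 0
  full : J ⊆ S
  φ : ∀ t (ht : t ∈ S), P.flow.slice ⟨t, sub₁ ht⟩ ≃ᵢ Q.flow.slice ⟨t, sub₂ ht⟩
  map_ν : ∀ s t (hs : s ∈ S) (ht : t ∈ S) (h : s ≤ t) (x : P.flow.slice ⟨t, sub₁ ht⟩),
    (P.flow.ν (s := ⟨s, sub₁ hs⟩) (Subtype.mk_le_mk.2 h) x).map (φ s hs) =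
      Q.flow.ν (s := ⟨s, sub₂ hs⟩) (Subtype.mk_le_mk.2 h) (φ t ht x)
  map_μ : ∀ t (ht : t ∈ S), (P.μ ⟨t, sub₁ ht⟩).map (φ t ht) = Q.μ ⟨t, sub₂ ht⟩

theorem measurable_isometryEquiv {X Y : Type*} [MetricSpace X] [MetricSpace Y]
    [MeasurableSpace X] [MeasurableSpace Y] [BorelSpace X] [BorelSpace Y] (e : X ≃ᵢ Y) :
    Measurable e :=
  e.continuous.measurable

/-- The identity. -/
def AlmostAlwaysIsometry.refl {I : Set ℝ} (P : MetricFlowPair.{u} I) {J : Set ℝ}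
    (h : P.FullyDefined J) : AlmostAlwaysIsometry P P J where
  S := P.dom
  sub₁ := subset_rfl
  sub₂ := subset_rfl
  null₁ := by simp
  null₂ := by simp
  full := h
  φ t ht := IsometryEquiv.refl _
  map_ν s t hs ht h x := Measure.map_id
  map_μ t ht := Measure.map_id

/-- The inverse. -/
def AlmostAlwaysIsometry.symm {I : Set ℝ} {P Q : MetricFlowPair.{u} I} {J : Set ℝ}
    (a : AlmostAlwaysIsometry P Q J) : AlmostAlwaysIsometry Q P J where
  S := a.S
  sub₁ := a.sub₂
  sub₂ := a.sub₁
  null₁ := a.null₂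
  null₂ := a.null₁
  full := a.full
  φ t ht := (a.φ t ht).symm
  map_ν s t hs ht h x := by
    have := a.map_ν s t hs ht h ((a.φ t ht).symm x)
    rw [IsometryEquiv.apply_symm_apply] at this
    rw [← this, Measure.map_map (measurable_isometryEquiv _) (measurable_isometryEquiv _),
      IsometryEquiv.symm_comp_self, Measure.map_id]
  map_μ t ht := by
    rw [← a.map_μ t ht, Measure.map_map (measurable_isometryEquiv _) (measurable_isometryEquiv _),
      IsometryEquiv.symm_comp_self, Measure.map_id]

/-- The composition, on the intersection of the two sets of times. -/
def AlmostAlwaysIsometry.trans {I : Set ℝ} {P Q R : MetricFlowPair.{u} I} {J : Set ℝ}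
    (a : AlmostAlwaysIsometry P Q J) (b : AlmostAlwaysIsometry Q R J) :
    AlmostAlwaysIsometry P R J where
  S := a.S ∩ b.S
  sub₁ := fun _ h => a.sub₁ h.1
  sub₂ := fun _ h => b.sub₂ h.2
  null₁ := measure_mono_null (t := (P.dom \ a.S) ∪ (Q.dom \ b.S)) (by
      intro t ht
      by_cases h : t ∈ a.S
      · exact Or.inr ⟨a.sub₂ h, fun h' => ht.2 ⟨h, h'⟩⟩
      · exact Or.inl ⟨ht.1, h⟩) (measure_union_null a.null₁ b.null₁)
  null₂ := measure_mono_null (t := (Q.dom \ a.S) ∪ (R.dom \ b.S)) (by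
      intro t ht
      by_cases h : t ∈ b.S
      · exact Or.inl ⟨b.sub₁ h, fun h' => ht.2 ⟨h', h⟩⟩
      · exact Or.inr ⟨ht.1, h⟩) (measure_union_null a.null₂ b.null₂)
  full := fun _ h => ⟨a.full h, b.full h⟩
  φ t ht := (a.φ t ht.1).trans (b.φ t ht.2)
  map_ν s t hs ht h x := by
    have e := b.map_ν s t hs.2 ht.2 h (a.φ t ht.1 x)
    rw [← a.map_ν s t hs.1 ht.1 h x, Measure.map_map (measurable_isometryEquiv _)
      (measurable_isometryEquiv _)] at e
    exact e
  map_μ t ht := by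
    have e := b.map_μ t ht.2
    rw [← a.map_μ t ht.1, Measure.map_map (measurable_isometryEquiv _)
      (measurable_isometryEquiv _)] at e
    exact e

/-- The equivalence relation on metric flow pairs over `I` that are fully defined over `J`. -/
def pairSetoid (I J : Set ℝ) : Setoid {P : MetricFlowPair.{u} I // P.FullyDefined J} where
  r P Q := Nonempty (AlmostAlwaysIsometry P.1 Q.1 J)
  iseqv :=
    { refl := fun P => ⟨.refl P.1 P.2⟩
      symm := fun ⟨a⟩ => ⟨a.symm⟩
      trans := fun ⟨a⟩ ⟨b⟩ => ⟨a.trans b⟩ }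

/-- The set `𝔽_I^J` of equivalence classes of metric flow pairs over `I` that are fully defined
over `J`. -/
def FSpace (I J : Set ℝ) : Type (u + 1) := Quotient (pairSetoid.{u} I J)

/-! ### Correspondences and the `𝔽`-distance -/

/-- A correspondence over `K ⊆ ℝ` between two metric flows. -/
structure Correspondence {A B : Set ℝ} (X : MetricFlow.{u} A) (Y : MetricFlow.{u} B)
    (K : Set ℝ) where
  Z : K → Type u
  [metric : ∀ t, MetricSpace (Z t)]
  [meas : ∀ t, MeasurableSpace (Z t)]
  [borel : ∀ t, BorelSpace (Z t)]
  dom₁ : Set ℝ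
  dom₂ : Set ℝ
  sub₁ : dom₁ ⊆ A
  sub₂ : dom₂ ⊆ B
  sub₁' : dom₁ ⊆ K
  sub₂' : dom₂ ⊆ K
  emb₁ : ∀ t (ht : t ∈ dom₁), X.slice ⟨t, sub₁ ht⟩ → Z ⟨t, sub₁' ht⟩
  emb₂ : ∀ t (ht : t ∈ dom₂), Y.slice ⟨t, sub₂ ht⟩ → Z ⟨t, sub₂' ht⟩
  isom₁ : ∀ t (ht : t ∈ dom₁), Isometry (emb₁ t ht)
  isom₂ : ∀ t (ht : t ∈ dom₂), Isometry (emb₂ t ht)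

attribute [instance] Correspondence.metric Correspondence.meas Correspondence.borel

/-- The correspondence is fully defined over `J`. -/
def Correspondence.FullyDefined {A B : Set ℝ} {X : MetricFlow.{u} A} {Y : MetricFlow.{u} B}
    {K : Set ℝ} (C : Correspondence X Y K) (J : Set ℝ) : Prop :=
  J ⊆ C.dom₁ ∧ J ⊆ C.dom₂

/-- The number `r` is admissible in the definition of the `𝔽`-distance within `C`, uniform over
`J`. The exceptional set `E` is Lebesgue measurable (it need not be a Borel set). -/
def Correspondence.Admissible {I₁ I₂ K : Set ℝ} {P : MetricFlowPair.{u} I₁}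
    {Q : MetricFlowPair.{u} I₂} (C : Correspondence P.flow Q.flow K) (J : Set ℝ) (r : ℝ) : Prop :=
  ∃ E : Set ℝ, E ⊆ K ∧ NullMeasurableSet E volume ∧ J ⊆ K \ E ∧
    volume E ≤ ENNReal.ofReal (r ^ 2) ∧
    ∃ (h₁ : K \ E ⊆ C.dom₁) (h₂ : K \ E ⊆ C.dom₂)
      (q : ∀ t (ht : t ∈ K \ E),
        Measure (P.flow.slice ⟨t, C.sub₁ (h₁ ht)⟩ × Q.flow.slice ⟨t, C.sub₂ (h₂ ht)⟩)),
      (∀ t (ht : t ∈ K \ E),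
        IsCoupling (q t ht) (P.μ ⟨t, C.sub₁ (h₁ ht)⟩) (Q.μ ⟨t, C.sub₂ (h₂ ht)⟩)) ∧
      ∀ s t (hs : s ∈ K \ E) (ht : t ∈ K \ E) (h : s ≤ t),
        ∫⁻ p, W1
          ((P.flow.ν (s := ⟨s, C.sub₁ (h₁ hs)⟩) (Subtype.mk_le_mk.2 h) p.1).map
            (C.emb₁ s (h₁ hs)))
          ((Q.flow.ν (s := ⟨s, C.sub₂ (h₂ hs)⟩) (Subtype.mk_le_mk.2 h) p.2).map
            (C.emb₂ s (h₂ hs))) ∂(q t ht) ≤ ENNReal.ofReal r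

/-- The `𝔽`-distance between two metric flow pairs within a correspondence, uniform over `J`. -/
noncomputable def dFWithin {I₁ I₂ K : Set ℝ} {P : MetricFlowPair.{u} I₁}
    {Q : MetricFlowPair.{u} I₂} (C : Correspondence P.flow Q.flow K) (J : Set ℝ) : ℝ≥0∞ :=
  ⨅ (r : ℝ) (_ : 0 < r ∧ C.Admissible J r), ENNReal.ofReal r

/-- The `𝔽`-distance between two metric flow pairs over `I`, uniform over `J`. -/
noncomputable def dFPair {I : Set ℝ} (J : Set ℝ) (P Q : MetricFlowPair.{u} I) : ℝ≥0∞ :=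
  ⨅ (C : Correspondence P.flow Q.flow I) (_ : C.FullyDefined J), dFWithin C J

/-- Transport of a correspondence along almost always isometries. -/
def Correspondence.transport {I J : Set ℝ} {P P' Q Q' : MetricFlowPair.{u} I}
    (a : AlmostAlwaysIsometry P P' J) (b : AlmostAlwaysIsometry Q Q' J)
    (C : Correspondence P.flow Q.flow I) : Correspondence P'.flow Q'.flow I where
  Z := C.Z
  dom₁ := C.dom₁ ∩ a.S
  dom₂ := C.dom₂ ∩ b.S
  sub₁ := fun _ h => a.sub₂ h.2
  sub₂ := fun _ h => b.sub₂ h.2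
  sub₁' := fun _ h => C.sub₁' h.1
  sub₂' := fun _ h => C.sub₂' h.1
  emb₁ t ht := C.emb₁ t ht.1 ∘ (a.φ t ht.2).symm
  emb₂ t ht := C.emb₂ t ht.1 ∘ (b.φ t ht.2).symm
  isom₁ t ht := (C.isom₁ t ht.1).comp (IsometryEquiv.isometry _)
  isom₂ t ht := (C.isom₂ t ht.1).comp (IsometryEquiv.isometry _)

theorem Correspondence.Admissible.transport {I J : Set ℝ} {P P' Q Q' : MetricFlowPair.{u} I}
    (a : AlmostAlwaysIsometry P P' J) (b : AlmostAlwaysIsometry Q Q' J)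
    {C : Correspondence P.flow Q.flow I} {r : ℝ} (hC : C.Admissible J r) :
    (C.transport a b).Admissible J r := by
  obtain ⟨E, hE, hm, hJ, hv, h₁, h₂, q, hq, hr⟩ := hC
  have hN : volume (I \ (a.S ∩ b.S)) = 0 := by
    refine measure_mono_null (t := ((I \ P.dom) ∪ (P.dom \ a.S)) ∪ ((I \ Q.dom) ∪ (Q.dom \ b.S)))
      ?_ (measure_union_null (measure_union_null P.null a.null₁)
        (measure_union_null Q.null b.null₁))
    intro t ht
    simp only [Set.mem_union, Set.mem_sdiff, Set.mem_inter_iff] at ht ⊢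
    tauto
  have hmem : ∀ t, t ∈ I \ (E ∪ I \ (a.S ∩ b.S)) → t ∈ I \ E ∧ t ∈ a.S ∧ t ∈ b.S := by
    intro t ht
    simp only [Set.mem_union, Set.mem_sdiff, Set.mem_inter_iff] at ht ⊢
    tauto
  refine ⟨E ∪ I \ (a.S ∩ b.S), Set.union_subset hE Set.sdiff_subset,
    hm.union (NullMeasurableSet.of_null hN), ?_, ?_,
    fun t ht => ⟨h₁ (hmem t ht).1, (hmem t ht).2.1⟩,
    fun t ht => ⟨h₂ (hmem t ht).1, (hmem t ht).2.2⟩,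
    fun t ht => (q t (hmem t ht).1).map
      (Prod.map (a.φ t (hmem t ht).2.1) (b.φ t (hmem t ht).2.2)), ?_, ?_⟩
  · intro t ht
    exact ⟨(hJ ht).1, fun h => h.elim (hJ ht).2 fun h' => h'.2 ⟨a.full ht, b.full ht⟩⟩
  · exact (measure_union_le _ _).trans (by rw [hN, add_zero]; exact hv)
  · intro t ht
    have ha := measurable_isometryEquiv (a.φ t (hmem t ht).2.1)
    have hb := measurable_isometryEquiv (b.φ t (hmem t ht).2.2)
    have hqt := hq t (hmem t ht).1
    constructor
    · rw [Measure.map_map measurable_fst (ha.prodMap hb), ← a.map_μ t (hmem t ht).2.1,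
        ← hqt.1, Measure.map_map ha measurable_fst]
      rfl
    · rw [Measure.map_map measurable_snd (ha.prodMap hb), ← b.map_μ t (hmem t ht).2.2,
        ← hqt.2, Measure.map_map hb measurable_snd]
      rfl
  · intro s t hs ht h
    have key := hr s t (hmem s hs).1 (hmem t ht).1 h
    have e := lintegral_map_equiv (μ := q t (hmem t ht).1)
      (fun p => W1
          ((P'.flow.ν (s := ⟨s, a.sub₂ (hmem s hs).2.1⟩) (t := ⟨t, a.sub₂ (hmem t ht).2.1⟩)
            (Subtype.mk_le_mk.2 h) p.1).map
            ((C.transport a b).emb₁ s ⟨h₁ (hmem s hs).1, (hmem s hs).2.1⟩))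
          ((Q'.flow.ν (s := ⟨s, b.sub₂ (hmem s hs).2.2⟩) (t := ⟨t, b.sub₂ (hmem t ht).2.2⟩)
            (Subtype.mk_le_mk.2 h) p.2).map
            ((C.transport a b).emb₂ s ⟨h₂ (hmem s hs).1, (hmem s hs).2.2⟩)))
      (MeasurableEquiv.prodCongr
        (a.φ t (hmem t ht).2.1).toHomeomorph.toMeasurableEquiv
        (b.φ t (hmem t ht).2.2).toHomeomorph.toMeasurableEquiv)
    refine (le_of_eq ?_).trans key
    refine e.trans (lintegral_congr fun p => ?_)
    have c₁ := a.map_ν s t (hmem s hs).2.1 (hmem t ht).2.1 h p.1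
    have c₂ := b.map_ν s t (hmem s hs).2.2 (hmem t ht).2.2 h p.2
    have m₁ := (C.isom₁ s (h₁ (hmem s hs).1)).continuous.measurable
    have m₂ := (C.isom₂ s (h₂ (hmem s hs).1)).continuous.measurable
    have d₁ : (P'.flow.ν (s := ⟨s, a.sub₂ (hmem s hs).2.1⟩) (t := ⟨t, a.sub₂ (hmem t ht).2.1⟩)
            (Subtype.mk_le_mk.2 h) (a.φ t (hmem t ht).2.1 p.1)).map
            (C.emb₁ s (h₁ (hmem s hs).1) ∘ (a.φ s (hmem s hs).2.1).symm) =
        (P.flow.ν (s := ⟨s, C.sub₁ (h₁ (hmem s hs).1)⟩) (Subtype.mk_le_mk.2 h) p.1).map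
            (C.emb₁ s (h₁ (hmem s hs).1)) := by
      rw [← c₁, Measure.map_map (m₁.comp (measurable_isometryEquiv _))
        (measurable_isometryEquiv _), Function.comp_assoc, IsometryEquiv.symm_comp_self,
        Function.comp_id]
    have d₂ : (Q'.flow.ν (s := ⟨s, b.sub₂ (hmem s hs).2.2⟩) (t := ⟨t, b.sub₂ (hmem t ht).2.2⟩)
            (Subtype.mk_le_mk.2 h) (b.φ t (hmem t ht).2.2 p.2)).map
            (C.emb₂ s (h₂ (hmem s hs).1) ∘ (b.φ s (hmem s hs).2.2).symm) =
        (Q.flow.ν (s := ⟨s, C.sub₂ (h₂ (hmem s hs).1)⟩) (Subtype.mk_le_mk.2 h) p.2).map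
            (C.emb₂ s (h₂ (hmem s hs).1)) := by
      rw [← c₂, Measure.map_map (m₂.comp (measurable_isometryEquiv _))
        (measurable_isometryEquiv _), Function.comp_assoc, IsometryEquiv.symm_comp_self,
        Function.comp_id]
    exact congrArg₂ W1 d₁ d₂

theorem dFPair_le_of_isometry {I J : Set ℝ} {P P' Q Q' : MetricFlowPair.{u} I}
    (a : AlmostAlwaysIsometry P P' J) (b : AlmostAlwaysIsometry Q Q' J) :
    dFPair J P' Q' ≤ dFPair J P Q :=
  le_iInf₂ fun C hC => (iInf₂_le (C.transport a b)
    ⟨fun _ h => ⟨hC.1 h, a.full h⟩, fun _ h => ⟨hC.2 h, b.full h⟩⟩).trans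
    (le_iInf₂ fun r hr => iInf₂_le r ⟨hr.1, hr.2.transport a b⟩)

/-- The `𝔽`-distance `d_𝔽^J` on `𝔽_I^J`, with values in `[0, ∞]`: the `𝔽`-distance of any two
representatives. -/
noncomputable def dF {I J : Set ℝ} (x y : FSpace.{u} I J) : ℝ≥0∞ :=
  Quotient.lift₂ (s₁ := pairSetoid.{u} I J) (s₂ := pairSetoid.{u} I J)
    (fun P Q => dFPair J P.1 Q.1)
    (fun _ _ _ _ ⟨a⟩ ⟨b⟩ =>
      le_antisymm (dFPair_le_of_isometry a.symm b.symm) (dFPair_le_of_isometry a b)) x y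

/-! The ambient spaces are first eliminated. Since time-slices are complete, couplings of
push-forwards into a common space lift to the slices, so the Wasserstein distance there equals the
transport cost for `c x y = d (f x) (g y)` (`W1_map_eq_otCost`). A correspondence matters only
through these bridges `c`, and `FClose` restates the 𝔽-distance with them. Gluing metric spaces and
couplings along the middle slice gives the triangle inequality (`FClose.trans`).

The gradient estimate must survive limits. `phi_dichotomy_iff` turns "constant or Φ of a Lipschitz
function" into a closed condition on pairs of values, `PhiStep`. For T > 0 the estimate becomes a
property `HeatStep` of two measures and the distance of their base points, stable under weak limits
and isometric embeddings. The case T = 0, with arbitrary measurable functions, is recovered by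
density of Lipschitz functions in L¹ (`HeatStep.phiStep_of_measurable`). `HeatStep` also makes the
kernels Lipschitz in the base point for the bounded Lipschitz distance (`BLClose`), with a constant
independent of the flow and of the two times.

Distance zero (`nonempty_isometry_of_forall_fClose`). Take closeness 2⁻ⁿ for every n. By
Borel–Cantelli almost every time is eventually good. At a good time the couplings converge along an
ultrafilter by Prokhorov. On the support of the limit coupling the bridges tend to 0, so the support
preserves distances; since the two measures have full support, it is the graph of an isometry. Near
each point of this graph the couplings keep mass bounded below, so some nearby pair of kernels has
small transport cost; equicontinuity in the base point then shows that the isometries intertwine the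
kernels (`map_eq_of_tendsto_otCost`).

Completeness (`exists_limit_of_fClose`). It suffices to treat successive closeness 2⁻ⁿ. At almost
every time, and at every time of J, all but finitely many slices embed into one Polish space
realizing the bridges, and the couplings are realized by one random sequence, of which consecutive
pairs have the prescribed laws. Its expected increments are summable, so it converges almost surely;
the limit slice is the support of the law of the limit. At a point of this support the kernels
converge along every approximating sequence (`AmbientSequence.exists_isKernelLimit`): almost every
path makes the Wasserstein distances of successive kernels summable, and equicontinuity compares
such paths with other sequences. The flow axioms then pass to the limit. Lower semicontinuity of the
Wasserstein distance bounds the distance to the limit by the tail 2 · 2⁻ⁿ. -/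

open Filter Topology ProbabilityTheory

/-! ### Optimal transport costs -/

section Coupling

theorem IsCoupling.isProbabilityMeasure {X Y : Type*} [MeasurableSpace X] [MeasurableSpace Y]
    {q : Measure (X × Y)} {μ : Measure X} {ν : Measure Y} [IsProbabilityMeasure μ]
    (h : IsCoupling q μ ν) : IsProbabilityMeasure q := by
  constructor
  have := measure_univ (μ := μ)
  rw [← h.1, Measure.map_apply measurable_fst MeasurableSet.univ] at this
  simpa using this

theorem IsCoupling.swap {X Y : Type*} [MeasurableSpace X] [MeasurableSpace Y]
    {q : Measure (X × Y)} {μ : Measure X} {ν : Measure Y}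
    (h : IsCoupling q μ ν) : IsCoupling (q.map Prod.swap) ν μ := by
  constructor
  · rw [Measure.map_map measurable_fst measurable_swap]; exact h.2
  · rw [Measure.map_map measurable_snd measurable_swap]; exact h.1

theorem IsCoupling.map {X Y X' Y' : Type*} [MeasurableSpace X] [MeasurableSpace Y]
    [MeasurableSpace X'] [MeasurableSpace Y']
    {q : Measure (X × Y)} {μ : Measure X} {ν : Measure Y}
    (h : IsCoupling q μ ν) {f : X → X'} {g : Y → Y'} (hf : Measurable f) (hg : Measurable g) :
    IsCoupling (q.map (Prod.map f g)) (μ.map f) (ν.map g) := by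
  constructor
  · rw [Measure.map_map measurable_fst (hf.prodMap hg), ← h.1, Measure.map_map hf measurable_fst]
    rfl
  · rw [Measure.map_map measurable_snd (hf.prodMap hg), ← h.2, Measure.map_map hg measurable_snd]
    rfl

/-- The diagonal coupling along a measurable map. -/
theorem isCoupling_graph {X Y : Type*} [MeasurableSpace X] [MeasurableSpace Y]
    (μ : Measure X) {f : X → Y} (hf : Measurable f) :
    IsCoupling (μ.map fun x => (x, f x)) μ (μ.map f) := by
  constructor
  · rw [Measure.map_map measurable_fst (by fun_prop)]; exact Measure.map_id
  · rw [Measure.map_map measurable_snd (by fun_prop)]; rfl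

/-- A coupling of push-forwards under measurable embeddings comes from a coupling. -/
theorem IsCoupling.exists_map_eq {X Y X' Y' : Type*} [MeasurableSpace X] [MeasurableSpace Y]
    [MeasurableSpace X'] [MeasurableSpace Y']
    {μ : Measure X} {ν : Measure Y} {f : X → X'} {g : Y → Y'} (hf : MeasurableEmbedding f)
    (hg : MeasurableEmbedding g) {q : Measure (X' × Y')}
    (h : IsCoupling q (μ.map f) (ν.map g)) :
    ∃ p : Measure (X × Y), IsCoupling p μ ν ∧ p.map (Prod.map f g) = q := by
  have hfg := hf.prodMap hg
  have hmap : (q.comap (Prod.map f g)).map (Prod.map f g) = q := by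
    -- Both marginals of `q` live on the ranges, so restricting `q` to the range of the product map
    -- loses no mass.
    rw [hfg.map_comap, Measure.restrict_eq_self_of_ae_mem]
    have h1 : ∀ᵐ z ∂q, z.1 ∈ Set.range f := by
      have : ∀ᵐ x ∂(q.map Prod.fst), x ∈ Set.range f := by
        rw [h.1, hf.ae_map_iff]
        exact ae_of_all _ fun x => ⟨x, rfl⟩
      exact ae_of_ae_map measurable_fst.aemeasurable this
    have h2 : ∀ᵐ z ∂q, z.2 ∈ Set.range g := by
      have : ∀ᵐ x ∂(q.map Prod.snd), x ∈ Set.range g := by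
        rw [h.2, hg.ae_map_iff]
        exact ae_of_all _ fun x => ⟨x, rfl⟩
      exact ae_of_ae_map measurable_snd.aemeasurable this
    filter_upwards [h1, h2] with z ⟨x, hx⟩ ⟨y, hy⟩
    exact ⟨(x, y), Prod.ext hx hy⟩
  refine ⟨q.comap (Prod.map f g), ⟨?_, ?_⟩, hmap⟩
  · have e := h.1
    rw [← hmap, Measure.map_map measurable_fst hfg.measurable] at e
    have e' : ((q.comap (Prod.map f g)).map Prod.fst).map f = μ.map f := by
      rw [Measure.map_map hf.measurable measurable_fst]; exact e
    rw [← hf.comap_map μ, ← e', hf.comap_map]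
  · have e := h.2
    rw [← hmap, Measure.map_map measurable_snd hfg.measurable] at e
    have e' : ((q.comap (Prod.map f g)).map Prod.snd).map g = ν.map g := by
      rw [Measure.map_map hg.measurable measurable_snd]; exact e
    rw [← hg.comap_map ν, ← e', hg.comap_map]

/-- The optimal transport cost between `μ` and `ν` with respect to the cost function `c`. -/
noncomputable def otCost {X Y : Type*} [MeasurableSpace X] [MeasurableSpace Y]
    (c : X → Y → ℝ≥0∞) (μ : Measure X) (ν : Measure Y) : ℝ≥0∞ :=
  ⨅ (q : Measure (X × Y)) (_ : IsCoupling q μ ν), ∫⁻ z, c z.1 z.2 ∂q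

theorem otCost_le {X Y : Type*} [MeasurableSpace X] [MeasurableSpace Y]
    {c : X → Y → ℝ≥0∞} {μ : Measure X} {ν : Measure Y} {q : Measure (X × Y)}
    (h : IsCoupling q μ ν) : otCost c μ ν ≤ ∫⁻ z, c z.1 z.2 ∂q := iInf₂_le q h

theorem exists_coupling_of_otCost_lt {X Y : Type*} [MeasurableSpace X] [MeasurableSpace Y]
    {c : X → Y → ℝ≥0∞} {μ : Measure X} {ν : Measure Y} {a : ℝ≥0∞} (h : otCost c μ ν < a) :
    ∃ q, IsCoupling q μ ν ∧ ∫⁻ z, c z.1 z.2 ∂q < a := by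
  simp only [otCost, iInf_lt_iff] at h
  obtain ⟨q, hq, h⟩ := h
  exact ⟨q, hq, h⟩

theorem Isometry.measurableEmbedding {X Z : Type*} [MetricSpace X] [MeasurableSpace X]
    [BorelSpace X] [CompleteSpace X] [MetricSpace Z] [MeasurableSpace Z] [BorelSpace Z] {f : X → Z}
    (hf : Isometry f) : MeasurableEmbedding f :=
  hf.isClosedEmbedding.measurableEmbedding

/-- Isometric images of complete spaces are closed, so both embeddings are measurable embeddings and
couplings correspond upstairs and downstairs. The ambient space then enters only through the cost.
-/
theorem W1_map_eq_otCost {X Y Z : Type*} [MetricSpace X] [MeasurableSpace X] [BorelSpace X]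
    [CompleteSpace X] [MetricSpace Y] [MeasurableSpace Y] [BorelSpace Y] [CompleteSpace Y]
    [MetricSpace Z] [MeasurableSpace Z] [BorelSpace Z] {f : X → Z} {g : Y → Z} (hf : Isometry f) (hg : Isometry g)
    (μ : Measure X) (ν : Measure Y) :
    W1 (μ.map f) (ν.map g) = otCost (fun x y => edist (f x) (g y)) μ ν := by
  have hfe := hf.measurableEmbedding
  have hge := hg.measurableEmbedding
  have key : ∀ p : Measure (X × Y), ∫⁻ z, edist z.1 z.2 ∂(p.map (Prod.map f g)) =
      ∫⁻ z, edist (f z.1) (g z.2) ∂p := fun p => (hfe.prodMap hge).lintegral_map _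
  refine le_antisymm (le_iInf₂ fun p hp => ?_) (le_iInf₂ fun q hq => ?_)
  · rw [← key]
    exact iInf₂_le (p.map (Prod.map f g)) (hp.map hfe.measurable hge.measurable)
  · obtain ⟨p, hp, rfl⟩ := hq.exists_map_eq hfe hge
    rw [key]
    exact otCost_le hp

theorem otCost_swap {X Y : Type*} [MeasurableSpace X] [MeasurableSpace Y]
    (c : X → Y → ℝ≥0∞) (μ : Measure X) (ν : Measure Y) :
    otCost (fun y x => c x y) ν μ = otCost c μ ν := by
  refine le_antisymm (le_iInf₂ fun q hq => (otCost_le hq.swap).trans (lintegral_map_le _ _))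
    (le_iInf₂ fun q hq => (otCost_le hq.swap).trans (lintegral_map_le _ _))

/-- Two couplings with a common marginal can be glued. -/
theorem exists_gluing {X Y W : Type*} [MeasurableSpace X] [MeasurableSpace Y] [MeasurableSpace W]
    [StandardBorelSpace W]
    {μ : Measure X} {ν : Measure Y} {ρ : Measure W} [IsProbabilityMeasure ν]
    {q : Measure (X × Y)} {p : Measure (Y × W)} (hq : IsCoupling q μ ν) (hp : IsCoupling p ν ρ) :
    ∃ π : Measure ((X × Y) × W), π.map Prod.fst = q ∧ π.map (fun z => (z.1.2, z.2)) = p := by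
  have hpp := hp.isProbabilityMeasure
  have hqp : IsProbabilityMeasure q := by
    have := hq.swap.isProbabilityMeasure
    constructor
    have := measure_univ (μ := q.map Prod.swap)
    rw [Measure.map_apply measurable_swap MeasurableSet.univ] at this
    simpa using this
  have : Nonempty W := by
    by_contra hW
    rw [not_nonempty_iff] at hW
    have : p Set.univ = 0 := by
      rw [Set.univ_eq_empty_iff.2 inferInstance]; simp
    simp at this
  -- Given `(x, y)`, the third coordinate is drawn from the conditional law of `p` given `y` alone.
  let κ : Kernel (X × Y) W := p.condKernel.comap Prod.snd measurable_snd
  refine ⟨q ⊗ₘ κ, Measure.fst_compProd q κ, ?_⟩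
  have hd : ν ⊗ₘ p.condKernel = p := by
    have := p.disintegrate p.condKernel
    rwa [show p.fst = ν from hp.1] at this
  conv_rhs => rw [← hd, ← hq.2]
  ext s hs
  rw [Measure.map_apply (by fun_prop) hs, Measure.compProd_apply (by measurability),
    Measure.compProd_apply hs, lintegral_map _ measurable_snd]
  · rfl
  · exact Kernel.measurable_kernel_prodMk_left hs

/-- Near-optimal couplings are glued over the middle measure. Three different costs are allowed, as
needed for composing bridges. -/
theorem otCost_triangle {X Y W : Type*} [MeasurableSpace X] [MeasurableSpace Y]
    [MeasurableSpace W] [StandardBorelSpace W]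
    {c₁ : X → Y → ℝ≥0∞} {c₂ : Y → W → ℝ≥0∞} {c : X → W → ℝ≥0∞}
    (h₁ : Measurable (Function.uncurry c₁))
    (h₂ : Measurable (Function.uncurry c₂))
    (h : ∀ x y w, c x w ≤ c₁ x y + c₂ y w)
    (μ : Measure X) (ν : Measure Y) (ρ : Measure W) [IsProbabilityMeasure ν] :
    otCost c μ ρ ≤ otCost c₁ μ ν + otCost c₂ ν ρ := by
  refine ENNReal.le_of_forall_pos_le_add fun ε hε hlt => ?_
  have hε2 : (ε : ℝ≥0∞) / 2 ≠ 0 := by simp [hε.ne']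
  obtain ⟨q, hq, hq'⟩ := exists_coupling_of_otCost_lt
    (ENNReal.lt_add_right (lt_of_le_of_lt le_self_add hlt).ne hε2)
  obtain ⟨p, hp, hp'⟩ := exists_coupling_of_otCost_lt
    (ENNReal.lt_add_right (lt_of_le_of_lt le_add_self hlt).ne hε2)
  obtain ⟨π, hπ₁, hπ₂⟩ := exists_gluing hq hp
  have m₁ : Measurable fun z : (X × Y) × W => z.1.1 := by fun_prop
  have m₂ : Measurable fun z : (X × Y) × W => (z.1.2, z.2) := by fun_prop
  have hc : IsCoupling (π.map fun z => (z.1.1, z.2)) μ ρ := by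
    constructor
    · rw [Measure.map_map measurable_fst (by fun_prop), ← hq.1, ← hπ₁,
        Measure.map_map measurable_fst measurable_fst]
      rfl
    · rw [Measure.map_map measurable_snd (by fun_prop), ← hp.2, ← hπ₂,
        Measure.map_map measurable_snd m₂]
      rfl
  calc otCost c μ ρ ≤ _ := otCost_le hc
    _ ≤ ∫⁻ z, c z.1.1 z.2 ∂π := lintegral_map_le _ _
    _ ≤ ∫⁻ z, c₁ z.1.1 z.1.2 + c₂ z.1.2 z.2 ∂π := lintegral_mono fun z => h _ _ _
    _ = ∫⁻ z, c₁ z.1.1 z.1.2 ∂π + ∫⁻ z, c₂ z.1.2 z.2 ∂π :=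
        lintegral_add_left (h₁.comp measurable_fst) _
    _ = ∫⁻ z, c₁ z.1 z.2 ∂q + ∫⁻ z, c₂ z.1 z.2 ∂p := by
        rw [← hπ₁, ← hπ₂]
        exact (congrArg₂ (· + ·) (lintegral_map h₁ measurable_fst) (lintegral_map h₂ m₂)).symm
    _ ≤ (otCost c₁ μ ν + ε / 2) + (otCost c₂ ν ρ + ε / 2) := add_le_add hq'.le hp'.le
    _ = otCost c₁ μ ν + otCost c₂ ν ρ + ε := by
        rw [add_add_add_comm, ENNReal.add_halves]

end Coupling

/-! ### Compactness of couplings, semicontinuity of transport costs, chains of couplings -/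

section Marginals

variable {X Y : Type*}
variable [MetricSpace X] [MeasurableSpace X] [BorelSpace X] [CompleteSpace X]
  [SecondCountableTopology X]
variable [MetricSpace Y] [MeasurableSpace Y] [BorelSpace Y] [CompleteSpace Y]
  [SecondCountableTopology Y]

/-- The pair of marginals of a probability measure on a product. -/
noncomputable def marginals {X Y : Type*} [MeasurableSpace X] [MeasurableSpace Y]
    (q : ProbabilityMeasure (X × Y)) : ProbabilityMeasure X × ProbabilityMeasure Y :=
  (q.map measurable_fst.aemeasurable, q.map measurable_snd.aemeasurable)

theorem marginals_eq_iff {X Y : Type*} [MeasurableSpace X] [MeasurableSpace Y]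
    {q : ProbabilityMeasure (X × Y)} {μ : ProbabilityMeasure X} {ν : ProbabilityMeasure Y} :
    marginals q = (μ, ν) ↔ IsCoupling (q : Measure (X × Y)) (μ : Measure X) (ν : Measure Y) := by
  simp only [marginals, Prod.mk.injEq, IsCoupling]
  exact and_congr ⟨fun h => congrArg ProbabilityMeasure.toMeasure h, fun h => Subtype.ext h⟩
    ⟨fun h => congrArg ProbabilityMeasure.toMeasure h, fun h => Subtype.ext h⟩

theorem continuous_marginals {X Y : Type*} [MetricSpace X] [MeasurableSpace X] [BorelSpace X]
    [MetricSpace Y] [MeasurableSpace Y] [BorelSpace Y] [SecondCountableTopology Y] :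
    Continuous (marginals (X := X) (Y := Y)) :=
  (ProbabilityMeasure.continuous_map continuous_fst).prodMk
    (ProbabilityMeasure.continuous_map continuous_snd)

/-- By Prokhorov's theorem the set of couplings of measures in a compact set is compact. -/
theorem isProperMap_marginals : IsProperMap (marginals (X := X) (Y := Y)) := by
  rw [isProperMap_iff_isCompact_preimage]
  refine ⟨continuous_marginals, fun K hK => ?_⟩
  have h1 : IsTightMeasureSet {((μ : ProbabilityMeasure X) : Measure X) | μ ∈ Prod.fst '' K} := by
    refine isTightMeasureSet_of_isCompact_closure ?_
    rw [(hK.image continuous_fst).isClosed.closure_eq]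
    exact hK.image continuous_fst
  have h2 : IsTightMeasureSet {((μ : ProbabilityMeasure Y) : Measure Y) | μ ∈ Prod.snd '' K} := by
    refine isTightMeasureSet_of_isCompact_closure ?_
    rw [(hK.image continuous_snd).isClosed.closure_eq]
    exact hK.image continuous_snd
  have h3 : IsTightMeasureSet
      {((q : ProbabilityMeasure (X × Y)) : Measure (X × Y)) | q ∈ marginals ⁻¹' K} := by
    refine IsTightMeasureSet.prodMk (h1.subset ?_) (h2.subset ?_)
    · rintro _ ⟨_, ⟨q, hq, rfl⟩, rfl⟩
      exact ⟨_, ⟨_, hq, rfl⟩, rfl⟩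
    · rintro _ ⟨_, ⟨q, hq, rfl⟩, rfl⟩
      exact ⟨_, ⟨_, hq, rfl⟩, rfl⟩
  exact (isCompact_closure_of_isTightMeasureSet h3).of_isClosed_subset
    (hK.isClosed.preimage continuous_marginals) subset_closure

/-- Couplings of convergent measures converge along ultrafilters. -/
theorem exists_tendsto_coupling {ι : Type*} (F : Ultrafilter ι) {μ : ι → ProbabilityMeasure X}
    {ν : ι → ProbabilityMeasure Y} {μ' : ProbabilityMeasure X} {ν' : ProbabilityMeasure Y}
    (hμ : Tendsto μ F (𝓝 μ')) (hν : Tendsto ν F (𝓝 ν'))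
    {q : ι → ProbabilityMeasure (X × Y)}
    (hq : ∀ᶠ i in F, IsCoupling (q i : Measure (X × Y)) (μ i : Measure X) (ν i : Measure Y)) :
    ∃ q' : ProbabilityMeasure (X × Y), IsCoupling (q' : Measure (X × Y)) (μ' : Measure X) ν' ∧
      Tendsto q F (𝓝 q') := by
  have : Tendsto marginals (F.map q : Filter (ProbabilityMeasure (X × Y))) (𝓝 (μ', ν')) := by
    rw [Ultrafilter.coe_map, tendsto_map'_iff]
    refine (hμ.prodMk_nhds hν).congr' ?_
    filter_upwards [hq] with i hi
    exact (marginals_eq_iff.2 hi).symm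
  obtain ⟨q', h, h'⟩ := isProperMap_marginals.ultrafilter_le_nhds_of_tendsto this
  exact ⟨q', marginals_eq_iff.1 h, h'⟩

/-- The truncations `min c n` are bounded and continuous, hence pass to the weak limit; monotone
convergence removes the truncation. -/
theorem lintegral_le_of_tendsto_of_continuous {X : Type*} [TopologicalSpace X]
    [MeasurableSpace X] [OpensMeasurableSpace X] {ι : Type*} {F : Filter ι} [F.NeBot]
    {q : ι → ProbabilityMeasure X}
    {q' : ProbabilityMeasure X} (hq : Tendsto q F (𝓝 q')) {c : X → ℝ≥0∞} (hc : Continuous c)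
    {a : ℝ≥0∞} (h : ∀ᶠ i in F, ∫⁻ x, c x ∂(q i : Measure X) ≤ a) :
    ∫⁻ x, c x ∂(q' : Measure X) ≤ a := by
  have key : ∀ n : ℕ, ∫⁻ x, min (c x) n ∂(q' : Measure X) ≤ a := by
    intro n
    let g : X → ℝ≥0 := fun x => (min (c x) n).toNNReal
    have hg : ∀ x, (g x : ℝ≥0∞) = min (c x) n := fun x =>
      ENNReal.coe_toNNReal (ne_top_of_le_ne_top (ENNReal.natCast_ne_top n) (min_le_right _ _))
    have hgc : Continuous g := by
      rw [← ENNReal.continuous_coe_iff]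
      simp only [hg]
      exact hc.min continuous_const
    have hgn : ∀ x, g x ≤ n := fun x => by
      rw [← ENNReal.coe_le_coe, hg]
      exact_mod_cast min_le_right _ _
    let G : BoundedContinuousFunction X ℝ≥0 :=
      BoundedContinuousFunction.mkOfBound ⟨g, hgc⟩ n fun x y => by
        have hx : (g x : ℝ) ≤ n := by exact_mod_cast hgn x
        have hy : (g y : ℝ) ≤ n := by exact_mod_cast hgn y
        have := (g x).coe_nonneg
        have := (g y).coe_nonneg
        simp only [ContinuousMap.coe_mk, NNReal.dist_eq]
        rw [abs_le]
        constructor <;> linarith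
    have ht := (ProbabilityMeasure.tendsto_iff_forall_lintegral_tendsto.1 hq) G
    simp only [← hg]
    change ∫⁻ x, (G x : ℝ≥0∞) ∂(q' : Measure X) ≤ a
    refine le_of_tendsto ht (h.mono fun i hi => le_trans (lintegral_mono fun x => ?_) hi)
    change (g x : ℝ≥0∞) ≤ c x
    rw [hg]
    exact min_le_left _ _
  have hsup : ∀ x, c x = ⨆ n : ℕ, min (c x) n := fun x => by
    refine le_antisymm (le_of_forall_lt fun b hb => ?_) (iSup_le fun n => min_le_left _ _)
    obtain ⟨n, hn⟩ := ENNReal.exists_nat_gt hb.ne_top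
    exact (lt_min hb hn).trans_le (le_iSup (fun n : ℕ => min (c x) n) n)
  calc ∫⁻ x, c x ∂(q' : Measure X) = ∫⁻ x, ⨆ n : ℕ, min (c x) n ∂(q' : Measure X) :=
        lintegral_congr hsup
    _ = ⨆ n : ℕ, ∫⁻ x, min (c x) n ∂(q' : Measure X) :=
        lintegral_iSup (fun n => (hc.min continuous_const).measurable) fun m n hmn x =>
          min_le_min le_rfl (by exact_mod_cast hmn)
    _ ≤ a := iSup_le key

/-- Were the cost to drop near `(μ, ν)`, cheap couplings along an ultrafilter would converge by
Prokhorov to a coupling of `μ` and `ν` that is too cheap. -/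
theorem lowerSemicontinuous_otCost {c : X → Y → ℝ≥0∞} (hc : Continuous (Function.uncurry c)) :
    LowerSemicontinuous fun p : ProbabilityMeasure X × ProbabilityMeasure Y =>
      otCost c (p.1 : Measure X) (p.2 : Measure Y) := by
  rintro ⟨μ, ν⟩ a ha
  by_contra hcon
  obtain ⟨b, hab, hb⟩ := exists_between ha
  rw [not_eventually] at hcon
  obtain ⟨F, hF⟩ := Filter.exists_ultrafilter_iff.2 (Filter.frequently_iff_neBot.1 hcon)
  rw [le_inf_iff, le_principal_iff] at hF
  have : ∀ p : ProbabilityMeasure X × ProbabilityMeasure Y,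
      ∃ q : ProbabilityMeasure (X × Y), otCost c (p.1 : Measure X) (p.2 : Measure Y) < b →
        IsCoupling (q : Measure (X × Y)) (p.1 : Measure X) (p.2 : Measure Y) ∧
          ∫⁻ z, c z.1 z.2 ∂(q : Measure (X × Y)) ≤ b := by
    intro p
    by_cases h : otCost c (p.1 : Measure X) (p.2 : Measure Y) < b
    · obtain ⟨q, hq, hq'⟩ := exists_coupling_of_otCost_lt h
      exact ⟨⟨q, hq.isProbabilityMeasure⟩, fun _ => ⟨hq, hq'.le⟩⟩
    · exact ⟨p.1.prod p.2, fun h' => absurd h' h⟩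
  choose q hq using this
  have hev : ∀ᶠ p in (F : Filter (ProbabilityMeasure X × ProbabilityMeasure Y)),
      otCost c (p.1 : Measure X) (p.2 : Measure Y) < b := by
    filter_upwards [hF.2] with p hp
    exact (not_lt.1 hp).trans_lt hab
  obtain ⟨q', hq', hlim⟩ := exists_tendsto_coupling F
    ((continuous_fst.tendsto (μ, ν)).comp hF.1) ((continuous_snd.tendsto (μ, ν)).comp hF.1)
    (q := q) (hev.mono fun p hp => (hq p hp).1)
  have := lintegral_le_of_tendsto_of_continuous hlim (c := fun z => c z.1 z.2) hc
    (hev.mono fun p hp => (hq p hp).2)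
  exact absurd ((otCost_le hq').trans this) (not_le.2 hb)

/-- Lower semicontinuous functions of weakly continuous kernels are measurable; this permits the
integrals of transport costs to be added and transported. -/
theorem measurable_otCost {A B : Type*} [TopologicalSpace A] [TopologicalSpace B]
    [MeasurableSpace A] [MeasurableSpace B] [OpensMeasurableSpace (A × B)]
    {c : X → Y → ℝ≥0∞} (hc : Continuous (Function.uncurry c))
    {κ : A → ProbabilityMeasure X} (hκ : Continuous κ) {η : B → ProbabilityMeasure Y}
    (hη : Continuous η) :
    Measurable fun p : A × B => otCost c (κ p.1 : Measure X) (η p.2 : Measure Y) :=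
  ((lowerSemicontinuous_otCost hc).comp (hκ.prodMap hη)).measurable

/-- A sequence of couplings of consecutive measures is realized by a random sequence. -/
theorem exists_chain {Z : Type*} [MeasurableSpace Z] [StandardBorelSpace Z] [Nonempty Z]
    {m : ℕ → Measure Z} [∀ n, IsProbabilityMeasure (m n)] {q : ℕ → Measure (Z × Z)}
    (hq : ∀ n, IsCoupling (q n) (m n) (m (n + 1))) :
    ∃ P : Measure (ℕ → Z), IsProbabilityMeasure P ∧
      ∀ n, P.map (fun y => (y n, y (n + 1))) = q n := by
  have hqp : ∀ n, IsProbabilityMeasure (q n) := fun n => (hq n).isProbabilityMeasure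
  -- A Markov chain: the next term depends only on the last one, through the conditional law of `q
  -- n`. The Ionescu-Tulcea construction gives its law.
  let κ : ∀ n : ℕ, Kernel (Π _ : Finset.Iic n, Z) Z := fun n =>
    (q n).condKernel.comap (fun x => x ⟨n, by simp⟩) (by fun_prop)
  let P := Kernel.trajMeasure (X := fun _ => Z) (m 0) κ
  have hstep : ∀ n, P.map (fun y => y n) = m n → P.map (fun y => (y n, y (n + 1))) = q n := by
    intro n hn
    have h := Kernel.map_frestrictLe_trajMeasure_compProd_eq_map_trajMeasure (X := fun _ => Z)
      (μ₀ := m 0) (κ := κ) (a := n)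
    have hd : m n ⊗ₘ (q n).condKernel = q n := by
      have := (q n).disintegrate (q n).condKernel
      rwa [show (q n).fst = m n from (hq n).1] at this
    have e : P.map (fun y => (y n, y (n + 1))) =
        (P.map (fun y => (Preorder.frestrictLe n y, y (n + 1)))).map
          (fun z => (z.1 ⟨n, by simp⟩, z.2)) := by
      rw [Measure.map_map (by fun_prop) (by fun_prop)]
      rfl
    rw [e, ← h]
    conv_rhs => rw [← hd, ← hn]
    ext s hs
    rw [Measure.map_apply (by fun_prop) hs, Measure.compProd_apply (by measurability),
      Measure.compProd_apply hs, lintegral_map _ (by fun_prop), lintegral_map _ (by fun_prop)]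
    · rfl
    · exact Kernel.measurable_kernel_prodMk_left hs
    · exact Kernel.measurable_kernel_prodMk_left (by measurability)
  have hm : ∀ n, P.map (fun y => y n) = m n := by
    intro n
    induction n with
    | zero =>
      have h0 : P.map (Preorder.frestrictLe 0) =
          (m 0).map (MeasurableEquiv.piUnique fun _ : Finset.Iic 0 => Z).symm := by
        rw [show P = Kernel.trajMeasure (X := fun _ => Z) (m 0) κ from rfl, Kernel.trajMeasure,
          Measure.map_comp _ _ (by fun_prop), Kernel.traj_map_frestrictLe, Kernel.partialTraj_self,
          Measure.id_comp]
      have e : P.map (fun y => y 0) =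
          (P.map (Preorder.frestrictLe 0)).map (fun z => z ⟨0, by simp⟩) := by
        rw [Measure.map_map (by fun_prop) (by fun_prop)]
        rfl
      rw [e, h0, Measure.map_map (by fun_prop) (by fun_prop)]
      exact Measure.map_id
    | succ n ih =>
      rw [← (hq n).2, ← hstep n ih, Measure.map_map measurable_snd (by fun_prop)]
      rfl
  exact ⟨P, inferInstance, fun n => hstep n (hm n)⟩

end Marginals

/-! ### The function `Φ` -/

theorem phi_eq_cdf (x : ℝ) : Phi x = cdf (gaussianReal 0 2) x := by
  have h : ∀ y : ℝ, (4 * Real.pi) ^ (-(1 / 2) : ℝ) * Real.exp (-y ^ 2 / 4) =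
      gaussianPDFReal 0 2 y := by
    intro y
    rw [gaussianPDFReal, Real.rpow_neg (by positivity), ← Real.sqrt_eq_rpow]
    congr 3
    · rw [NNReal.coe_ofNat]; ring
    · ring
    · rw [NNReal.coe_ofNat]; norm_num
  rw [cdf_eq_real, measureReal_def, gaussianReal_apply_eq_integral 0 (by norm_num), Phi,
    ENNReal.toReal_ofReal (setIntegral_nonneg measurableSet_Iic fun y _ =>
      gaussianPDFReal_nonneg _ _ _)]
  simp only [h]

theorem tendsto_phi_atBot : Tendsto Phi atBot (𝓝 0) := by
  exact (funext phi_eq_cdf : Phi = _) ▸ tendsto_cdf_atBot (gaussianReal 0 2)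

theorem tendsto_phi_atTop : Tendsto Phi atTop (𝓝 1) := by
  exact (funext phi_eq_cdf : Phi = _) ▸ tendsto_cdf_atTop (gaussianReal 0 2)

theorem phi_sub_phi (a b : ℝ) :
    Phi b - Phi a = ∫ y in a..b, (4 * Real.pi) ^ (-(1 / 2) : ℝ) * Real.exp (-y ^ 2 / 4) := by
  have hi : Integrable fun y : ℝ => (4 * Real.pi) ^ (-(1 / 2) : ℝ) * Real.exp (-y ^ 2 / 4) := by
    refine Integrable.const_mul ?_ _
    convert! integrable_exp_neg_mul_sq (b := 1 / 4) (by norm_num) using 3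
    ring
  exact intervalIntegral.integral_Iic_sub_Iic hi.integrableOn hi.integrableOn

theorem intervalIntegrable_phi_density (a b : ℝ) : IntervalIntegrable
    (fun y : ℝ => (4 * Real.pi) ^ (-(1 / 2) : ℝ) * Real.exp (-y ^ 2 / 4)) volume a b :=
  Continuous.intervalIntegrable (by fun_prop) a b

theorem strictMono_phi : StrictMono Phi := fun a b hab => by
  rw [← sub_pos, phi_sub_phi]
  exact intervalIntegral.intervalIntegral_pos_of_pos (intervalIntegrable_phi_density a b)
    (fun y => by positivity) hab

theorem phi_density_le_one (y : ℝ) :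
    (4 * Real.pi) ^ (-(1 / 2) : ℝ) * Real.exp (-y ^ 2 / 4) ≤ 1 := by
  have h1 : (4 * Real.pi) ^ (-(1 / 2) : ℝ) ≤ 1 :=
    Real.rpow_le_one_of_one_le_of_nonpos (by linarith [Real.pi_gt_three]) (by norm_num)
  have h2 : Real.exp (-y ^ 2 / 4) ≤ 1 := Real.exp_le_one_iff.2 (by nlinarith [sq_nonneg y])
  exact mul_le_one₀ h1 (Real.exp_pos _).le h2

theorem phi_sub_phi_le {a b : ℝ} (hab : a ≤ b) : Phi b - Phi a ≤ b - a := by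
  rw [phi_sub_phi]
  calc _ ≤ ∫ _ in a..b, (1 : ℝ) := intervalIntegral.integral_mono_on hab
        (intervalIntegrable_phi_density a b) (by simp) fun y _ => phi_density_le_one y
    _ = b - a := by simp

theorem lipschitzWith_phi : LipschitzWith 1 Phi := by
  refine LipschitzWith.of_le_add fun a b => ?_
  rcases le_total a b with h | h
  · exact (strictMono_phi.monotone h).trans (by linarith [dist_nonneg (x := a) (y := b)])
  · have := phi_sub_phi_le h
    rw [Real.dist_eq, abs_of_nonneg (by linarith)]
    linarith

theorem phi_pos (x : ℝ) : 0 < Phi x :=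
  lt_of_le_of_lt (strictMono_phi.monotone.le_of_tendsto tendsto_phi_atBot (x - 1))
    (strictMono_phi (by linarith))

theorem phi_lt_one (x : ℝ) : Phi x < 1 :=
  lt_of_lt_of_le (strictMono_phi (show x < x + 1 by linarith))
    (strictMono_phi.monotone.ge_of_tendsto tendsto_phi_atTop (x + 1))

theorem exists_phi_eq {v : ℝ} (h0 : 0 < v) (h1 : v < 1) : ∃ x, Phi x = v := by
  obtain ⟨a, ha⟩ := (tendsto_phi_atBot.eventually_lt_const h0).exists
  obtain ⟨b, hb⟩ := (tendsto_phi_atTop.eventually_const_lt h1).exists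
  exact mem_range_of_exists_le_of_exists_ge lipschitzWith_phi.continuous ⟨a, ha.le⟩ ⟨b, hb.le⟩

/-- On intervals away from `0` and `1` the inverse of `Φ` is Lipschitz. -/
theorem exists_phi_antilipschitz {δ : ℝ} (hδ : 0 < δ) :
    ∃ C : ℝ≥0, 0 < C ∧ ∀ a b : ℝ, Phi a ∈ Set.Icc δ (1 - δ) → Phi b ∈ Set.Icc δ (1 - δ) →
      |a - b| ≤ C * |Phi a - Phi b| := by
  obtain ⟨R₁, hR₁⟩ := (tendsto_phi_atBot.eventually_lt_const hδ).exists
  obtain ⟨R₂, hR₂⟩ := (tendsto_phi_atTop.eventually_const_lt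
    (show 1 - δ < 1 by linarith)).exists
  set R := max |R₁| |R₂|
  -- The density at `±R`, its minimum on `[-R, R]`, hence a lower bound for the slope of `Phi`
  -- there.
  set c : ℝ := (4 * Real.pi) ^ (-(1 / 2) : ℝ) * Real.exp (-R ^ 2 / 4)
  have hc : 0 < c := by positivity
  have hmem : ∀ a, Phi a ∈ Set.Icc δ (1 - δ) → |a| ≤ R := by
    intro a ha
    have h1 : R₁ ≤ a := (strictMono_phi.lt_iff_lt.1 (hR₁.trans_le ha.1)).le
    have h2 : a ≤ R₂ := (strictMono_phi.lt_iff_lt.1 (ha.2.trans_lt hR₂)).le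
    rw [abs_le]
    constructor
    · linarith [neg_abs_le R₁, le_max_left |R₁| |R₂|]
    · linarith [le_abs_self R₂, le_max_right |R₁| |R₂|]
  have key : ∀ a b, a ≤ b → |a| ≤ R → |b| ≤ R → c * (b - a) ≤ Phi b - Phi a := by
    intro a b hab ha hb
    rw [phi_sub_phi]
    calc c * (b - a) = ∫ _ in a..b, c := by simp [mul_comm]
      _ ≤ _ := intervalIntegral.integral_mono_on hab (by simp)
        (intervalIntegrable_phi_density a b) fun y hy => ?_
    refine mul_le_mul_of_nonneg_left (Real.exp_le_exp.2 ?_) (by positivity)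
    have : y ^ 2 ≤ R ^ 2 := by
      rw [← sq_abs y]
      have : |y| ≤ R := abs_le.2 ⟨by linarith [hy.1, neg_abs_le a], by linarith [hy.2, le_abs_self b]⟩
      exact pow_le_pow_left₀ (abs_nonneg _) this 2
    linarith
  refine ⟨⟨c⁻¹, by positivity⟩, by exact_mod_cast inv_pos.2 hc, fun a b ha hb => ?_⟩
  have ha' := hmem a ha
  have hb' := hmem b hb
  change |a - b| ≤ c⁻¹ * |Phi a - Phi b|
  rw [← div_eq_inv_mul, le_div_iff₀ hc]
  rcases le_total a b with h | h
  · have := key a b h ha' hb'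
    rw [abs_sub_comm, abs_sub_comm (Phi a), abs_of_nonneg (by linarith),
      abs_of_nonneg (by linarith [strictMono_phi.monotone h])]
    linarith
  · have := key b a h hb' ha'
    rw [abs_of_nonneg (by linarith), abs_of_nonneg (by linarith [strictMono_phi.monotone h])]
    linarith

/-- The values `a` and `b` of a function `Φ ∘ f` at two points where `f` changes by at most `h`. -/
def PhiStep (h a b : ℝ) : Prop := ∀ r, a ≤ Phi r → b ≤ Phi (r + h)

theorem PhiStep.mono {h h' a b : ℝ} (H : PhiStep h a b) (hh : h ≤ h') : PhiStep h' a b :=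
  fun r hr => (H r hr).trans (strictMono_phi.monotone (by linarith))

/-- For `r' > r` the inequality `a' < Phi r'` is strict and persists for `a i`; afterwards `r'`
decreases to `r`. This closedness is the reason for working with `PhiStep`. -/
theorem PhiStep.of_tendsto {ι : Type*} {F : Filter ι} [F.NeBot] {h a b : ι → ℝ} {h' a' b' : ℝ}
    (hh : Tendsto h F (𝓝 h')) (ha : Tendsto a F (𝓝 a')) (hb : Tendsto b F (𝓝 b'))
    (H : ∀ᶠ i in F, PhiStep (h i) (a i) (b i)) : PhiStep h' a' b' := by
  intro r hr
  have key : ∀ r' > r, b' ≤ Phi (r' + h') := by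
    intro r' hr'
    refine le_of_tendsto_of_tendsto hb
      ((lipschitzWith_phi.continuous.tendsto _).comp (hh.const_add r')) ?_
    filter_upwards [H, ha.eventually_lt_const (hr.trans_lt (strictMono_phi hr'))] with i hi hi'
    exact hi r' hi'.le
  have hc : Tendsto (fun r' => Phi (r' + h')) (𝓝[>] r) (𝓝 (Phi (r + h'))) :=
    ((lipschitzWith_phi.continuous.comp (continuous_add_const h')).tendsto r).mono_left
      nhdsWithin_le_nhds
  exact ge_of_tendsto hc (eventually_nhdsWithin_of_forall key)

theorem PhiStep.sub_le {h a b : ℝ} (H : PhiStep h a b) (hh : 0 ≤ h) (ha : 0 ≤ a) (hb : b ≤ 1) :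
    b - a ≤ h := by
  rcases le_or_gt 1 a with h1 | h1
  · linarith
  refine le_of_forall_pos_le_add fun ε hε => ?_
  -- `a` may be 0, which is not a value of `Phi`; this number lies in `(0, 1)` and exceeds `a` by at
  -- most `ε`.
  obtain ⟨r, hr⟩ := exists_phi_eq (v := min (a + ε) ((a + 1) / 2))
    (lt_min (by linarith) (by linarith)) (min_lt_of_right_lt (by linarith))
  have h2 := H r (by rw [hr]; exact le_min (by linarith) (by linarith))
  have h3 := phi_sub_phi_le (show r ≤ r + h by linarith)
  have := min_le_left (a + ε) ((a + 1) / 2)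
  linarith

/-- Where `u` avoids 0 and 1, `PhiStep` is the Lipschitz bound for Φ⁻¹ ∘ u. If `u` attains 0 or 1 at
one point, letting `r` tend to `-∞` or `∞` forces this value everywhere, which is the constant
alternative. -/
theorem phi_dichotomy_iff {X : Type*} [PseudoMetricSpace X] {K : ℝ≥0} {u : X → ℝ}
    (hu : ∀ x, u x ∈ Set.Icc (0 : ℝ) 1) :
    ((∃ c : ℝ, ∀ x, u x = c) ∨ ∃ f : X → ℝ, LipschitzWith K f ∧ ∀ x, u x = Phi (f x)) ↔
      ∀ x y, PhiStep (K * dist x y) (u x) (u y) := by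
  constructor
  · rintro (⟨c, hc⟩ | ⟨f, hf, hu⟩) x y r hr
    · rw [hc] at hr ⊢
      exact hr.trans (strictMono_phi.monotone (by linarith [show 0 ≤ K * dist x y by positivity]))
    · rw [hu] at hr ⊢
      have h1 := strictMono_phi.le_iff_le.1 hr
      have h2 := hf.dist_le_mul y x
      rw [Real.dist_eq, dist_comm] at h2
      exact strictMono_phi.monotone (by linarith [le_abs_self (f y - f x)])
  · intro H
    by_cases h0 : ∃ x, u x = 0
    · obtain ⟨x, hx⟩ := h0
      refine Or.inl ⟨0, fun y => le_antisymm ?_ (hu y).1⟩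
      have h1 : Tendsto (fun r => Phi (r + K * dist x y)) atBot (𝓝 0) :=
        tendsto_phi_atBot.comp (tendsto_atBot_add_const_right _ _ tendsto_id)
      exact ge_of_tendsto h1 (Eventually.of_forall fun r => H x y r (by rw [hx]; exact (phi_pos r).le))
    by_cases h1 : ∃ x, u x = 1
    · obtain ⟨x, hx⟩ := h1
      refine Or.inl ⟨1, fun y => le_antisymm (hu y).2 ?_⟩
      by_contra hy
      rw [not_le] at hy
      obtain ⟨r, hr⟩ := (tendsto_phi_atTop.eventually_const_lt hy).exists
      have := H y x r hr.le
      rw [hx] at this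
      exact absurd (phi_lt_one _) (not_lt.2 this)
    push Not at h0 h1
    have : ∀ x, ∃ r, Phi r = u x := fun x =>
      exists_phi_eq (lt_of_le_of_ne (hu x).1 (h0 x).symm) (lt_of_le_of_ne (hu x).2 (h1 x))
    choose f hf using this
    refine Or.inr ⟨f, LipschitzWith.of_le_add_mul K fun x y => ?_, fun x => (hf x).symm⟩
    have := H y x (f y) (hf y).ge
    rw [← hf, strictMono_phi.le_iff_le, dist_comm] at this
    exact this

/-! ### The gradient estimate for pairs of measures -/

/-- The gradient estimate over a time step of length `τ` for two conjugate heat kernel measures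
based at points of distance `d`, for Lipschitz test functions. -/
def HeatStep {X : Type*} [PseudoMetricSpace X] [MeasurableSpace X] (τ : ℝ≥0) (d : ℝ)
    (α β : Measure X) : Prop :=
  ∀ T : ℝ≥0, 0 < T → ∀ f : X → ℝ, LipschitzWith (T ^ (-(1 / 2) : ℝ)) f →
    PhiStep (((τ + T) ^ (-(1 / 2) : ℝ) : ℝ≥0) * d) (∫ y, Phi (f y) ∂α) (∫ y, Phi (f y) ∂β)

theorem integral_mem_Icc {X : Type*} [MeasurableSpace X] {α : Measure X} [IsProbabilityMeasure α]
    {v : X → ℝ} {a b : ℝ} (hm : AEStronglyMeasurable v α) (hv : ∀ x, v x ∈ Set.Icc a b) :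
    ∫ x, v x ∂α ∈ Set.Icc a b := by
  have hi : Integrable v α := Integrable.of_mem_Icc a b hm.aemeasurable (ae_of_all _ hv)
  constructor
  · calc a = ∫ _, a ∂α := by simp
      _ ≤ _ := integral_mono (integrable_const _) hi fun x => (hv x).1
  · calc _ ≤ ∫ _, b ∂α := integral_mono hi (integrable_const _) fun x => (hv x).2
      _ = b := by simp

theorem exists_rpow_eq {L : ℝ≥0} (hL : 0 < L) : ∃ T : ℝ≥0, 0 < T ∧ T ^ (-(1 / 2) : ℝ) = L :=
  ⟨L ^ (-2 : ℝ), NNReal.rpow_pos hL, by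
    rw [← NNReal.rpow_mul]; norm_num⟩

theorem rpow_neg_half_anti {S T : ℝ≥0} (hS : 0 < S) (h : S ≤ T) :
    T ^ (-(1 / 2) : ℝ) ≤ S ^ (-(1 / 2) : ℝ) := by
  rw [← NNReal.coe_le_coe, NNReal.coe_rpow, NNReal.coe_rpow]
  exact Real.rpow_le_rpow_of_nonpos (by exact_mod_cast hS) (by exact_mod_cast h) (by norm_num)

/-- Lipschitz functions with values away from `0` and `1` are of the form `Φ ∘ f`. -/
theorem exists_lipschitz_phi_comp {δ : ℝ} (hδ : 0 < δ) {C : ℝ≥0}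
    (h : ∀ a b : ℝ, Phi a ∈ Set.Icc δ (1 - δ) → Phi b ∈ Set.Icc δ (1 - δ) →
      |a - b| ≤ C * |Phi a - Phi b|)
    {X : Type*} [PseudoMetricSpace X] {L : ℝ≥0} {v : X → ℝ}
    (hL : LipschitzWith L v) (hv : ∀ x, v x ∈ Set.Icc δ (1 - δ)) :
    ∃ f : X → ℝ, LipschitzWith (C * L) f ∧ ∀ x, v x = Phi (f x) := by
  have : ∀ x, ∃ r, Phi r = v x := fun x =>
    exists_phi_eq (by linarith [(hv x).1]) (by linarith [(hv x).2])
  choose f hf using this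
  refine ⟨f, LipschitzWith.of_dist_le_mul fun x y => ?_, fun x => (hf x).symm⟩
  rw [Real.dist_eq]
  refine (h _ _ (by rw [hf]; exact hv x) (by rw [hf]; exact hv y)).trans ?_
  rw [hf, hf, NNReal.coe_mul, mul_assoc]
  exact mul_le_mul_of_nonneg_left (hL.dist_le_mul x y) C.coe_nonneg

/-- The universal constant in the Lipschitz estimate for heat flows. -/
noncomputable def heatConst : ℝ≥0 :=
  (exists_phi_antilipschitz (show (0 : ℝ) < 1 / 4 by norm_num)).choose

theorem heatConst_pos : 0 < heatConst :=
  (exists_phi_antilipschitz (show (0 : ℝ) < 1 / 4 by norm_num)).choose_spec.1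

section

variable {X : Type*} [MetricSpace X] [MeasurableSpace X] [BorelSpace X] {τ : ℝ≥0} {d : ℝ}
  {α β : Measure X} [IsProbabilityMeasure α] [IsProbabilityMeasure β]

/-- Squeezing `f` into `[1/4, 3/4]` makes it Φ of a Lipschitz function, with Lipschitz constant
`heatConst * L / 2 = T ^ (-1/2)`. As `(τ + T) ^ (-1/2)` is no larger, the bound does not involve
`τ`. -/
theorem HeatStep.integral_sub_le (H : HeatStep τ d α β) (hd : 0 ≤ d) {L : ℝ≥0} (hL : 0 < L)
    {f : X → ℝ} (hf : LipschitzWith L f) (hf' : ∀ x, f x ∈ Set.Icc (0 : ℝ) 1) :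
    ∫ x, f x ∂β - ∫ x, f x ∂α ≤ heatConst * L * d := by
  let v : X → ℝ := fun x => 1 / 4 + f x / 2
  have hvL : LipschitzWith (L / 2) v := by
    refine LipschitzWith.of_dist_le_mul fun x y => ?_
    have h1 := hf.dist_le_mul x y
    have h2 : dist (v x) (v y) = dist (f x) (f y) / 2 := by
      simp only [v, Real.dist_eq]
      rw [show 1 / 4 + f x / 2 - (1 / 4 + f y / 2) = (f x - f y) / 2 by ring, abs_div]
      norm_num
    push_cast
    linarith
  have hv : ∀ x, v x ∈ Set.Icc (1 / 4 : ℝ) (1 - 1 / 4) := fun x =>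
    ⟨by simp only [v]; linarith [(hf' x).1], by simp only [v]; linarith [(hf' x).2]⟩
  obtain ⟨g, hg, hvg⟩ := exists_lipschitz_phi_comp (by norm_num) (exists_phi_antilipschitz
    (show (0 : ℝ) < 1 / 4 by norm_num)).choose_spec.2 hvL hv
  obtain ⟨T, hT, hTL⟩ := exists_rpow_eq (L := heatConst * (L / 2))
    (mul_pos heatConst_pos (by positivity))
  have h1 := H T hT g (by rw [hTL]; exact hg)
  simp only [← hvg] at h1
  have hva := integral_mem_Icc (α := α) hvL.continuous.aestronglyMeasurable hv
  have hvb := integral_mem_Icc (α := β) hvL.continuous.aestronglyMeasurable hv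
  have h2 := h1.sub_le (by positivity) (by linarith [hva.1]) (by linarith [hvb.2])
  have h3 : (((τ + T) ^ (-(1 / 2) : ℝ) : ℝ≥0) : ℝ) ≤ heatConst * (L / 2) := by
    have := rpow_neg_half_anti hT (show T ≤ τ + T by simp)
    rw [hTL] at this
    exact_mod_cast this
  have e : ∀ (γ : Measure X) [IsProbabilityMeasure γ],
      ∫ x, v x ∂γ = 1 / 4 + (∫ x, f x ∂γ) / 2 := by
    intro γ _
    have hi : Integrable f γ :=
      Integrable.of_mem_Icc 0 1 hf.continuous.aemeasurable (ae_of_all _ hf')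
    simp only [v]
    rw [integral_add (integrable_const _) (hi.div_const 2), integral_div 2 f]
    simp
  rw [e, e] at h2
  have := mul_le_mul_of_nonneg_right h3 hd
  linarith

/-- Lipschitz functions are dense in `L¹`. -/
theorem exists_lipschitz_eLpNorm_sub_le (m : Measure X) [IsFiniteMeasure m] {v : X → ℝ}
    (hv : MemLp v 1 m) {ε : ℝ≥0∞} (hε : ε ≠ 0) :
    ∃ g : X → ℝ, eLpNorm (v - g) 1 m ≤ ε ∧ ∃ L : ℝ≥0, LipschitzWith L g := by
  refine hv.induction_dense ENNReal.one_ne_top (fun g : X → ℝ => ∃ L : ℝ≥0, LipschitzWith L g)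
    ?_ ?_ ?_ hε
  · intro c s hs hms ε hε
    obtain ⟨η, hη, hη'⟩ : ∃ η : ℝ≥0∞, η ≠ 0 ∧ ‖c‖ₑ * (η + η) ≤ ε := by
      rcases eq_or_ne ε ∞ with rfl | htop
      · exact ⟨1, one_ne_zero, le_top⟩
      refine ⟨ε / (2 * (‖c‖ₑ + 1)), ?_, ?_⟩
      · rw [Ne, ENNReal.div_eq_zero_iff, not_or]
        exact ⟨hε, by finiteness⟩
      · rw [← two_mul, ← mul_assoc, mul_comm ‖c‖ₑ 2, ← mul_div_assoc]
        refine ENNReal.div_le_of_le_mul ?_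
        rw [mul_comm]
        gcongr
        exact le_self_add
    -- A closed subset of `s` of almost full mass and a thin thickening of it: the thickened
    -- indicator differs from that of `s` only on the small set `D`.
    obtain ⟨F, hFs, hF, hFm⟩ := hs.exists_isClosed_sdiff_lt hms.ne hη
    have hthick := tendsto_measure_thickening_of_isClosed (μ := m) (s := F)
      ⟨1, one_pos, measure_ne_top _ _⟩ hF
    have hlt : m F < m F + η := ENNReal.lt_add_right (measure_ne_top _ _) hη
    obtain ⟨δ, hδ, hδ0⟩ := ((hthick.eventually_lt_const hlt).and self_mem_nhdsWithin).exists
    have hdiff : m (Metric.thickening δ F \ F) ≤ η := by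
      rw [measure_sdiff (Metric.self_subset_thickening hδ0 F) hF.measurableSet.nullMeasurableSet
        (measure_ne_top _ _)]
      exact tsub_le_iff_left.2 hδ.le
    set D := (Metric.thickening δ F \ F) ∪ (s \ F)
    have hD : MeasurableSet D :=
      (Metric.isOpen_thickening.measurableSet.diff hF.measurableSet).union
        (hs.diff hF.measurableSet)
    have hmD : m D ≤ η + η := (measure_union_le _ _).trans (add_le_add hdiff hFm.le)
    refine ⟨fun x => c * (thickenedIndicator hδ0 F x : ℝ), ?_, ‖c‖₊ * (δ.toNNReal⁻¹), ?_⟩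
    · rw [eLpNorm_one_eq_lintegral_enorm]
      calc _ ≤ ∫⁻ x, D.indicator (fun _ => ‖c‖ₑ) x ∂m := lintegral_mono fun x => ?_
        _ = ‖c‖ₑ * m D := by rw [lintegral_indicator hD]; simp
        _ ≤ ε := (mul_le_mul_right hmD _).trans hη'
      simp only [Pi.sub_apply]
      by_cases hx : x ∈ D
      · rw [Set.indicator_of_mem hx, ← mul_one (s.indicator _ x), ← ofReal_norm, ← ofReal_norm]
        refine ENNReal.ofReal_le_ofReal ?_
        have hle : (thickenedIndicator hδ0 F x : ℝ) ≤ 1 := by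
          exact_mod_cast thickenedIndicator_le_one hδ0 F x
        have h0 := (thickenedIndicator hδ0 F x).coe_nonneg
        by_cases hxs : x ∈ s
        · rw [Set.indicator_of_mem hxs, ← mul_sub, norm_mul]
          refine mul_le_of_le_one_right (norm_nonneg _) ?_
          rw [Real.norm_eq_abs, abs_le]
          constructor <;> linarith
        · rw [Set.indicator_of_notMem hxs, zero_mul, sub_zero, norm_mul]
          refine mul_le_of_le_one_right (norm_nonneg _) ?_
          rw [Real.norm_eq_abs, abs_le]
          constructor <;> linarith
      · rw [Set.indicator_of_notMem hx]
        simp only [D, Set.mem_union, Set.mem_sdiff, not_or, not_and, not_not] at hx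
        by_cases hxF : x ∈ F
        · rw [Set.indicator_of_mem (hFs hxF), thickenedIndicator_one hδ0 F hxF]
          simp
        · rw [Set.indicator_of_notMem (fun h => hxF (hx.2 h)),
            thickenedIndicator_zero hδ0 F (fun h => hxF (hx.1 h))]
          simp
    · refine LipschitzWith.of_dist_le_mul fun x y => ?_
      have h := (lipschitzWith_thickenedIndicator hδ0 F).dist_le_mul x y
      rw [Real.dist_eq, ← mul_sub, abs_mul, NNReal.coe_mul, mul_assoc]
      exact mul_le_mul_of_nonneg_left h (abs_nonneg c)
  · rintro f g ⟨L, hf⟩ ⟨L', hg⟩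
    exact ⟨_, hf.add hg⟩
  · rintro f ⟨L, hf⟩
    exact hf.continuous.aestronglyMeasurable

/-- The gradient estimate extends from Lipschitz functions to all measurable functions. -/
theorem HeatStep.phiStep_of_measurable (H : HeatStep τ d α β) (hτ : 0 < τ) (hd : 0 ≤ d)
    {v : X → ℝ} (hv : Measurable v) (hv' : ∀ x, v x ∈ Set.Icc (0 : ℝ) 1) :
    PhiStep ((τ ^ (-(1 / 2) : ℝ) : ℝ≥0) * d) (∫ y, v y ∂α) (∫ y, v y ∂β) := by
  have hvi : ∀ γ : Measure X, IsFiniteMeasure γ → Integrable v γ := fun γ _ =>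
    Integrable.of_mem_Icc 0 1 hv.aemeasurable (ae_of_all _ hv')
  have key : ∀ n : ℕ, ∃ w : X → ℝ, PhiStep ((τ ^ (-(1 / 2) : ℝ) : ℝ≥0) * d)
      (∫ y, w y ∂α) (∫ y, w y ∂β) ∧ |∫ y, w y ∂α - ∫ y, v y ∂α| ≤ 3 * (1 / ((n : ℝ) + 3)) ∧
        |∫ y, w y ∂β - ∫ y, v y ∂β| ≤ 3 * (1 / ((n : ℝ) + 3)) := by
    intro n
    set δ : ℝ := 1 / ((n : ℝ) + 3)
    have hδ : 0 < δ := by positivity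
    have hδ1 : δ ≤ 1 / 3 := one_div_le_one_div_of_le (by norm_num) (by linarith [n.cast_nonneg (α := ℝ)])
    -- Approximating with respect to the sum serves both measures at once.
    obtain ⟨g, hg, L, hgL⟩ := exists_lipschitz_eLpNorm_sub_le (α + β)
      (memLp_one_iff_integrable.2 (hvi (α + β) inferInstance))
      (ε := ENNReal.ofReal δ) (by simpa using hδ)
    -- The cut-off keeps the values where Φ⁻¹ is Lipschitz, at the price of a further error `δ`.
    let w : X → ℝ := fun x => max δ (min (1 - δ) (g x))
    have hwL : LipschitzWith (L + 1) w :=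
      ((hgL.const_min _).const_max _).weaken (by simp)
    have hw : ∀ x, w x ∈ Set.Icc δ (1 - δ) := fun x =>
      ⟨le_max_left _ _, max_le (by linarith) (min_le_left _ _)⟩
    have hwv : ∀ x, |w x - v x| ≤ |v x - g x| + δ := by
      intro x
      have h1 := (hv' x).1
      have h2 := (hv' x).2
      have h3 := le_abs_self (v x - g x)
      have h4 := neg_abs_le (v x - g x)
      simp only [w]
      rw [abs_le]
      rcases le_total (1 - δ) (g x) with h | h
      · rw [min_eq_left h, max_eq_right (by linarith)]
        constructor <;> linarith
      · rw [min_eq_right h]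
        rcases le_total δ (g x) with h' | h'
        · rw [max_eq_right h']
          constructor <;> linarith
        · rw [max_eq_left h']
          constructor <;> linarith
    have hest : ∀ γ : Measure X, IsProbabilityMeasure γ → γ ≤ α + β →
        |∫ y, w y ∂γ - ∫ y, v y ∂γ| ≤ 3 * δ := by
      intro γ _ hγ
      have hwi : Integrable w γ := Integrable.of_mem_Icc δ (1 - δ) hwL.continuous.aemeasurable
        (ae_of_all _ hw)
      have hle : eLpNorm (v - g) 1 γ ≤ ENNReal.ofReal δ :=
        (eLpNorm_mono_measure _ hγ).trans hg
      have hgi : Integrable (v - g) γ := by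
        refine memLp_one_iff_integrable.1 ⟨?_, hle.trans_lt ENNReal.ofReal_lt_top⟩
        exact hv.aestronglyMeasurable.sub hgL.continuous.aestronglyMeasurable
      have hvg : ∫ y, |v y - g y| ∂γ ≤ δ := by
        have e := ofReal_integral_norm_eq_lintegral_enorm hgi
        rw [← eLpNorm_one_eq_lintegral_enorm] at e
        rw [← e] at hle
        exact (ENNReal.ofReal_le_ofReal_iff hδ.le).1 hle
      rw [← integral_sub hwi (hvi γ inferInstance)]
      calc |∫ y, (w y - v y) ∂γ| ≤ ∫ y, |w y - v y| ∂γ := abs_integral_le_integral_abs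
        _ ≤ ∫ y, (|v y - g y| + δ) ∂γ := integral_mono (hwi.sub (hvi γ inferInstance)).abs
            (hgi.abs.add (integrable_const _)) hwv
        _ = ∫ y, |v y - g y| ∂γ + δ := by
            rw [integral_add (f := fun y => |v y - g y|) hgi.abs (integrable_const _)]
            simp
        _ ≤ 3 * δ := by linarith
    refine ⟨w, ?_, hest α inferInstance (Measure.le_add_right le_rfl),
      hest β inferInstance (Measure.le_add_left le_rfl)⟩
    obtain ⟨C, hC, hspec⟩ := exists_phi_antilipschitz hδ
    obtain ⟨f, hf, hwf⟩ := exists_lipschitz_phi_comp hδ hspec hwL hw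
    obtain ⟨T, hT, hTL⟩ := exists_rpow_eq (L := C * (L + 1)) (by positivity)
    have h1 := H T hT f (by rw [hTL]; exact hf)
    simp only [← hwf] at h1
    -- `T` depends on `n` without control, but dropping it from `τ + T` only weakens the estimate,
    -- so the limit keeps the sharp constant.
    refine h1.mono (mul_le_mul_of_nonneg_right ?_ hd)
    exact_mod_cast rpow_neg_half_anti hτ (show τ ≤ τ + T by simp)
  choose w hw hwα hwβ using key
  have hlim : Tendsto (fun n : ℕ => 3 * (1 / ((n : ℝ) + 3))) atTop (𝓝 0) := by
    have : Tendsto (fun n : ℕ => 1 / ((n : ℝ) + 3)) atTop (𝓝 0) := by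
      simp only [one_div]
      exact tendsto_inv_atTop_zero.comp
        (tendsto_atTop_add_const_right _ _ tendsto_natCast_atTop_atTop)
    simpa using this.const_mul 3
  refine PhiStep.of_tendsto tendsto_const_nhds (F := atTop) (a := fun n => ∫ y, w n y ∂α)
    (b := fun n => ∫ y, w n y ∂β) ?_ ?_ (Eventually.of_forall hw)
  · exact tendsto_iff_dist_tendsto_zero.2 (squeeze_zero (fun _ => dist_nonneg) hwα hlim)
  · exact tendsto_iff_dist_tendsto_zero.2 (squeeze_zero (fun _ => dist_nonneg) hwβ hlim)

end

/-! ### Weak convergence and Lipschitz test functions -/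

section

variable {X Y : Type*} [MetricSpace X] [MeasurableSpace X] [BorelSpace X]
  [MetricSpace Y] [MeasurableSpace Y] [BorelSpace Y]

theorem tendsto_integral_of_bounded {ι : Type*} {F : Filter ι} {μ : ι → ProbabilityMeasure X}
    {μ' : ProbabilityMeasure X} (h : Tendsto μ F (𝓝 μ')) {f : X → ℝ} (hf : Continuous f) {a b : ℝ}
    (hab : ∀ x, f x ∈ Set.Icc a b) :
    Tendsto (fun i => ∫ x, f x ∂(μ i : Measure X)) F (𝓝 (∫ x, f x ∂(μ' : Measure X))) :=
  ProbabilityMeasure.tendsto_iff_forall_integral_tendsto.1 h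
    (BoundedContinuousFunction.mkOfBound ⟨f, hf⟩ (b - a) fun x y =>
      Real.dist_le_of_mem_Icc (hab x) (hab y))

/-- To check weak convergence it suffices to consider `1`-Lipschitz functions to `[0, 1]`. -/
theorem tendsto_of_forall_lipschitzWith_one {ι : Type*} {F : Filter ι} [F.IsCountablyGenerated]
    {μ : ι → ProbabilityMeasure X} {μ' : ProbabilityMeasure X}
    (h : ∀ f : X → ℝ, LipschitzWith 1 f → (∀ x, f x ∈ Set.Icc (0 : ℝ) 1) →
      Tendsto (fun i => ∫ x, f x ∂(μ i : Measure X)) F (𝓝 (∫ x, f x ∂(μ' : Measure X)))) :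
    Tendsto μ F (𝓝 μ') := by
  rw [tendsto_iff_forall_lipschitz_integral_tendsto]
  rintro f ⟨C, hC⟩ ⟨L, hL⟩
  obtain ⟨x₀⟩ : Nonempty X := μ'.nonempty
  have hC0 : 0 ≤ C := dist_nonneg.trans (hC x₀ x₀)
  -- Large enough that the shifted and rescaled function `g` is 1-Lipschitz with values in `[0, 1]`.
  set c : ℝ := 2 * (C + 1) * (L + 1) with hc
  have hc0 : 0 < c := by positivity
  have hLc : (L : ℝ) ≤ c := by rw [hc]; nlinarith [L.coe_nonneg]
  have hCc : 2 * (C + 1) ≤ c := by rw [hc]; nlinarith [L.coe_nonneg]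
  let g : X → ℝ := fun x => (f x - f x₀ + (C + 1)) / c
  have hfg : ∀ x, f x = c * g x + (f x₀ - (C + 1)) := fun x => by
    simp only [g]; field_simp; ring
  have hg1 : LipschitzWith 1 g := by
    refine LipschitzWith.of_dist_le_mul fun x y => ?_
    have h1 := hL.dist_le_mul x y
    rw [Real.dist_eq] at h1 ⊢
    simp only [g]
    rw [← sub_div, abs_div, abs_of_pos hc0, div_le_iff₀ hc0,
      show f x - f x₀ + (C + 1) - (f y - f x₀ + (C + 1)) = f x - f y by ring]
    push_cast
    nlinarith [dist_nonneg (x := x) (y := y)]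
  have hg2 : ∀ x, g x ∈ Set.Icc (0 : ℝ) 1 := fun x => by
    have h1 := hC x x₀
    rw [Real.dist_eq, abs_le] at h1
    simp only [g]
    constructor
    · apply div_nonneg _ hc0.le; linarith
    · rw [div_le_one hc0]; linarith
  have hi : ∀ ν : ProbabilityMeasure X, ∫ x, f x ∂(ν : Measure X) =
      c * ∫ x, g x ∂(ν : Measure X) + (f x₀ - (C + 1)) := by
    intro ν
    have : Integrable g (ν : Measure X) :=
      Integrable.of_mem_Icc 0 1 hg1.continuous.aemeasurable (ae_of_all _ hg2)
    rw [integral_congr_ae (ae_of_all _ hfg), integral_add (this.const_mul c) (integrable_const _), integral_const_mul]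
    simp
  simp only [hi]
  exact ((h g hg1 hg2).const_mul c).add_const _

theorem ext_of_forall_lipschitzWith_one {μ ν : Measure X} [hμ : IsProbabilityMeasure μ]
    [hν : IsProbabilityMeasure ν]
    (h : ∀ f : X → ℝ, LipschitzWith 1 f → (∀ x, f x ∈ Set.Icc (0 : ℝ) 1) →
      ∫ x, f x ∂μ = ∫ x, f x ∂ν) : μ = ν := by
  let μ' : ProbabilityMeasure X := ⟨μ, hμ⟩
  let ν' : ProbabilityMeasure X := ⟨ν, hν⟩
  have : Tendsto (fun _ : ℕ => μ') atTop (𝓝 ν') :=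
    tendsto_of_forall_lipschitzWith_one fun f hf hf' => by
      change Tendsto (fun _ : ℕ => ∫ x, f x ∂μ) atTop (𝓝 (∫ x, f x ∂ν))
      rw [h f hf hf']
      exact tendsto_const_nhds
  exact congrArg ProbabilityMeasure.toMeasure (tendsto_nhds_unique tendsto_const_nhds this)

/-- A weakly continuous family of probability measures is measurable. -/
theorem measurable_of_continuous_probabilityMeasure {A : Type*} [TopologicalSpace A]
    [MeasurableSpace A] [OpensMeasurableSpace A] {κ : A → ProbabilityMeasure X}
    (hκ : Continuous κ) : Measurable fun a => (κ a : Measure X) := by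
  refine Measurable.measure_of_isPiSystem_of_isProbabilityMeasure
    (borel_eq_generateFrom_isClosed (α := X) ▸ BorelSpace.measurable_eq) isPiSystem_isClosed ?_
  intro S hS
  -- On closed sets the mass is upper semicontinuous by the portmanteau theorem, and closed sets
  -- form a π-system generating the Borel sets.
  refine UpperSemicontinuous.measurable fun a => ?_
  refine upperSemicontinuousAt_iff_limsup_le.2 ?_
  exact ProbabilityMeasure.limsup_measure_closed_le_of_tendsto (hκ.tendsto a) hS

/-- `HeatStep` tests only with the bounded continuous functions Φ ∘ f, and `PhiStep` is closed. -/
theorem HeatStep.of_tendsto {ι : Type*} {F : Filter ι} [F.NeBot] {τ : ℝ≥0} {d : ι → ℝ} {d' : ℝ}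
    {α β : ι → ProbabilityMeasure X} {α' β' : ProbabilityMeasure X} (hd : Tendsto d F (𝓝 d'))
    (hα : Tendsto α F (𝓝 α')) (hβ : Tendsto β F (𝓝 β'))
    (H : ∀ᶠ i in F, HeatStep τ (d i) (α i : Measure X) (β i : Measure X)) :
    HeatStep τ d' (α' : Measure X) (β' : Measure X) := fun T hT f hf =>
  PhiStep.of_tendsto (hd.const_mul _)
    (tendsto_integral_of_bounded hα (lipschitzWith_phi.continuous.comp hf.continuous)
      fun x => ⟨(phi_pos (f x)).le, (phi_lt_one (f x)).le⟩)
    (tendsto_integral_of_bounded hβ (lipschitzWith_phi.continuous.comp hf.continuous)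
      fun x => ⟨(phi_pos (f x)).le, (phi_lt_one (f x)).le⟩)
    (H.mono fun _ hi => hi T hT f hf)

theorem HeatStep.map {τ : ℝ≥0} {d : ℝ} {α β : Measure X} (H : HeatStep τ d α β) {g : X → Y}
    (hg : Isometry g) : HeatStep τ d (α.map g) (β.map g) := fun T hT f hf => by
  have hc : StronglyMeasurable fun y => Phi (f y) :=
    (lipschitzWith_phi.continuous.comp hf.continuous).measurable.stronglyMeasurable
  rw [integral_map_of_stronglyMeasurable hg.continuous.measurable hc,
    integral_map_of_stronglyMeasurable hg.continuous.measurable hc]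
  exact H T hT (f ∘ g) (by simpa using hf.comp hg.lipschitz)

theorem Isometry.exists_lipschitz_extension {X Y : Type*} [PseudoMetricSpace Y] [MetricSpace X]
    {g : X → Y} (hg : Isometry g) {K : ℝ≥0} {f : X → ℝ}
    (hf : LipschitzWith K f) : ∃ h : Y → ℝ, LipschitzWith K h ∧ ∀ x, h (g x) = f x := by
  have he : ∀ x, Function.extend g f 0 (g x) = f x := hg.injective.extend_apply f 0
  have : LipschitzOnWith K (Function.extend g f 0) (Set.range g) := by
    rintro _ ⟨x, rfl⟩ _ ⟨y, rfl⟩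
    rw [he, he, hg.edist_eq]
    exact hf x y
  obtain ⟨h, hh, heq⟩ := this.extend_real
  exact ⟨h, hh, fun x => (heq ⟨x, rfl⟩).symm.trans (he x)⟩

/-- Real Lipschitz functions extend from the isometric copy with the same constant, so no test
function is lost. -/
theorem HeatStep.of_map {τ : ℝ≥0} {d : ℝ} {α β : Measure X} {g : X → Y}
    (hg : Isometry g) (H : HeatStep τ d (α.map g) (β.map g)) : HeatStep τ d α β := by
  intro T hT f hf
  obtain ⟨h, hh, hhf⟩ := hg.exists_lipschitz_extension hf
  have hc : StronglyMeasurable fun y => Phi (h y) :=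
    (lipschitzWith_phi.continuous.comp hh.continuous).measurable.stronglyMeasurable
  have := H T hT h hh
  rw [integral_map_of_stronglyMeasurable hg.continuous.measurable hc,
    integral_map_of_stronglyMeasurable hg.continuous.measurable hc] at this
  simpa only [hhf] using this

/-- The time step 0, which lets later statements treat `s = t` and `s < t` alike. -/
theorem heatStep_dirac (x y : X) :
    HeatStep 0 (dist x y) (Measure.dirac x) (Measure.dirac y) := by
  intro T hT f hf r hr
  rw [integral_dirac] at hr ⊢
  have h1 := strictMono_phi.le_iff_le.1 hr
  have h2 := hf.dist_le_mul y x
  rw [Real.dist_eq, dist_comm] at h2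
  rw [zero_add]
  exact strictMono_phi.monotone (by linarith [le_abs_self (f y - f x)])

/-- The integrals of `1`-Lipschitz functions to `[0, 1]` differ by at most `ε`. -/
def BLClose (ε : ℝ) (μ ν : Measure X) : Prop :=
  ∀ f : X → ℝ, LipschitzWith 1 f → (∀ x, f x ∈ Set.Icc (0 : ℝ) 1) →
    |∫ x, f x ∂μ - ∫ x, f x ∂ν| ≤ ε

theorem BLClose.symm {X : Type*} [MetricSpace X] [MeasurableSpace X] {ε : ℝ} {μ ν : Measure X} (h : BLClose ε μ ν) : BLClose ε ν μ :=
  fun f hf hf' => by rw [abs_sub_comm]; exact h f hf hf'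

theorem BLClose.trans {X : Type*} [MetricSpace X] [MeasurableSpace X] {ε δ : ℝ} {μ ν ρ : Measure X} (h : BLClose ε μ ν) (h' : BLClose δ ν ρ) :
    BLClose (ε + δ) μ ρ := fun f hf hf' =>
  (abs_sub_le _ _ _).trans (add_le_add (h f hf hf') (h' f hf hf'))

theorem BLClose.mono {X : Type*} [MetricSpace X] [MeasurableSpace X] {ε δ : ℝ} {μ ν : Measure X} (h : BLClose ε μ ν) (h' : ε ≤ δ) :
    BLClose δ μ ν := fun f hf hf' => (h f hf hf').trans h'

theorem HeatStep.blClose {τ : ℝ≥0} {d : ℝ} {α β : Measure X} [IsProbabilityMeasure α]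
    [IsProbabilityMeasure β] (h : HeatStep τ d α β) (h' : HeatStep τ d β α) (hd : 0 ≤ d) :
    BLClose (heatConst * d) α β := fun f hf hf' => by
  have h1 := h.integral_sub_le hd one_pos hf hf'
  have h2 := h'.integral_sub_le hd one_pos hf hf'
  rw [NNReal.coe_one, mul_one] at h1 h2
  rw [abs_le]
  constructor <;> linarith

theorem tendsto_of_blClose {ι : Type*} {F : Filter ι} [F.IsCountablyGenerated]
    {μ : ι → ProbabilityMeasure X} {μ' : ProbabilityMeasure X} {ε : ι → ℝ}
    (hε : Tendsto ε F (𝓝 0)) (h : ∀ᶠ i in F, BLClose (ε i) (μ i : Measure X) (μ' : Measure X)) :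
    Tendsto μ F (𝓝 μ') :=
  tendsto_of_forall_lipschitzWith_one fun f hf hf' => by
    rw [tendsto_iff_dist_tendsto_zero]
    exact squeeze_zero' (Eventually.of_forall fun _ => dist_nonneg)
      (h.mono fun i hi => hi f hf hf') hε

/-- A family of measures satisfying the gradient estimate is weakly continuous. -/
theorem continuous_of_heatStep {A : Type*} [PseudoMetricSpace A] {κ : A → ProbabilityMeasure X}
    {τ : ℝ≥0} (h : ∀ a b, HeatStep τ (dist a b) (κ a : Measure X) (κ b : Measure X)) :
    Continuous κ := by
  refine continuous_iff_continuousAt.2 fun a => tendsto_of_blClose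
    (ε := fun b => heatConst * dist b a) ?_ (Eventually.of_forall fun b => ?_)
  · have : Continuous fun b => heatConst * dist b a := by fun_prop
    simpa using this.tendsto a
  · exact HeatStep.blClose (h b a) (by rw [dist_comm]; exact h a b) dist_nonneg

/-- The easy direction of Kantorovich–Rubinstein duality. -/
theorem blClose_of_W1_le [SecondCountableTopology X] {μ ν : Measure X} [IsProbabilityMeasure μ]
    [IsProbabilityMeasure ν] {ε : ℝ} (h : W1 μ ν ≤ ENNReal.ofReal ε) (hε : 0 ≤ ε) :
    BLClose ε μ ν := by
  intro f hf hf'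
  refine le_of_forall_pos_le_add fun δ hδ => ?_
  have hlt : W1 μ ν < ENNReal.ofReal (ε + δ) :=
    h.trans_lt ((ENNReal.ofReal_lt_ofReal_iff (by linarith)).2 (by linarith))
  obtain ⟨q, hq, hq'⟩ := exists_coupling_of_otCost_lt (c := fun x y : X => edist x y) hlt
  have := hq.isProbabilityMeasure
  have hm : StronglyMeasurable f := hf.continuous.measurable.stronglyMeasurable
  have hi1 : Integrable (fun z : X × X => f z.1) q :=
    Integrable.of_mem_Icc 0 1 (by fun_prop) (ae_of_all _ fun z => hf' z.1)
  have hi2 : Integrable (fun z : X × X => f z.2) q :=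
    Integrable.of_mem_Icc 0 1 (by fun_prop) (ae_of_all _ fun z => hf' z.2)
  have e1 : ∫ x, f x ∂μ = ∫ z, f z.1 ∂q := by
    rw [← hq.1, integral_map_of_stronglyMeasurable measurable_fst hm]
  have e2 : ∫ x, f x ∂ν = ∫ z, f z.2 ∂q := by
    rw [← hq.2, integral_map_of_stronglyMeasurable measurable_snd hm]
  rw [e1, e2, ← integral_sub hi1 hi2]
  have h3 : ENNReal.ofReal (∫ z, ‖f z.1 - f z.2‖ ∂q) ≤ ENNReal.ofReal (ε + δ) := by
    rw [ofReal_integral_norm_eq_lintegral_enorm (f := fun z : X × X => f z.1 - f z.2)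
      (hi1.sub hi2)]
    refine (lintegral_mono fun z => ?_).trans hq'.le
    rw [← edist_eq_enorm_sub]
    simpa using hf z.1 z.2
  exact (norm_integral_le_integral_norm _).trans
    ((ENNReal.ofReal_le_ofReal_iff (by linarith)).1 h3)

theorem BLClose.of_tendsto {ι : Type*} {F : Filter ι} [F.NeBot]
    {μ : ProbabilityMeasure X} {ν : ι → ProbabilityMeasure X} {ν' : ProbabilityMeasure X} {ε : ℝ}
    (hν : Tendsto ν F (𝓝 ν')) (h : ∀ᶠ i in F, BLClose ε (μ : Measure X) (ν i : Measure X)) :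
    BLClose ε (μ : Measure X) (ν' : Measure X) := fun f hf hf' =>
  le_of_tendsto ((tendsto_integral_of_bounded hν hf.continuous hf').const_sub _).abs
    (h.mono fun _ hi => hi f hf hf')

/-- A uniform bound for the mass outside of finitely many balls. -/
theorem exists_measure_compl_iUnion_ball_le [SecondCountableTopology X] {μ : ℕ → ProbabilityMeasure X}
    (h : ∀ ε > 0, ∃ N, ∀ n ≥ N, BLClose ε (μ N : Measure X) (μ n : Measure X))
    {D : ℕ → X} (hD : DenseRange D) {r : ℝ} (hr : 0 < r) {η : ℝ≥0∞} (hη : η ≠ 0) :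
    ∃ k : ℕ, ∀ n, (μ n : Measure X) (⋃ i ≤ k, Metric.closedBall (D i) r)ᶜ ≤ η := by
  obtain ⟨e, he0, he1, heη⟩ : ∃ e : ℝ, 0 < e ∧ e ≤ 1 ∧ ENNReal.ofReal (2 * e) ≤ η := by
    rcases eq_or_ne η ∞ with rfl | htop
    · exact ⟨1, one_pos, le_rfl, le_top⟩
    · have := ENNReal.toReal_pos hη htop
      refine ⟨min 1 (η.toReal / 2), lt_min one_pos (by positivity), min_le_left _ _, ?_⟩
      refine (ENNReal.ofReal_le_ofReal (q := η.toReal) ?_).trans ENNReal.ofReal_toReal_le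
      linarith [min_le_right 1 (η.toReal / 2)]
  -- The factor that makes the thickened indicator of `U`, which is `(r/2)⁻¹`-Lipschitz, an
  -- admissible test function for `BLClose`.
  set c : ℝ := min 1 (r / 2) with hc
  have hc0 : 0 < c := lt_min one_pos (by positivity)
  obtain ⟨N, hN⟩ := h (c * e) (by positivity)
  have hS : IsCompact (closure (μ '' Set.Iic N)) := by
    have : (μ '' Set.Iic N).Finite := (Set.finite_Iic N).image μ
    rw [this.isClosed.closure_eq]
    exact this.isCompact
  -- The finitely many measures up to `N` are handled by compactness. Those after `N` are compared
  -- with `μ N`, which loses a further mass `e` and doubles the radius of the balls.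
  obtain ⟨k, hk⟩ := exists_measure_iUnion_gt_of_isCompact_closure
    (fun i => Metric.ball (D i) (r / 2)) (fun _ => Metric.isOpen_ball)
    (Set.eq_univ_of_forall fun x => by
      obtain ⟨i, hi⟩ := hD.exists_dist_lt x (half_pos hr)
      exact Set.mem_iUnion.2 ⟨i, hi⟩) hS (ENNReal.ofReal e) (by simpa using he0)
    (by simpa using he1)
  set U := ⋃ i ≤ k, Metric.ball (D i) (r / 2) with hU
  set V := ⋃ i ≤ k, Metric.closedBall (D i) r with hV
  have hUm : MeasurableSet U := MeasurableSet.iUnion fun i => MeasurableSet.iUnion fun _ =>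
    Metric.isOpen_ball.measurableSet
  have hVm : MeasurableSet V := MeasurableSet.iUnion fun i => MeasurableSet.iUnion fun _ =>
    Metric.isClosed_closedBall.measurableSet
  have hUV : Metric.thickening (r / 2) U ⊆ V := by
    intro x hx
    obtain ⟨y, hy, hxy⟩ := Metric.mem_thickening_iff.1 hx
    simp only [hU, Set.mem_iUnion] at hy
    obtain ⟨i, hi, hy⟩ := hy
    refine Set.mem_biUnion (show i ∈ {i | i ≤ k} from hi) ?_
    rw [Metric.mem_ball] at hy
    rw [Metric.mem_closedBall]
    linarith [dist_triangle x y (D i)]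
  have hU' : U ⊆ V := (Metric.self_subset_thickening (half_pos hr) U).trans hUV
  have hreal : ∀ n ≤ N, 1 - e < (μ n : Measure X).real U := by
    intro n hn
    have := hk (μ n) ⟨n, hn, rfl⟩
    rw [← ENNReal.ofReal_one, ← ENNReal.ofReal_sub _ he0.le,
      ProbabilityMeasure.ennreal_coeFn_eq_coeFn_toMeasure,
      ENNReal.ofReal_lt_iff_lt_toReal (by linarith) (measure_ne_top _ _)] at this
    exact this
  have hfin : ∀ n, 1 - 2 * e ≤ (μ n : Measure X).real V → (μ n : Measure X) Vᶜ ≤ η := by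
    intro n hn
    refine le_trans ?_ heη
    rw [← ofReal_measureReal (measure_ne_top _ _), probReal_compl_eq_one_sub hVm]
    exact ENNReal.ofReal_le_ofReal (by linarith)
  refine ⟨k, fun n => hfin n ?_⟩
  rcases le_total n N with hn | hn
  · have h1 := hreal n hn
    have h2 : (μ n : Measure X).real U ≤ (μ n : Measure X).real V :=
      measureReal_mono hU' (measure_ne_top _ _)
    linarith
  let g := thickenedIndicator (half_pos hr) U
  let f : X → ℝ := fun x => c * (g x : ℝ)
  have hg1 : ∀ x, (g x : ℝ) ≤ 1 := fun x => by
    exact_mod_cast thickenedIndicator_le_one (half_pos hr) U x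
  have hf1 : LipschitzWith 1 f := by
    refine LipschitzWith.of_dist_le_mul fun x y => ?_
    have h1 := (lipschitzWith_thickenedIndicator (half_pos hr) U).dist_le_mul x y
    rw [NNReal.dist_eq] at h1
    rw [Real.dist_eq, ← mul_sub, abs_mul, abs_of_pos hc0]
    calc c * |(g x : ℝ) - g y| ≤ (r / 2) * (((r / 2).toNNReal⁻¹ : ℝ≥0) * dist x y) :=
          mul_le_mul (min_le_right _ _) h1 (abs_nonneg _) (by positivity)
      _ = _ := by
          rw [NNReal.coe_inv, Real.coe_toNNReal _ (half_pos hr).le, NNReal.coe_one]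
          field_simp
  have hf2 : ∀ x, f x ∈ Set.Icc (0 : ℝ) 1 := fun x =>
    ⟨mul_nonneg hc0.le (g x).coe_nonneg, mul_le_one₀ (min_le_left _ _) (g x).coe_nonneg (hg1 x)⟩
  have hi : ∀ m, Integrable f (μ m : Measure X) := fun m =>
    Integrable.of_mem_Icc 0 1 hf1.continuous.aemeasurable (ae_of_all _ hf2)
  have hclose := hN n hn f hf1 hf2
  have h1 : c * (μ N : Measure X).real U ≤ ∫ x, f x ∂(μ N : Measure X) := by
    rw [mul_comm, ← smul_eq_mul, ← integral_indicator_const c hUm]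
    refine integral_mono ((integrable_const c).indicator hUm) (hi N) fun x => ?_
    by_cases hx : x ∈ U
    · rw [Set.indicator_of_mem hx]
      simp only [f, g, thickenedIndicator_one (half_pos hr) U hx]
      simp
    · rw [Set.indicator_of_notMem hx]
      exact (hf2 x).1
  have h2 : ∫ x, f x ∂(μ n : Measure X) ≤ c * (μ n : Measure X).real V := by
    rw [mul_comm c, ← smul_eq_mul, ← integral_indicator_const c hVm]
    refine integral_mono (hi n) ((integrable_const c).indicator hVm) fun x => ?_
    by_cases hx : x ∈ V
    · rw [Set.indicator_of_mem hx]
      exact mul_le_of_le_one_right hc0.le (hg1 x)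
    · rw [Set.indicator_of_notMem hx]
      simp only [f, g, thickenedIndicator_zero (half_pos hr) U fun hx' => hx (hUV hx')]
      simp
  have h3 : c * (μ N : Measure X).real U - c * (μ n : Measure X).real V ≤ c * e := by
    linarith [le_abs_self (∫ x, f x ∂(μ N : Measure X) - ∫ x, f x ∂(μ n : Measure X))]
  rw [← mul_sub] at h3
  have h4 := le_of_mul_le_mul_left h3 hc0
  linarith [hreal N le_rfl]

/-- The space of probability measures on a Polish space is complete with respect to the distance
defined by bounded Lipschitz functions. -/
theorem exists_tendsto_of_blClose [SecondCountableTopology X] [CompleteSpace X]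
    {μ : ℕ → ProbabilityMeasure X}
    (h : ∀ ε > 0, ∃ N, ∀ n ≥ N, BLClose ε (μ N : Measure X) (μ n : Measure X)) :
    ∃ μ' : ProbabilityMeasure X, Tendsto μ atTop (𝓝 μ') ∧
      ∀ ε > 0, ∀ᶠ n in atTop, BLClose ε (μ n : Measure X) (μ' : Measure X) := by
  have hne : Nonempty X := (μ 0).nonempty
  obtain ⟨D, hD⟩ := TopologicalSpace.exists_dense_seq X
  have htight : IsTightMeasureSet
      {((ν : ProbabilityMeasure X) : Measure X) | ν ∈ Set.range μ} := by
    rw [isTightMeasureSet_iff_exists_isCompact_measure_compl_le]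
    intro ε hε
    obtain ⟨η, hη, hηε⟩ := ENNReal.exists_pos_sum_of_countable' hε.ne' ℕ
    choose k hk using fun m : ℕ => exists_measure_compl_iUnion_ball_le h hD
      (r := 1 / ((m : ℝ) + 1)) (by positivity) (hη m).ne'
    -- Closed and totally bounded, hence compact; the masses lost at the scales `1 / (m + 1)` add up
    -- to at most `ε`.
    refine ⟨⋂ m : ℕ, ⋃ i ≤ k m, Metric.closedBall (D i) (1 / ((m : ℝ) + 1)), ?_, ?_⟩
    · refine isCompact_iff_totallyBounded_isComplete.2 ⟨?_, IsClosed.isComplete ?_⟩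
      · rw [Metric.totallyBounded_iff]
        intro δ hδ
        obtain ⟨m, hm⟩ := exists_nat_one_div_lt hδ
        refine ⟨D '' Set.Iic (k m), (Set.finite_Iic _).image D, fun x hx => ?_⟩
        have hx := Set.mem_iInter.1 hx m
        simp only [Set.mem_iUnion] at hx
        obtain ⟨i, hi, hx⟩ := hx
        exact Set.mem_biUnion ⟨i, hi, rfl⟩ ((Metric.mem_closedBall.1 hx).trans_lt hm)
      · exact isClosed_iInter fun m => (Set.finite_Iic (k m)).isClosed_biUnion
          fun i _ => Metric.isClosed_closedBall
    · rintro _ ⟨_, ⟨n, rfl⟩, rfl⟩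
      rw [Set.compl_iInter]
      exact (measure_iUnion_le _).trans ((ENNReal.tsum_le_tsum fun m => hk m n).trans hηε.le)
  -- A limit along an ultrafilter suffices: the Cauchy property extends it to the whole sequence.
  obtain ⟨μ', -, hμ'⟩ := (isCompact_closure_of_isTightMeasureSet htight).ultrafilter_le_nhds
    ((hyperfilter ℕ).map μ) (by
      rw [le_principal_iff, Ultrafilter.coe_map, mem_map]
      exact univ_mem' fun n => subset_closure ⟨n, rfl⟩)
  have hlim : Tendsto μ (hyperfilter ℕ : Filter ℕ) (𝓝 μ') := hμ'
  have hclose : ∀ ε > 0, ∀ᶠ n in atTop, BLClose ε (μ n : Measure X) (μ' : Measure X) := by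
    intro ε hε
    obtain ⟨N, hN⟩ := h (ε / 2) (half_pos hε)
    have hev : ∀ᶠ n in (hyperfilter ℕ : Filter ℕ), N ≤ n :=
      (Nat.hyperfilter_le_atTop (eventually_ge_atTop N))
    have h1 : BLClose (ε / 2) (μ N : Measure X) (μ' : Measure X) :=
      BLClose.of_tendsto hlim (hev.mono hN)
    filter_upwards [eventually_ge_atTop N] with n hn
    exact ((hN n hn).symm.trans h1).mono (by linarith)
  refine ⟨μ', tendsto_of_forall_lipschitzWith_one fun f hf hf' => ?_, hclose⟩
  rw [Metric.tendsto_nhds]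
  intro ε hε
  filter_upwards [hclose (ε / 2) (half_pos hε)] with n hn
  exact (hn f hf hf').trans_lt (by linarith)

end

/-! ### Conjugate heat kernels -/

instance MetricFlow.secondCountableTopology {A : Set ℝ} (X : MetricFlow.{u} A) (t : A) :
    SecondCountableTopology (X.slice t) :=
  UniformSpace.secondCountable_of_separable _

instance MetricFlow.isProbabilityMeasure_ν {A : Set ℝ} (X : MetricFlow.{u} A) {s t : A}
    (h : s ≤ t) (x : X.slice t) : IsProbabilityMeasure (X.ν h x) := X.prob h x

instance MetricFlowPair.isProbabilityMeasure_μ {I : Set ℝ} (P : MetricFlowPair.{u} I)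
    (t : P.dom) : IsProbabilityMeasure (P.μ t) := P.conj.1 t

instance MetricFlowPair.nonempty_slice {I : Set ℝ} (P : MetricFlowPair.{u} I)
    (t : P.dom) : Nonempty (P.flow.slice t) :=
  nonempty_of_isProbabilityMeasure (P.μ t)

theorem MetricFlow.heatStep {A : Set ℝ} (X : MetricFlow.{u} A) {s t : A} (h : s ≤ t)
    (x y : X.slice t) :
    HeatStep (Real.toNNReal ((t : ℝ) - (s : ℝ))) (dist x y) (X.ν h x) (X.ν h y) := by
  rcases h.eq_or_lt with rfl | hlt
  · rw [X.ν_self, X.ν_self, sub_self, Real.toNNReal_zero]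
    exact heatStep_dirac x y
  · intro T hT f hf
    have hc : Continuous fun z => Phi (f z) := lipschitzWith_phi.continuous.comp hf.continuous
    have hI : ∀ z, Phi (f z) ∈ Set.Icc (0 : ℝ) 1 := fun z => ⟨(phi_pos _).le, (phi_lt_one _).le⟩
    have := X.gradient hlt T (fun z => Phi (f z)) hc.measurable hI fun _ => ⟨f, hf, fun _ => rfl⟩
    exact (phi_dichotomy_iff fun z =>
      integral_mem_Icc hc.aestronglyMeasurable hI).1 this x y

/-- The conjugate heat kernel as a family of bundled probability measures. -/
def MetricFlow.kernel {A : Set ℝ} (X : MetricFlow.{u} A) {s t : A} (h : s ≤ t) (x : X.slice t) :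
    ProbabilityMeasure (X.slice s) := ⟨X.ν h x, X.prob h x⟩

theorem MetricFlow.continuous_kernel {A : Set ℝ} (X : MetricFlow.{u} A) {s t : A} (h : s ≤ t) :
    Continuous (X.kernel h) :=
  continuous_of_heatStep (X.heatStep h)

/-! ### Bridges between metric spaces -/

/-- A function of the form `c x y = d (f x) (g y)` for isometric embeddings into a common space. -/
def IsBridge {X Y : Type u} [MetricSpace X] [MetricSpace Y] (c : X → Y → ℝ) : Prop :=
  ∃ (Z : Type u) (_ : MetricSpace Z) (f : X → Z) (g : Y → Z), Isometry f ∧ Isometry g ∧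
    ∀ x y, c x y = dist (f x) (g y)

namespace IsBridge

variable {X Y W : Type u} [MetricSpace X] [MetricSpace Y] [MetricSpace W] {c : X → Y → ℝ}

theorem nonneg (h : IsBridge c) (x : X) (y : Y) : 0 ≤ c x y := by
  obtain ⟨Z, _, f, g, hf, hg, h⟩ := h
  rw [h]; exact dist_nonneg

theorem le_add (h : IsBridge c) (x x' : X) (y y' : Y) : c x y ≤ dist x x' + c x' y' + dist y y' := by
  obtain ⟨Z, _, f, g, hf, hg, h⟩ := h
  rw [h, h, ← hf.dist_eq, ← hg.dist_eq, dist_comm (g y)]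
  exact dist_triangle4 _ _ _ _

theorem dist_left_le (h : IsBridge c) (x x' : X) (y y' : Y) :
    dist x x' ≤ c x y + dist y y' + c x' y' := by
  obtain ⟨Z, _, f, g, hf, hg, h⟩ := h
  rw [h, h, ← hf.dist_eq, ← hg.dist_eq, dist_comm (f x') (g y')]
  exact dist_triangle4 _ _ _ _

theorem symm (h : IsBridge c) : IsBridge fun y x => c x y := by
  obtain ⟨Z, m, f, g, hf, hg, h⟩ := h
  exact ⟨Z, m, g, f, hg, hf, fun y x => (h x y).trans (dist_comm _ _)⟩

theorem dist_right_le (h : IsBridge c) (x x' : X) (y y' : Y) :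
    dist y y' ≤ c x y + dist x x' + c x' y' := h.symm.dist_left_le y y' x x'

theorem refl : IsBridge (fun x y : X => dist x y) :=
  ⟨X, inferInstance, id, id, isometry_id, isometry_id, fun _ _ => rfl⟩

theorem continuous (h : IsBridge c) : Continuous (Function.uncurry c) := by
  obtain ⟨Z, _, f, g, hf, hg, h⟩ := h
  have : Function.uncurry c = fun p => dist (f p.1) (g p.2) := funext fun p => h _ _
  rw [this]
  exact (hf.continuous.comp continuous_fst).dist (hg.continuous.comp continuous_snd)

theorem continuous_ofReal (h : IsBridge c) :
    Continuous (Function.uncurry fun x y => ENNReal.ofReal (c x y)) :=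
  ENNReal.continuous_ofReal.comp h.continuous

/-- The two ambient spaces are glued along their copies of `Y`; the inequality is the triangle
inequality through the common point `y`. -/
theorem exists_comp [Nonempty Y] {c' : Y → W → ℝ} (h : IsBridge c) (h' : IsBridge c') :
    ∃ c'' : X → W → ℝ, IsBridge c'' ∧ ∀ x y w, c'' x w ≤ c x y + c' y w := by
  obtain ⟨Z, _, f, g, hf, hg, h⟩ := h
  obtain ⟨Z', _, f', g', hf', hg', h'⟩ := h'
  refine ⟨fun x w => dist (Metric.toGlueL hg hf' (f x)) (Metric.toGlueR hg hf' (g' w)),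
    ⟨Metric.GlueSpace hg hf', inferInstance, _, _, (Metric.toGlueL_isometry hg hf').comp hf,
      (Metric.toGlueR_isometry hg hf').comp hg', fun _ _ => rfl⟩, fun x y w => ?_⟩
  rw [h, h', ← (Metric.toGlueL_isometry hg hf').dist_eq, ← (Metric.toGlueR_isometry hg hf').dist_eq]
  have : Metric.toGlueL hg hf' (g y) = Metric.toGlueR hg hf' (f' y) :=
    congrFun (Metric.toGlue_commute hg hf') y
  rw [← this]
  exact dist_triangle _ _ _

end IsBridge

/-! ### Closeness of metric flow pairs -/

/-- `P` and `Q` are at `𝔽`-distance at most `r`, in terms of bridges between their time-slices. -/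
def FClose {I : Set ℝ} (J : Set ℝ) (P Q : MetricFlowPair.{u} I) (r : ℝ) : Prop :=
  ∃ (T : Set ℝ) (h₁ : T ⊆ P.dom) (h₂ : T ⊆ Q.dom)
    (c : ∀ t (ht : t ∈ T), P.flow.slice ⟨t, h₁ ht⟩ → Q.flow.slice ⟨t, h₂ ht⟩ → ℝ)
    (q : ∀ t (ht : t ∈ T), Measure (P.flow.slice ⟨t, h₁ ht⟩ × Q.flow.slice ⟨t, h₂ ht⟩)),
    J ⊆ T ∧ NullMeasurableSet (I \ T) volume ∧ volume (I \ T) ≤ ENNReal.ofReal (r ^ 2) ∧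
      (∀ t ht, IsBridge (c t ht)) ∧
      (∀ t ht, IsCoupling (q t ht) (P.μ ⟨t, h₁ ht⟩) (Q.μ ⟨t, h₂ ht⟩)) ∧
      ∀ s t (hs : s ∈ T) (ht : t ∈ T) (h : s ≤ t),
        ∫⁻ p, otCost (fun x y => ENNReal.ofReal (c s hs x y))
          (P.flow.ν (s := ⟨s, h₁ hs⟩) (t := ⟨t, h₁ ht⟩) (Subtype.mk_le_mk.2 h) p.1)
          (Q.flow.ν (s := ⟨s, h₂ hs⟩) (t := ⟨t, h₂ ht⟩) (Subtype.mk_le_mk.2 h) p.2) ∂(q t ht) ≤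
        ENNReal.ofReal r

theorem Correspondence.W1_map_eq {A B K : Set ℝ} {X : MetricFlow.{u} A} {Y : MetricFlow.{u} B}
    (C : Correspondence X Y K) {t : ℝ} (h₁ : t ∈ C.dom₁) (h₂ : t ∈ C.dom₂)
    (μ : Measure (X.slice ⟨t, C.sub₁ h₁⟩)) (ν : Measure (Y.slice ⟨t, C.sub₂ h₂⟩)) :
    W1 (μ.map (C.emb₁ t h₁)) (ν.map (C.emb₂ t h₂)) =
      otCost (fun x y => ENNReal.ofReal (dist (C.emb₁ t h₁ x) (C.emb₂ t h₂ y))) μ ν := by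
  rw [W1_map_eq_otCost (C.isom₁ t h₁) (C.isom₂ t h₂)]
  simp only [edist_dist]

theorem Correspondence.Admissible.fClose {I J : Set ℝ} {P Q : MetricFlowPair.{u} I}
    {C : Correspondence P.flow Q.flow I} {r : ℝ} (h : C.Admissible J r) : FClose J P Q r := by
  obtain ⟨E, hE, hm, hJ, hv, h₁, h₂, q, hq, hr⟩ := h
  have hIE : I \ (I \ E) = E := by rw [Set.sdiff_sdiff_right_self]; exact Set.inter_eq_right.2 hE
  refine ⟨I \ E, h₁.trans C.sub₁, h₂.trans C.sub₂,
    fun t ht x y => dist (C.emb₁ t (h₁ ht) x) (C.emb₂ t (h₂ ht) y), q, hJ, ?_, ?_, ?_, hq, ?_⟩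
  · rwa [hIE]
  · rwa [hIE]
  · exact fun t ht => ⟨_, inferInstance, _, _, C.isom₁ t (h₁ ht), C.isom₂ t (h₂ ht), fun _ _ => rfl⟩
  · intro s t hs ht hst
    refine le_trans (le_of_eq (lintegral_congr fun p => ?_)) (hr s t hs ht hst)
    exact (C.W1_map_eq (h₁ hs) (h₂ hs) _ _).symm

theorem FClose.exists_admissible {I J : Set ℝ} {P Q : MetricFlowPair.{u} I} {r : ℝ}
    (h : FClose J P Q r) :
    ∃ C : Correspondence P.flow Q.flow I, C.FullyDefined J ∧ C.Admissible J r := by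
  obtain ⟨T, h₁, h₂, c, q, hJ, hm, hv, hc, hq, hr⟩ := h
  have hTI : T ⊆ I := h₁.trans P.dom_subset
  have : ∀ k : I, ∃ (Z : Type u) (_ : MetricSpace Z), ∀ ht : (k : ℝ) ∈ T,
      ∃ (f : P.flow.slice ⟨k, h₁ ht⟩ → Z) (g : Q.flow.slice ⟨k, h₂ ht⟩ → Z),
        Isometry f ∧ Isometry g ∧ ∀ x y, c k ht x y = dist (f x) (g y) := by
    intro k
    by_cases ht : (k : ℝ) ∈ T
    · obtain ⟨Z, m, f, g, h⟩ := hc k ht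
      exact ⟨Z, m, fun _ => ⟨f, g, h⟩⟩
    -- Nothing is embedded at times outside `T`, so any space will do.
    · exact ⟨PUnit, inferInstance, fun h => absurd h ht⟩
  choose Z m f g hf hg hfg using this
  let C : Correspondence P.flow Q.flow I :=
    { Z := Z
      meas := fun t => borel (Z t)
      borel := fun t => @BorelSpace.mk _ _ (borel (Z t)) rfl
      dom₁ := T
      dom₂ := T
      sub₁ := h₁
      sub₂ := h₂
      sub₁' := hTI
      sub₂' := hTI
      emb₁ := fun t ht => f ⟨t, hTI ht⟩ ht
      emb₂ := fun t ht => g ⟨t, hTI ht⟩ ht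
      isom₁ := fun t ht => hf ⟨t, hTI ht⟩ ht
      isom₂ := fun t ht => hg ⟨t, hTI ht⟩ ht }
  have hIT : I \ (I \ T) = T := by rw [Set.sdiff_sdiff_right_self]; exact Set.inter_eq_right.2 hTI
  refine ⟨C, ⟨hJ, hJ⟩, I \ T, Set.sdiff_subset, hm, by rwa [hIT], hv, hIT.subset, hIT.subset,
    fun t ht => q t (hIT.subset ht), fun t ht => hq t (hIT.subset ht), fun s t hs ht hst => ?_⟩
  refine le_trans (le_of_eq (lintegral_congr fun p => ?_))
    (hr s t (hIT.subset hs) (hIT.subset ht) hst)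
  refine (C.W1_map_eq (hIT.subset hs) (hIT.subset hs) _ _).trans ?_
  congr 1
  funext x y
  exact congrArg _ (hfg ⟨s, hs.1⟩ (hIT.subset hs) x y).symm

/-! ### The pseudometric axioms -/

theorem dFPair_le_of_fClose {I J : Set ℝ} {P Q : MetricFlowPair.{u} I} {r : ℝ} (hr : 0 < r)
    (h : FClose J P Q r) : dFPair J P Q ≤ ENNReal.ofReal r := by
  obtain ⟨C, hC, hC'⟩ := h.exists_admissible
  exact (iInf₂_le C hC).trans (iInf₂_le r ⟨hr, hC'⟩)

theorem exists_fClose_of_dFPair_lt {I J : Set ℝ} {P Q : MetricFlowPair.{u} I} {a : ℝ≥0∞}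
    (h : dFPair J P Q < a) : ∃ r : ℝ, 0 < r ∧ ENNReal.ofReal r < a ∧ FClose J P Q r := by
  simp only [dFPair, dFWithin, iInf_lt_iff] at h
  obtain ⟨C, hC, r, ⟨hr, hr'⟩, hlt⟩ := h
  exact ⟨r, hr, hlt, hr'.fClose⟩

theorem FClose.mono {I J : Set ℝ} {P Q : MetricFlowPair.{u} I} {r r' : ℝ} (h : FClose J P Q r)
    (hr : 0 ≤ r) (hrr : r ≤ r') : FClose J P Q r' := by
  obtain ⟨T, h₁, h₂, c, q, hJ, hm, hv, hc, hq, hr'⟩ := h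
  exact ⟨T, h₁, h₂, c, q, hJ, hm,
    hv.trans (ENNReal.ofReal_le_ofReal (pow_le_pow_left₀ hr hrr 2)), hc, hq,
    fun s t hs ht hst => (hr' s t hs ht hst).trans (ENNReal.ofReal_le_ofReal hrr)⟩

theorem FClose.refl {I J : Set ℝ} {P : MetricFlowPair.{u} I} (hP : P.FullyDefined J) (r : ℝ) :
    FClose J P P r := by
  refine ⟨P.dom, subset_rfl, subset_rfl, fun t ht x y => dist x y,
    fun t ht => (P.μ ⟨t, ht⟩).map fun x => (x, x), hP, NullMeasurableSet.of_null P.null,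
    by rw [P.null]; exact zero_le, fun t ht => IsBridge.refl, fun t ht => ?_, fun s t hs ht hst => ?_⟩
  · simpa using isCoupling_graph (P.μ ⟨t, ht⟩) measurable_id
  · refine (lintegral_map_le _ _).trans ?_
    refine le_trans (le_of_eq ?_) (zero_le (a := ENNReal.ofReal r))
    rw [lintegral_eq_zero_of_ae_eq_zero]
    refine ae_of_all _ fun x => ?_
    refine le_antisymm ((otCost_le (by simpa using isCoupling_graph _ measurable_id)).trans
      ((lintegral_map_le _ _).trans ?_)) (zero_le)
    simp

theorem FClose.symm {I J : Set ℝ} {P Q : MetricFlowPair.{u} I} {r : ℝ} (h : FClose J P Q r) :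
    FClose J Q P r := by
  obtain ⟨T, h₁, h₂, c, q, hJ, hm, hv, hc, hq, hr⟩ := h
  refine ⟨T, h₂, h₁, fun t ht y x => c t ht x y, fun t ht => (q t ht).map Prod.swap, hJ, hm, hv,
    fun t ht => (hc t ht).symm, fun t ht => (hq t ht).swap, fun s t hs ht hst => ?_⟩
  refine (lintegral_map_le _ _).trans (le_trans (le_of_eq ?_) (hr s t hs ht hst))
  exact lintegral_congr fun p => otCost_swap _ _ _

theorem FClose.trans {I J : Set ℝ} {P Q R : MetricFlowPair.{u} I} {r r' : ℝ}
    (h : FClose J P Q r) (h' : FClose J Q R r') (hr : 0 ≤ r) (hr' : 0 ≤ r') :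
    FClose J P R (r + r') := by
  obtain ⟨T, h₁, h₂, c, q, hJ, hm, hv, hc, hq, he⟩ := h
  obtain ⟨T', h₁', h₂', c', q', hJ', hm', hv', hc', hq', he'⟩ := h'
  have : ∀ t (ht : t ∈ T ∩ T'), ∃ c'' : P.flow.slice ⟨t, h₁ ht.1⟩ → R.flow.slice ⟨t, h₂' ht.2⟩ → ℝ,
      IsBridge c'' ∧ ∀ x y w, c'' x w ≤ c t ht.1 x y + c' t ht.2 y w := fun t ht =>
    have := Q.nonempty_slice ⟨t, h₂ ht.1⟩
    (hc t ht.1).exists_comp (hc' t ht.2)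
  choose c'' hc'' hle using this
  choose π hπ hπ' using fun t (ht : t ∈ T ∩ T') => exists_gluing (hq t ht.1) (hq' t ht.2)
  have hI : I \ (T ∩ T') = (I \ T) ∪ (I \ T') := Set.sdiff_inter
  refine ⟨T ∩ T', fun t ht => h₁ ht.1, fun t ht => h₂' ht.2, c'',
    fun t ht => (π t ht).map fun z => (z.1.1, z.2), Set.subset_inter hJ hJ', ?_, ?_, hc'',
    fun t ht => ?_, fun s t hs ht hst => ?_⟩
  · rw [hI]; exact hm.union hm'
  · rw [hI]
    refine (measure_union_le _ _).trans ((add_le_add hv hv').trans ?_)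
    rw [← ENNReal.ofReal_add (sq_nonneg _) (sq_nonneg _)]
    -- The exceptional sets are compatible with addition of radii because `r² + r'² ≤ (r + r')²`.
    exact ENNReal.ofReal_le_ofReal (by nlinarith)
  · constructor
    · rw [Measure.map_map measurable_fst (by fun_prop), ← (hq t ht.1).1, ← hπ t ht,
        Measure.map_map measurable_fst measurable_fst]
      rfl
    · rw [Measure.map_map measurable_snd (by fun_prop), ← (hq' t ht.2).2, ← hπ' t ht,
        Measure.map_map measurable_snd (by fun_prop)]
      rfl
  -- Measurability, from weak continuity of the kernels, is needed to split the integral over the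
  -- glued coupling into its two marginal parts.
  · have m₁ := measurable_otCost (hc s hs.1).continuous_ofReal
      (P.flow.continuous_kernel (s := ⟨s, h₁ hs.1⟩) (t := ⟨t, h₁ ht.1⟩) (Subtype.mk_le_mk.2 hst))
      (Q.flow.continuous_kernel (s := ⟨s, h₂ hs.1⟩) (t := ⟨t, h₂ ht.1⟩) (Subtype.mk_le_mk.2 hst))
    have m₂ := measurable_otCost (hc' s hs.2).continuous_ofReal
      (Q.flow.continuous_kernel (s := ⟨s, h₂ hs.1⟩) (t := ⟨t, h₂ ht.1⟩) (Subtype.mk_le_mk.2 hst))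
      (R.flow.continuous_kernel (s := ⟨s, h₂' hs.2⟩) (t := ⟨t, h₂' ht.2⟩) (Subtype.mk_le_mk.2 hst))
    have e₁ := lintegral_map (μ := π t ht) m₁ measurable_fst
    have e₂ := lintegral_map (μ := π t ht) (g := fun z => (z.1.2, z.2)) m₂ (by fun_prop)
    rw [hπ t ht] at e₁
    rw [hπ' t ht] at e₂
    rw [ENNReal.ofReal_add hr hr']
    refine (lintegral_map_le _ _).trans (le_trans ?_
      (add_le_add (he s t hs.1 ht.1 hst) (he' s t hs.2 ht.2 hst)))
    refine le_trans ?_ (le_of_eq (congrArg₂ (· + ·) e₁.symm e₂.symm))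
    refine le_trans (lintegral_mono fun z => ?_)
      (le_of_eq (lintegral_add_left (m₁.comp measurable_fst) _))
    refine otCost_triangle (hc s hs.1).continuous_ofReal.measurable
      (hc' s hs.2).continuous_ofReal.measurable (fun x y w => ?_) _ _ _
    rw [← ENNReal.ofReal_add ((hc s hs.1).nonneg _ _) ((hc' s hs.2).nonneg _ _)]
    exact ENNReal.ofReal_le_ofReal (hle s hs x y w)

theorem dFPair_self {I J : Set ℝ} {P : MetricFlowPair.{u} I} (hP : P.FullyDefined J) :
    dFPair J P P = 0 := by
  refine le_antisymm (ENNReal.le_of_forall_pos_le_add fun ε hε _ => ?_) (zero_le)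
  rw [zero_add, ← ENNReal.ofReal_coe_nnreal]
  exact dFPair_le_of_fClose (by exact_mod_cast hε) (FClose.refl hP _)

theorem dFPair_comm {I J : Set ℝ} (P Q : MetricFlowPair.{u} I) :
    dFPair J P Q = dFPair J Q P := by
  have key : ∀ P Q : MetricFlowPair.{u} I, dFPair J P Q ≤ dFPair J Q P := fun P Q =>
    le_of_forall_gt fun a ha => by
      obtain ⟨r, hr, hra, h⟩ := exists_fClose_of_dFPair_lt ha
      exact (dFPair_le_of_fClose hr h.symm).trans_lt hra
  exact le_antisymm (key P Q) (key Q P)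

theorem dFPair_triangle {I J : Set ℝ} (P Q R : MetricFlowPair.{u} I) :
    dFPair J P R ≤ dFPair J P Q + dFPair J Q R := by
  refine ENNReal.le_of_forall_pos_le_add fun ε hε hlt => ?_
  have hε2 : (ε : ℝ≥0∞) / 2 ≠ 0 := by simp [hε.ne']
  obtain ⟨r, hr, hra, h⟩ := exists_fClose_of_dFPair_lt
    (ENNReal.lt_add_right (lt_of_le_of_lt le_self_add hlt).ne hε2)
  obtain ⟨r', hr', hra', h'⟩ := exists_fClose_of_dFPair_lt
    (ENNReal.lt_add_right (lt_of_le_of_lt le_add_self hlt).ne hε2)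
  calc dFPair J P R ≤ ENNReal.ofReal (r + r') :=
        dFPair_le_of_fClose (add_pos hr hr') (h.trans h' hr.le hr'.le)
    _ = ENNReal.ofReal r + ENNReal.ofReal r' := ENNReal.ofReal_add hr.le hr'.le
    _ ≤ (dFPair J P Q + ε / 2) + (dFPair J Q R + ε / 2) := add_le_add hra.le hra'.le
    _ = _ := by rw [add_add_add_comm, ENNReal.add_halves]

/-! ### Pairs at distance zero are almost always isometric -/

theorem otCost_dirac {X Y : Type*} [MeasurableSpace X] [MeasurableSingletonClass X]
    [MeasurableSpace Y] [MeasurableSingletonClass Y] (c : X → Y → ℝ≥0∞) (x : X) (y : Y) :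
    c x y ≤ otCost c (Measure.dirac x) (Measure.dirac y) := by
  refine le_iInf₂ fun q hq => ?_
  have hp := hq.isProbabilityMeasure
  have h1 : ∀ᵐ z ∂q, z.1 = x := by
    have : ∀ᵐ a ∂(q.map Prod.fst), a = x := by rw [hq.1]; simp [ae_dirac_eq]
    exact ae_of_ae_map measurable_fst.aemeasurable this
  have h2 : ∀ᵐ z ∂q, z.2 = y := by
    have : ∀ᵐ a ∂(q.map Prod.snd), a = y := by rw [hq.2]; simp [ae_dirac_eq]
    exact ae_of_ae_map measurable_snd.aemeasurable this
  have : ∫⁻ z, c z.1 z.2 ∂q = ∫⁻ _, c x y ∂q :=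
    lintegral_congr_ae (by filter_upwards [h1, h2] with z hz hz'; rw [hz, hz'])
  rw [this, lintegral_const, measure_univ, mul_one]

/-- A lower bound for an integral of a function which need not be measurable. -/
theorem exists_mem_lt_of_lintegral_lt {X : Type*} [MeasurableSpace X] {q : Measure X}
    {f : X → ℝ≥0∞} {U : Set X} (hU : MeasurableSet U) {a : ℝ≥0∞}
    (h : ∫⁻ x, f x ∂q < a * q U) : ∃ x ∈ U, f x < a := by
  by_contra! hcon
  refine h.not_ge ?_
  calc a * q U = ∫⁻ _ in U, a ∂q := by rw [setLIntegral_const]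
    _ ≤ ∫⁻ x in U, f x ∂q := setLIntegral_mono' hU hcon
    _ ≤ ∫⁻ x, f x ∂q := setLIntegral_le_lintegral _ _

theorem ProbabilityMeasure.exists_eventually_le_of_isOpen {X : Type*} [MetricSpace X]
    [MeasurableSpace X] [BorelSpace X] {ι : Type*} {F : Filter ι}
    {q : ι → ProbabilityMeasure X} {q' : ProbabilityMeasure X} (h : Tendsto q F (𝓝 q'))
    {U : Set X} (hU : IsOpen U) (hpos : (q' : Measure X) U ≠ 0) :
    ∃ δ : ℝ≥0∞, δ ≠ 0 ∧ ∀ᶠ n in F, δ < (q n : Measure X) U := by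
  obtain ⟨δ, hδ, hδU⟩ := exists_between (pos_iff_ne_zero.2 hpos)
  exact ⟨δ, hδ.ne', eventually_lt_of_lt_liminf
    (hδU.trans_le (ProbabilityMeasure.le_liminf_measure_open_of_tendsto h hU))⟩

/-- The limit is taken along a general filter, in applications an ultrafilter, where dominated
convergence is not at hand. Instead the common Lipschitz constant reduces the claim to the centres
of finitely many balls carrying most of the mass. -/
theorem tendsto_integral_min_of_lipschitz {X : Type*} [MetricSpace X] [MeasurableSpace X]
    [BorelSpace X] [SecondCountableTopology X] {α : Measure X} [IsProbabilityMeasure α]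
    {F : Filter ℕ} {g : ℕ → X → ℝ} {K : ℝ≥0} (hg : ∀ᶠ n in F, LipschitzWith K (g n))
    (h0 : ∀ᶠ n in F, ∀ x, 0 ≤ g n x) (hlim : ∀ x, Tendsto (fun n => g n x) F (𝓝 0)) :
    Tendsto (fun n => ∫ x, min 1 (g n x) ∂α) F (𝓝 0) := by
  have hne : Nonempty X := nonempty_of_isProbabilityMeasure α
  obtain ⟨D, hD⟩ := TopologicalSpace.exists_dense_seq X
  rw [Metric.tendsto_nhds]
  intro ε hε
  set r : ℝ := ε / (4 * (K + 1)) with hr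
  have hr0 : 0 < r := by positivity
  have hKr : K * r ≤ ε / 4 := by
    rw [hr, mul_div_assoc', div_le_div_iff₀ (by positivity) (by positivity)]
    nlinarith [K.coe_nonneg]
  obtain ⟨k, hk⟩ := exists_measure_compl_iUnion_ball_le (μ := fun _ => ⟨α, ‹_›⟩)
    (fun ε hε => ⟨0, fun n _ f _ _ => by simpa using hε.le⟩) hD hr0
    (η := ENNReal.ofReal (ε / 4)) (by simpa using hε)
  have hk := hk 0
  set B : Set X := ⋃ i ≤ k, Metric.closedBall (D i) r with hB
  have hBm : MeasurableSet B := by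
    refine MeasurableSet.iUnion fun i => MeasurableSet.iUnion fun _ => measurableSet_closedBall
  have hD' : ∀ᶠ n in F, ∀ i ∈ Set.Iic k, g n (D i) < ε / 4 :=
    (eventually_all_finite (Set.finite_Iic k)).2 fun i _ =>
      (hlim (D i)).eventually_lt_const (by positivity)
  filter_upwards [hg, h0, hD'] with n hn hn0 hnD
  have hm01 : ∀ x, min 1 (g n x) ∈ Set.Icc (0 : ℝ) 1 := fun x =>
    ⟨le_min zero_le_one (hn0 x), min_le_left _ _⟩
  have hmc : Continuous fun x => min 1 (g n x) := continuous_const.min hn.continuous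
  have hle : ∀ x, min 1 (g n x) ≤ ε / 2 + Bᶜ.indicator (fun _ => (1 : ℝ)) x := by
    intro x
    by_cases hx : x ∈ B
    · rw [Set.indicator_of_notMem (by simpa using hx), add_zero]
      simp only [hB, Set.mem_iUnion] at hx
      obtain ⟨i, hi, hx⟩ := hx
      have h1 := hn.dist_le_mul x (D i)
      have h2 := hnD i hi
      rw [Real.dist_eq] at h1
      have h3 : (K : ℝ) * dist x (D i) ≤ K * r := by gcongr; exact hx
      exact (min_le_right _ _).trans (by linarith [le_abs_self (g n x - g n (D i))])
    · rw [Set.indicator_of_mem (by simpa using hx)]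
      exact (min_le_left _ _).trans (by linarith)
  have hint : ∫ x, min 1 (g n x) ∂α ≤ ε / 2 + ε / 4 := by
    refine (integral_mono (Integrable.of_mem_Icc 0 1 hmc.aemeasurable (ae_of_all _ hm01))
      ((integrable_const _).add ((integrable_const _).indicator hBm.compl)) hle).trans ?_
    refine (integral_add (integrable_const _) ((integrable_const _).indicator hBm.compl)).le.trans ?_
    rw [integral_indicator hBm.compl]
    simp only [integral_const, probReal_univ, smul_eq_mul, one_mul, mul_one,
      measureReal_restrict_apply_univ]
    gcongr
    exact ENNReal.toReal_le_of_le_ofReal (by positivity) hk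
  rw [Real.dist_eq, sub_zero, abs_of_nonneg (integral_nonneg fun x => (hm01 x).1)]
  linarith

/-- Values in `[0, 1]` differ by at most 1, so the error `g` may be truncated; only its truncated
integral is known to be small. -/
theorem IsCoupling.abs_integral_sub_le {X Y : Type*} [MeasurableSpace X] [MeasurableSpace Y]
    {p : Measure (X × Y)} {α : Measure X} {β : Measure Y} [IsProbabilityMeasure α]
    (hp : IsCoupling p α β)
    {c : X → Y → ℝ} (hc : Measurable (Function.uncurry c)) (hc0 : ∀ x y, 0 ≤ c x y)
    {f : X → ℝ} {f' : Y → ℝ} {g : X → ℝ} (hf : Measurable f) (hf' : Measurable f')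
    (hg : Measurable g) (hg0 : ∀ x, 0 ≤ g x) (h01 : ∀ x, f x ∈ Set.Icc (0 : ℝ) 1)
    (h01' : ∀ x, f' x ∈ Set.Icc (0 : ℝ) 1) (h : ∀ x y, |f x - f' y| ≤ c x y + g x) {ε : ℝ}
    (hε : 0 ≤ ε) (hcost : ∫⁻ z, ENNReal.ofReal (c z.1 z.2) ∂p ≤ ENNReal.ofReal ε) :
    |∫ x, f x ∂α - ∫ y, f' y ∂β| ≤ ε + ∫ x, min 1 (g x) ∂α := by
  have hpp := hp.isProbabilityMeasure
  have i1 : Integrable (fun z : X × Y => f z.1) p :=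
    Integrable.of_mem_Icc 0 1 (by fun_prop) (ae_of_all _ fun z => h01 z.1)
  have i2 : Integrable (fun z : X × Y => f' z.2) p :=
    Integrable.of_mem_Icc 0 1 (by fun_prop) (ae_of_all _ fun z => h01' z.2)
  have i3 : Integrable (fun z : X × Y => min 1 (g z.1)) p :=
    Integrable.of_mem_Icc 0 1 (by fun_prop)
      (ae_of_all _ fun z => ⟨le_min zero_le_one (hg0 _), min_le_left _ _⟩)
  have i4 : Integrable (fun z : X × Y => c z.1 z.2) p := by
    refine ⟨hc.aestronglyMeasurable, ?_⟩
    rw [hasFiniteIntegral_iff_ofReal (ae_of_all _ fun z => hc0 _ _)]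
    exact hcost.trans_lt ENNReal.ofReal_lt_top
  have e1 : ∫ x, f x ∂α = ∫ z, f z.1 ∂p := by
    rw [← hp.1, integral_map measurable_fst.aemeasurable hf.aestronglyMeasurable]
  have e2 : ∫ y, f' y ∂β = ∫ z, f' z.2 ∂p := by
    rw [← hp.2, integral_map measurable_snd.aemeasurable hf'.aestronglyMeasurable]
  have e3 : ∫ x, min 1 (g x) ∂α = ∫ z, min 1 (g z.1) ∂p := by
    rw [← hp.1, integral_map measurable_fst.aemeasurable
      (measurable_const.min hg).aestronglyMeasurable]
  have e4 : ∫ z, c z.1 z.2 ∂p ≤ ε := by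
    rw [integral_eq_lintegral_of_nonneg_ae (ae_of_all _ fun z => hc0 _ _) hc.aestronglyMeasurable]
    exact ENNReal.toReal_le_of_le_ofReal hε hcost
  rw [e1, e2, e3, ← integral_sub i1 i2]
  refine (abs_integral_le_integral_abs).trans ?_
  refine (integral_mono (i1.sub i2).abs (i4.add i3) fun z => ?_).trans
    ((integral_add i4 i3).le.trans (by gcongr))
  have a1 := h01 z.1
  have a2 := h01' z.2
  have a3 := h z.1 z.2
  have a4 := hc0 z.1 z.2
  simp only [Pi.add_apply, Pi.sub_apply]
  rcases min_cases 1 (g z.1) with ⟨h1, h2⟩ | ⟨h1, h2⟩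
  · rw [h1, abs_le]; constructor <;> linarith [a1.1, a1.2, a2.1, a2.2]
  · rw [h1]; exact a3

theorem exists_mem_of_relation {X Y : Type*} [MetricSpace X] [MetricSpace Y] [CompleteSpace Y]
    {R : Set (X × Y)} (hR : IsClosed R)
    (hd : ∀ z ∈ R, ∀ z' ∈ R, dist z.1 z'.1 = dist z.2 z'.2) (h₁ : Dense (Prod.fst '' R)) (x : X) :
    ∃ y, (x, y) ∈ R := by
  obtain ⟨a, ha, hax⟩ := mem_closure_iff_seq_limit.1 (h₁ x)
  choose z hz hza using ha
  have hc : CauchySeq fun n => (z n).2 := by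
    have := hax.cauchySeq
    rw [Metric.cauchySeq_iff] at this ⊢
    simpa only [← hd _ (hz _) _ (hz _), hza] using this
  obtain ⟨y, hy⟩ := cauchySeq_tendsto_of_complete hc
  refine ⟨y, hR.mem_of_tendsto (b := atTop) (f := z) ?_ (Eventually.of_forall hz)⟩
  rw [nhds_prod_eq]
  exact Tendsto.prodMk (by simpa only [hza] using hax) hy

/-- An isometry from a closed relation that preserves distances and has dense projections. -/
theorem exists_isometryEquiv_of_relation {X Y : Type*} [MetricSpace X] [CompleteSpace X]
    [MetricSpace Y] [CompleteSpace Y] {R : Set (X × Y)} (hR : IsClosed R)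
    (hd : ∀ z ∈ R, ∀ z' ∈ R, dist z.1 z'.1 = dist z.2 z'.2) (h₁ : Dense (Prod.fst '' R))
    (h₂ : Dense (Prod.snd '' R)) : ∃ φ : X ≃ᵢ Y, ∀ x y, (x, y) ∈ R ↔ y = φ x := by
  choose f hf using exists_mem_of_relation hR hd h₁
  choose g hg using exists_mem_of_relation (R := Prod.swap ⁻¹' R) (hR.preimage continuous_swap)
    (fun z hz z' hz' => (hd _ hz _ hz').symm) (by
      have : Prod.fst '' (Prod.swap ⁻¹' R) = Prod.snd '' R := by
        ext y
        constructor
        · rintro ⟨z, hz, rfl⟩; exact ⟨_, hz, rfl⟩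
        · rintro ⟨z, hz, rfl⟩; exact ⟨z.swap, by simpa using hz, rfl⟩
      rwa [this])
  have hu : ∀ {x y y'}, (x, y) ∈ R → (x, y') ∈ R → y = y' := fun h h' => by
    have := hd _ h _ h'
    rw [dist_self] at this
    exact dist_eq_zero.1 this.symm
  have hu' : ∀ {x x' y}, (x, y) ∈ R → (x', y) ∈ R → x = x' := fun h h' => by
    have := hd _ h _ h'
    rw [dist_self] at this
    exact dist_eq_zero.1 this
  refine ⟨IsometryEquiv.mk' f g (fun y => hu (hf _) (hg y))
    (Isometry.of_dist_eq fun x x' => (hd _ (hf x) _ (hf x')).symm), fun x y => ⟨fun h => ?_, ?_⟩⟩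
  · exact hu h (hf x)
  · rintro rfl; exact hf x

section Limit

variable {X Y : Type u} [MetricSpace X] [MeasurableSpace X] [BorelSpace X] [CompleteSpace X]
  [SecondCountableTopology X] [MetricSpace Y] [MeasurableSpace Y] [BorelSpace Y] [CompleteSpace Y]
  [SecondCountableTopology Y]

/-- Couplings of two measures of full support whose costs tend to zero with respect to a sequence of
bridges converge to the graph of an isometry. -/
theorem exists_isometryEquiv_of_couplings (F : Ultrafilter ℕ) {μ : ProbabilityMeasure X}
    {ν : ProbabilityMeasure Y} (hμ : (μ : Measure X).support = Set.univ)
    (hν : (ν : Measure Y).support = Set.univ) {c : ℕ → X → Y → ℝ}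
    (hc : ∀ᶠ n in F, IsBridge (c n)) {q : ℕ → ProbabilityMeasure (X × Y)}
    (hq : ∀ᶠ n in F, IsCoupling (q n : Measure (X × Y)) (μ : Measure X) (ν : Measure Y))
    (hlim : Tendsto (fun n => ∫⁻ z, ENNReal.ofReal (c n z.1 z.2) ∂(q n : Measure (X × Y))) F (𝓝 0)) :
    ∃ φ : X ≃ᵢ Y, (μ : Measure X).map φ = ν ∧ (∀ x, Tendsto (fun n => c n x (φ x)) F (𝓝 0)) ∧
      ∀ x, ∀ r > 0, ∃ δ : ℝ≥0∞, δ ≠ 0 ∧ ∀ᶠ n in F,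
        δ < (q n : Measure (X × Y)) (Metric.ball x r ×ˢ Metric.ball (φ x) r) := by
  obtain ⟨p, hp, hqp⟩ := exists_tendsto_coupling F tendsto_const_nhds tendsto_const_nhds hq
  have hmass : ∀ z ∈ (p : Measure (X × Y)).support, ∀ r > 0, ∃ δ : ℝ≥0∞, δ ≠ 0 ∧ ∀ᶠ n in F,
      δ < (q n : Measure (X × Y)) (Metric.ball z.1 r ×ˢ Metric.ball z.2 r) := by
    intro z hz r hr
    have hU : IsOpen (Metric.ball z.1 r ×ˢ Metric.ball z.2 r) :=
      Metric.isOpen_ball.prod Metric.isOpen_ball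
    refine ProbabilityMeasure.exists_eventually_le_of_isOpen hqp hU (ne_of_gt ?_)
    exact (Measure.mem_support_iff_forall _).1 hz _
      (hU.mem_nhds ⟨Metric.mem_ball_self hr, Metric.mem_ball_self hr⟩)
  -- The couplings keep mass at least `δ` near `z` while their costs tend to 0, so some nearby point
  -- has small cost; the bridge inequality carries this to `z`.
  have hzero : ∀ z ∈ (p : Measure (X × Y)).support,
      Tendsto (fun n => c n z.1 z.2) F (𝓝 0) := by
    intro z hz
    rw [Metric.tendsto_nhds]
    intro ε hε
    obtain ⟨δ, hδ, hev⟩ := hmass z hz (ε / 3) (by positivity)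
    have hpos : 0 < ENNReal.ofReal (ε / 3) * δ := by
      refine ENNReal.mul_pos ?_ hδ
      simpa using hε
    filter_upwards [hev, hc, hlim.eventually_lt_const hpos] with n h1 h2 h3
    obtain ⟨w, hw, hwc⟩ := exists_mem_lt_of_lintegral_lt
      (measurableSet_ball.prod measurableSet_ball)
      (h3.trans_le (mul_le_mul_right h1.le _))
    have := h2.le_add z.1 w.1 z.2 w.2
    have h4 := (ENNReal.ofReal_lt_ofReal_iff (by positivity)).1 hwc
    have h5 : dist w.1 z.1 < ε / 3 := hw.1
    have h6 : dist w.2 z.2 < ε / 3 := hw.2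
    rw [dist_comm] at h5 h6
    rw [Real.dist_eq, sub_zero, abs_of_nonneg (h2.nonneg _ _)]
    linarith
  -- Vanishing bridges make the support preserve distances, and full support of the marginals makes
  -- both projections dense.
  obtain ⟨φ, hφ⟩ := exists_isometryEquiv_of_relation (R := (p : Measure (X × Y)).support)
    Measure.isClosed_support (fun z hz z' hz' => by
      have h1 := hzero z hz
      have h2 := hzero z' hz'
      refine le_antisymm ?_ ?_
      · refine ge_of_tendsto (f := fun n => c n z.1 z.2 + dist z.2 z'.2 + c n z'.1 z'.2) (x := F) ?_
          (hc.mono fun n hn => hn.dist_left_le _ _ _ _)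
        simpa using (h1.add_const (dist z.2 z'.2)).add h2
      · refine ge_of_tendsto (f := fun n => c n z.1 z.2 + dist z.1 z'.1 + c n z'.1 z'.2) (x := F) ?_
          (hc.mono fun n hn => hn.dist_right_le _ _ _ _)
        simpa using (h1.add_const (dist z.1 z'.1)).add h2)
    (by
      rw [dense_iff_inter_open]
      rintro U hU ⟨x, hx⟩
      have hx' : 0 < (μ : Measure X) U := (Measure.mem_support_iff_forall _).1
        (hμ ▸ Set.mem_univ x : x ∈ (μ : Measure X).support) U (hU.mem_nhds hx)
      rw [← hp.1, Measure.map_apply measurable_fst hU.measurableSet] at hx'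
      obtain ⟨z, hz, hz'⟩ := Measure.nonempty_inter_support_of_pos hx'
      exact ⟨z.1, hz, z, hz', rfl⟩)
    (by
      rw [dense_iff_inter_open]
      rintro U hU ⟨x, hx⟩
      have hx' : 0 < (ν : Measure Y) U := (Measure.mem_support_iff_forall _).1
        (hν ▸ Set.mem_univ x : x ∈ (ν : Measure Y).support) U (hU.mem_nhds hx)
      rw [← hp.2, Measure.map_apply measurable_snd hU.measurableSet] at hx'
      obtain ⟨z, hz, hz'⟩ := Measure.nonempty_inter_support_of_pos hx'
      exact ⟨z.2, hz, z, hz', rfl⟩)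
  refine ⟨φ, ?_, fun x => hzero (x, φ x) ((hφ _ _).2 rfl),
    fun x => hmass (x, φ x) ((hφ _ _).2 rfl)⟩
  have hae : Prod.snd =ᵐ[(p : Measure (X × Y))] φ ∘ Prod.fst := by
    filter_upwards [Measure.support_mem_ae (μ := (p : Measure (X × Y)))] with z hz
    exact (hφ z.1 z.2).1 hz
  rw [← hp.2, Measure.map_congr hae, ← Measure.map_map (measurable_isometryEquiv φ) measurable_fst,
    hp.1]

end Limit

/-- The isometries of `exists_isometryEquiv_of_couplings` intertwine the conjugate heat kernels. -/
theorem map_eq_of_tendsto_otCost {X Y : Type u} [MetricSpace X] [MeasurableSpace X] [BorelSpace X]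
    [SecondCountableTopology X] [MetricSpace Y] [MeasurableSpace Y] [BorelSpace Y]
    [SecondCountableTopology Y] {X' Y' : Type*} [MetricSpace X'] [MeasurableSpace X']
    [BorelSpace X'] [MetricSpace Y'] [MeasurableSpace Y'] [BorelSpace Y']
    {F : Filter ℕ} [F.NeBot]
    {c : ℕ → X → Y → ℝ} (hc : ∀ᶠ n in F, IsBridge (c n)) {φ : X ≃ᵢ Y}
    (hφ : ∀ x, Tendsto (fun n => c n x (φ x)) F (𝓝 0)) {K : ℝ}
    {κ : X' → ProbabilityMeasure X} {η : Y' → ProbabilityMeasure Y}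
    (hκ : ∀ a b, BLClose (K * dist a b) (κ a : Measure X) (κ b : Measure X))
    (hη : ∀ a b, BLClose (K * dist a b) (η a : Measure Y) (η b : Measure Y))
    {q : ℕ → Measure (X' × Y')} {x : X'} {y : Y'}
    (hq : ∀ r > 0, ∃ δ : ℝ≥0∞, δ ≠ 0 ∧ ∀ᶠ n in F, δ < q n (Metric.ball x r ×ˢ Metric.ball y r))
    (hlim : Tendsto (fun n => ∫⁻ z, otCost (fun x y => ENNReal.ofReal (c n x y))
      (κ z.1 : Measure X) (η z.2 : Measure Y) ∂(q n)) F (𝓝 0)) :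
    (κ x : Measure X).map φ = η y := by
  have hφm := measurable_isometryEquiv φ
  have hpm : IsProbabilityMeasure ((κ x : Measure X).map φ) :=
    Measure.isProbabilityMeasure_map hφm.aemeasurable
  refine ext_of_forall_lipschitzWith_one fun f hf hf' => ?_
  rw [integral_map hφm.aemeasurable hf.continuous.aestronglyMeasurable]
  have hfφ : LipschitzWith 1 fun z => f (φ z) := by
    have := hf.comp φ.isometry.lipschitz
    rwa [one_mul] at this
  have hg : ∀ᶠ n in F, LipschitzWith 2 fun z => c n z (φ z) := by
    filter_upwards [hc] with n hn
    refine LipschitzWith.of_le_add_mul 2 fun a b => ?_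
    have := hn.le_add a b (φ a) (φ b)
    rw [φ.dist_eq] at this
    norm_num
    linarith
  have hg0 : ∀ᶠ n in F, ∀ z, 0 ≤ c n z (φ z) := hc.mono fun n hn z => hn.nonneg _ _
  have htend := tendsto_integral_min_of_lipschitz (α := (κ x : Measure X)) hg hg0 hφ
  rw [← sub_eq_zero, ← abs_nonpos_iff]
  refine le_of_forall_pos_le_add fun ε hε => ?_
  rw [zero_add]
  -- Moving a base point by less than `r` changes test integrals by at most `ε / 8`; six such errors
  -- occur in total.
  set r : ℝ := ε / (8 * (|K| + 1)) with hr
  have hr0 : 0 < r := by positivity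
  have hKr : ∀ d, 0 ≤ d → d ≤ r → K * d ≤ ε / 8 := by
    intro d hd hdr
    calc K * d ≤ (|K| + 1) * r := by
          refine mul_le_mul ?_ hdr hd (by positivity)
          linarith [le_abs_self K]
      _ = ε / 8 := by rw [hr]; field_simp
  obtain ⟨δ, hδ, hev⟩ := hq r hr0
  have hpos : 0 < ENNReal.ofReal (ε / 8) * δ := by
    refine ENNReal.mul_pos ?_ hδ
    simpa using hε
  obtain ⟨n, h1, h2, h3, h4, h5⟩ := (hev.and (hc.and ((hlim.eventually_lt_const hpos).and
    (hg.and (htend.eventually_lt_const (show (0 : ℝ) < ε / 8 by positivity)))))).exists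
  -- Only an average over `q n` is controlled, so the kernels are compared at some `w` close to `(x,
  -- y)` instead of at `(x, y)`.
  obtain ⟨w, hw, hwc⟩ := exists_mem_lt_of_lintegral_lt
    (measurableSet_ball.prod measurableSet_ball) (h3.trans_le (mul_le_mul_right h1.le _))
  obtain ⟨p, hp, hpc⟩ := exists_coupling_of_otCost_lt hwc
  have hd1 := hκ x w.1 (fun z => f (φ z)) hfφ fun z => hf' _
  have hd2 := hη w.2 y f hf hf'
  have hw1 : dist w.1 x < r := hw.1
  have hw2 : dist w.2 y < r := hw.2
  rw [dist_comm] at hw1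
  have hk1 := hKr _ dist_nonneg hw1.le
  have hk2 := hKr _ dist_nonneg hw2.le
  have hmid := hp.abs_integral_sub_le h2.continuous.measurable h2.nonneg
    hfφ.continuous.measurable hf.continuous.measurable h4.continuous.measurable
    (fun z => h2.nonneg z (φ z)) (fun z => hf' _) hf' (fun a b => by
      have e1 := hf.dist_le_mul (φ a) b
      have e2 := h2.dist_right_le a a (φ a) b
      rw [dist_self, add_zero] at e2
      rw [Real.dist_eq] at e1
      norm_num at e1
      linarith) (show (0 : ℝ) ≤ ε / 8 by positivity) hpc.le
  -- `htend` concerns the measure at `x`, while `hmid` involves the one at `w.1`. The half makes the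
  -- 2-Lipschitz integrand admissible for `BLClose`.
  have hhalf := hκ x w.1 (fun z => min 1 (c n z (φ z)) / 2) (by
      refine LipschitzWith.of_le_add_mul 1 fun a b => ?_
      have e1 := h4.dist_le_mul a b
      rw [Real.dist_eq] at e1
      have e2 := le_abs_self (c n a (φ a) - c n b (φ b))
      norm_num at e1 ⊢
      rcases min_cases 1 (c n b (φ b)) with ⟨h, _⟩ | ⟨h, _⟩
      · rw [h]; linarith [min_le_left 1 (c n a (φ a)), dist_nonneg (x := a) (y := b)]
      · rw [h]; linarith [min_le_right 1 (c n a (φ a))])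
    fun z => ⟨by have := le_min zero_le_one (h2.nonneg z (φ z)); linarith,
      by have := min_le_left 1 (c n z (φ z)); linarith⟩
  rw [integral_div, integral_div] at hhalf
  rw [abs_le] at hd1 hd2 hmid hhalf ⊢
  constructor <;> linarith [hd1.1, hd1.2, hd2.1, hd2.2, hmid.1, hmid.2, hhalf.1, hhalf.2]

theorem MetricFlow.blClose_kernel {A : Set ℝ} (X : MetricFlow.{u} A) {s t : A} (h : s ≤ t)
    (a b : X.slice t) : BLClose (heatConst * dist a b) (X.kernel h a : Measure (X.slice s))
      (X.kernel h b : Measure (X.slice s)) :=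
  (X.heatStep h a b).blClose (by rw [dist_comm]; exact X.heatStep h b a) dist_nonneg

theorem summable_half_pow_sq : Summable fun n : ℕ => ((1 / 2 : ℝ) ^ n) ^ 2 := by
  have : ∀ n : ℕ, ((1 / 2 : ℝ) ^ n) ^ 2 = (1 / 4) ^ n := fun n => by
    rw [← pow_mul, mul_comm, pow_mul]; norm_num
  simp only [this]
  exact summable_geometric_of_lt_one (by norm_num) (by norm_num)

/-- Borel–Cantelli: almost every time lies in all but finitely many of the sets `T n`. -/
theorem FClose.dom_null_of_summable {I : Set ℝ} {T : ℕ → Set ℝ} {r : ℕ → ℝ}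
    (hr : ∀ n, volume (I \ T n) ≤ ENNReal.ofReal (r n ^ 2)) (hs : Summable fun n => r n ^ 2) :
    volume (I \ {t | ∃ N, ∀ n ≥ N, t ∈ T n}) = 0 := by
  have h := measure_limsup_atTop_eq_zero (μ := volume) (s := fun n => I \ T n)
    (ne_top_of_le_ne_top hs.tsum_ofReal_ne_top (ENNReal.tsum_le_tsum hr))
  refine measure_mono_null ?_ h
  rintro t ⟨ht, h⟩
  rw [mem_limsup_iff_frequently_mem, frequently_atTop]
  intro N
  by_contra hcon
  push Not at hcon
  exact h ⟨N, fun n hn => by_contra fun h' => hcon n hn ⟨ht, h'⟩⟩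

theorem nonempty_isometry_of_forall_fClose {I J : Set ℝ} {P Q : MetricFlowPair.{u} I}
    (h : ∀ r > 0, FClose J P Q r) : Nonempty (AlmostAlwaysIsometry P Q J) := by
  choose T h₁ h₂ c q hJ hm hv hc hq hr using fun n : ℕ => h ((1 / 2) ^ n) (by positivity)
  set S : Set ℝ := {t | ∃ N, ∀ n ≥ N, t ∈ T n} with hS
  have hS₁ : S ⊆ P.dom := fun t ⟨N, hN⟩ => h₁ N (hN N le_rfl)
  have hS₂ : S ⊆ Q.dom := fun t ⟨N, hN⟩ => h₂ N (hN N le_rfl)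
  have hnull : volume (I \ S) = 0 := FClose.dom_null_of_summable hv summable_half_pow_sq
  -- One ultrafilter gives limits at all of the possibly uncountably many times simultaneously,
  -- which a diagonal subsequence would not.
  set F : Ultrafilter ℕ := hyperfilter ℕ with hF
  have hFT : ∀ t ∈ S, ∀ᶠ n in (F : Filter ℕ), t ∈ T n := fun t ⟨N, hN⟩ =>
    Nat.hyperfilter_le_atTop ((eventually_ge_atTop N).mono hN)
  have hzero : Tendsto (fun n : ℕ => ENNReal.ofReal ((1 / 2 : ℝ) ^ n)) F (𝓝 0) := by
    rw [← ENNReal.ofReal_zero]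
    exact (ENNReal.tendsto_ofReal (tendsto_pow_atTop_nhds_zero_of_lt_one (by norm_num)
      (by norm_num))).mono_left Nat.hyperfilter_le_atTop
  classical
  let μ' : ∀ t (ht : t ∈ S), ProbabilityMeasure (P.flow.slice ⟨t, hS₁ ht⟩) := fun t ht =>
    ⟨P.μ ⟨t, hS₁ ht⟩, inferInstance⟩
  let ν' : ∀ t (ht : t ∈ S), ProbabilityMeasure (Q.flow.slice ⟨t, hS₂ ht⟩) := fun t ht =>
    ⟨Q.μ ⟨t, hS₂ ht⟩, inferInstance⟩
  -- Dummy values for the finitely many `n` with `t ∉ T n`, invisible to the ultrafilter.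
  let c' : ∀ t (ht : t ∈ S), ℕ → P.flow.slice ⟨t, hS₁ ht⟩ → Q.flow.slice ⟨t, hS₂ ht⟩ → ℝ :=
    fun t ht n => if hn : t ∈ T n then c n t hn else fun _ _ => 0
  let q' : ∀ t (ht : t ∈ S),
      ℕ → ProbabilityMeasure (P.flow.slice ⟨t, hS₁ ht⟩ × Q.flow.slice ⟨t, hS₂ ht⟩) :=
    fun t ht n => if hn : t ∈ T n then
      ⟨q n t hn, (hq n t hn).isProbabilityMeasure⟩ else (μ' t ht).prod (ν' t ht)
  have hqe : ∀ t (ht : t ∈ S) n (hn : t ∈ T n),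
      (q' t ht n : Measure (P.flow.slice ⟨t, hS₁ ht⟩ × Q.flow.slice ⟨t, hS₂ ht⟩)) = q n t hn :=
    fun t ht n hn => congrArg ProbabilityMeasure.toMeasure (dif_pos hn)
  have hce : ∀ t (ht : t ∈ S) n (hn : t ∈ T n), c' t ht n = c n t hn :=
    fun t ht n hn => dif_pos hn
  have hc' : ∀ t (ht : t ∈ S), ∀ᶠ n in (F : Filter ℕ), IsBridge (c' t ht n) := fun t ht =>
    (hFT t ht).mono fun n hn => by rw [hce t ht n hn]; exact hc n t hn
  have hq' : ∀ t (ht : t ∈ S), ∀ᶠ n in (F : Filter ℕ),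
      IsCoupling (q' t ht n : Measure (P.flow.slice ⟨t, hS₁ ht⟩ × Q.flow.slice ⟨t, hS₂ ht⟩))
        (μ' t ht : Measure (P.flow.slice ⟨t, hS₁ ht⟩))
        (ν' t ht : Measure (Q.flow.slice ⟨t, hS₂ ht⟩)) :=
    fun t ht => (hFT t ht).mono fun n hn => by rw [hqe t ht n hn]; exact hq n t hn
  have hr' : ∀ s t (hs : s ∈ S) (ht : t ∈ S) (hst : s ≤ t),
      Tendsto (fun n => ∫⁻ z, otCost (fun x y => ENNReal.ofReal (c' s hs n x y))
        (P.flow.ν (s := ⟨s, hS₁ hs⟩) (t := ⟨t, hS₁ ht⟩) (Subtype.mk_le_mk.2 hst) z.1)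
        (Q.flow.ν (s := ⟨s, hS₂ hs⟩) (t := ⟨t, hS₂ ht⟩) (Subtype.mk_le_mk.2 hst) z.2)
        ∂(q' t ht n : Measure (P.flow.slice ⟨t, hS₁ ht⟩ × Q.flow.slice ⟨t, hS₂ ht⟩))) F (𝓝 0) := fun s t hs ht hst => by
    refine tendsto_of_tendsto_of_tendsto_of_le_of_le' tendsto_const_nhds hzero
      (Eventually.of_forall fun _ => zero_le) ?_
    filter_upwards [hFT s hs, hFT t ht] with n hns hnt
    rw [hqe t ht n hnt, hce s hs n hns]
    exact hr n s t hns hnt hst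
  have hlim : ∀ t (ht : t ∈ S), Tendsto (fun n => ∫⁻ z, ENNReal.ofReal (c' t ht n z.1 z.2)
      ∂(q' t ht n : Measure (P.flow.slice ⟨t, hS₁ ht⟩ × Q.flow.slice ⟨t, hS₂ ht⟩))) F (𝓝 0) := fun t ht => by
    refine tendsto_of_tendsto_of_tendsto_of_le_of_le tendsto_const_nhds (hr' t t ht ht le_rfl)
      (fun _ => zero_le) fun n => lintegral_mono fun z => ?_
    have e₁ := P.flow.ν_self ⟨t, hS₁ ht⟩ z.1
    have e₂ := Q.flow.ν_self ⟨t, hS₂ ht⟩ z.2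
    -- At `s = t` the kernels are Dirac measures, so the bound on transport costs bounds the
    -- integral of the bridge itself.
    have := otCost_dirac (fun x y => ENNReal.ofReal (c' t ht n x y)) z.1 z.2
    rw [← e₁, ← e₂] at this
    exact this
  choose φ hφμ hφc hφq using fun t (ht : t ∈ S) => exists_isometryEquiv_of_couplings F
    (P.full_support ⟨t, hS₁ ht⟩) (Q.full_support ⟨t, hS₂ ht⟩) (μ := μ' t ht) (ν := ν' t ht)
    (hc' t ht) (hq' t ht) (hlim t ht)
  refine ⟨⟨S, hS₁, hS₂, measure_mono_null (Set.sdiff_subset_sdiff_left P.dom_subset) hnull,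
    measure_mono_null (Set.sdiff_subset_sdiff_left Q.dom_subset) hnull,
    fun t ht => ⟨0, fun n _ => hJ n ht⟩, φ, fun s t hs ht hst x => ?_, hφμ⟩⟩
  exact map_eq_of_tendsto_otCost (hc' s hs) (hφc s hs)
    (P.flow.blClose_kernel (s := ⟨s, hS₁ hs⟩) (t := ⟨t, hS₁ ht⟩) (Subtype.mk_le_mk.2 hst))
    (Q.flow.blClose_kernel (s := ⟨s, hS₂ hs⟩) (t := ⟨t, hS₂ ht⟩) (Subtype.mk_le_mk.2 hst))
    (hφq t ht x) (hr' s t hs ht hst)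

/-! ### Gluing a sequence of metric spaces -/

/-- A metric space with an isometrically embedded copy of `A`. -/
structure IsometricExtension (A : Type u) [MetricSpace A] : Type (u + 1) where
  Space : Type u
  [metric : MetricSpace Space]
  embed : A → Space
  isom : Isometry embed

attribute [instance] IsometricExtension.metric

section Glue

variable {X W : ℕ → Type u} [∀ n, MetricSpace (X n)] [∀ n, MetricSpace (W n)]
  [∀ n, Nonempty (X n)] {f : ∀ n, X n → W n} {g : ∀ n, X (n + 1) → W n}

/-- The space obtained by gluing `W 0, …, W (n - 1)` along `X 1, …, X (n - 1)`. -/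
noncomputable def gluedSpace (hf : ∀ n, Isometry (f n)) (hg : ∀ n, Isometry (g n)) :
    ∀ n, IsometricExtension (X n)
  | 0 => ⟨X 0, id, isometry_id⟩
  | n + 1 => ⟨Metric.GlueSpace (gluedSpace hf hg n).isom (hf n),
      Metric.toGlueR (gluedSpace hf hg n).isom (hf n) ∘ g n,
      (Metric.toGlueR_isometry _ _).comp (hg n)⟩

/-- The inclusion of a glued space into the next one. -/
noncomputable def gluedSpaceSucc (hf : ∀ n, Isometry (f n)) (hg : ∀ n, Isometry (g n)) (n : ℕ) :
    (gluedSpace hf hg n).Space → (gluedSpace hf hg (n + 1)).Space :=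
  Metric.toGlueL (gluedSpace hf hg n).isom (hf n)

theorem gluedSpaceSucc_isometry (hf : ∀ n, Isometry (f n)) (hg : ∀ n, Isometry (g n)) (n : ℕ) :
    Isometry (gluedSpaceSucc hf hg n) :=
  Metric.toGlueL_isometry (gluedSpace hf hg n).isom (hf n)

theorem dist_gluedSpaceSucc (hf : ∀ n, Isometry (f n)) (hg : ∀ n, Isometry (g n)) (n : ℕ)
    (x : X n) (y : X (n + 1)) :
    dist (gluedSpaceSucc hf hg n ((gluedSpace hf hg n).embed x))
      ((gluedSpace hf hg (n + 1)).embed y) = dist (f n x) (g n y) := by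
  have h := congrFun (Metric.toGlue_commute (gluedSpace hf hg n).isom (hf n)) x
  have h' := (Metric.toGlueR_isometry (gluedSpace hf hg n).isom (hf n)).dist_eq (f n x) (g n y)
  refine Eq.trans ?_ h'
  exact congrArg (fun z => dist z (Metric.toGlueR (gluedSpace hf hg n).isom (hf n) (g n y))) h

end Glue

/-- A sequence of bridges is realized in a single complete separable metric space. -/
theorem exists_isometries_of_bridges {X : ℕ → Type u} [∀ n, MetricSpace (X n)]
    [∀ n, Nonempty (X n)] [∀ n, TopologicalSpace.SeparableSpace (X n)]
    {c : ∀ n, X n → X (n + 1) → ℝ} (hc : ∀ n, IsBridge (c n)) :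
    ∃ (Z : Type u) (_ : MetricSpace Z) (_ : CompleteSpace Z)
      (_ : TopologicalSpace.SeparableSpace Z) (ι : ∀ n, X n → Z), (∀ n, Isometry (ι n)) ∧
      ∀ n x y, dist (ι n x) (ι (n + 1) y) = c n x y := by
  choose W _ f g hf hg hfg using hc
  let V := UniformSpace.Completion (Metric.InductiveLimit (gluedSpaceSucc_isometry hf hg))
  let j : ∀ n, X n → V := fun n x =>
    ((Metric.toInductiveLimit (gluedSpaceSucc_isometry hf hg) n ((gluedSpace hf hg n).embed x) :
      Metric.InductiveLimit (gluedSpaceSucc_isometry hf hg)) : V)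
  have hj : ∀ n, Isometry (j n) := fun n =>
    UniformSpace.Completion.coe_isometry.comp
      ((Metric.toInductiveLimit_isometry _ n).comp (gluedSpace hf hg n).isom)
  have hd : ∀ n x y, dist (j n x) (j (n + 1) y) = c n x y := by
    intro n x y
    have h := congrFun (Metric.toInductiveLimit_commute (gluedSpaceSucc_isometry hf hg) n)
      ((gluedSpace hf hg n).embed x)
    simp only [j]
    rw [UniformSpace.Completion.dist_eq, ← h, Function.comp_apply,
      (Metric.toInductiveLimit_isometry _ (n + 1)).dist_eq, dist_gluedSpaceSucc, hfg]
  -- `V` contains all the spaces `W n`, which need not be separable; the closure of the images of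
  -- the `X n` is.
  let S : Set V := closure (⋃ n, Set.range (j n))
  have hS : TopologicalSpace.IsSeparable S :=
    (TopologicalSpace.IsSeparable.iUnion fun n =>
      TopologicalSpace.isSeparable_range (hj n).continuous).closure
  refine ⟨S, inferInstance, isClosed_closure.completeSpace_coe, hS.separableSpace,
    fun n x => ⟨j n x, subset_closure (Set.mem_iUnion.2 ⟨n, x, rfl⟩)⟩,
    fun n => Isometry.of_dist_eq fun x y => (hj n).dist_eq x y, hd⟩

/-- A version of `exists_isometries_of_bridges` for sequences that start at `N`. -/
theorem exists_isometries_of_bridges_from (N : ℕ) : ∀ {X : ∀ n, N ≤ n → Type u}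
    [∀ n h, MetricSpace (X n h)] [∀ n h, Nonempty (X n h)]
    [∀ n h, TopologicalSpace.SeparableSpace (X n h)]
    {c : ∀ n (h : N ≤ n), X n h → X (n + 1) (h.trans n.le_succ) → ℝ}
    (_ : ∀ n h, IsBridge (c n h)),
    ∃ (Z : Type u) (_ : MetricSpace Z) (_ : CompleteSpace Z)
      (_ : TopologicalSpace.SeparableSpace Z) (ι : ∀ n h, X n h → Z), (∀ n h, Isometry (ι n h)) ∧
      ∀ n h x y, dist (ι n h x) (ι (n + 1) (h.trans n.le_succ) y) = c n h x y := by
  induction N with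
  | zero =>
    intro X _ _ _ c hc
    obtain ⟨Z, h₁, h₂, h₃, ι, h₄, h₅⟩ := exists_isometries_of_bridges
      (X := fun n => X n (Nat.zero_le n)) fun n => hc n (Nat.zero_le n)
    exact ⟨Z, h₁, h₂, h₃, fun n _ => ι n, fun n _ => h₄ n, fun n _ => h₅ n⟩
  | succ N ih =>
    intro X _ _ _ c hc
    obtain ⟨Z, h₁, h₂, h₃, ι, h₄, h₅⟩ := ih (X := fun n h => X (n + 1) (Nat.succ_le_succ h))
      (c := fun n h => c (n + 1) (Nat.succ_le_succ h)) fun n h => hc (n + 1) (Nat.succ_le_succ h)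
    refine ⟨Z, h₁, h₂, h₃, fun n => match n with
      | 0 => fun h => absurd h (Nat.not_succ_le_zero N)
      | n + 1 => fun h => ι n (Nat.le_of_succ_le_succ h), fun n h => ?_, fun n h => ?_⟩
    · cases n with
      | zero => exact absurd h (Nat.not_succ_le_zero N)
      | succ n => exact h₄ n (Nat.le_of_succ_le_succ h)
    · cases n with
      | zero => exact absurd h (Nat.not_succ_le_zero N)
      | succ n => exact h₅ n (Nat.le_of_succ_le_succ h)

/-! ### Limits of kernels along sequences of sets -/

section Kernel

variable {X Z W : Type*} [MetricSpace X] [MeasurableSpace X] [BorelSpace X]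
  [MetricSpace Z] [MetricSpace W] [MeasurableSpace W] [BorelSpace W]

theorem tendsto_of_forall_blClose {ι : Type*} {F : Filter ι} [F.IsCountablyGenerated]
    {μ : ι → ProbabilityMeasure X} {μ' : ProbabilityMeasure X}
    (h : ∀ ε > 0, ∀ᶠ i in F, BLClose ε (μ i : Measure X) (μ' : Measure X)) :
    Tendsto μ F (𝓝 μ') :=
  tendsto_of_forall_lipschitzWith_one fun f hf hf' => by
    rw [Metric.tendsto_nhds]
    intro ε hε
    filter_upwards [h (ε / 2) (by positivity)] with i hi
    rw [Real.dist_eq]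
    exact (hi f hf hf').trans_lt (by linarith)

theorem BLClose.abs_integral_sub_le {X : Type*} [MetricSpace X] [MeasurableSpace X] {ε : ℝ} {μ ν : Measure X} (h : BLClose ε μ ν) {K : ℝ≥0}
    {f : X → ℝ} (hf : LipschitzWith K f) (hf' : ∀ x, f x ∈ Set.Icc (0 : ℝ) 1) :
    |∫ x, f x ∂μ - ∫ x, f x ∂ν| ≤ (K + 1) * ε := by
  have hK : (0 : ℝ) < K + 1 := by positivity
  have := h (fun x => f x / (K + 1)) (LipschitzWith.of_le_add_mul 1 fun x y => by
      have h1 := hf.dist_le_mul x y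
      rw [Real.dist_eq] at h1
      have h2 := le_abs_self (f x - f y)
      rw [div_le_iff₀ hK, add_mul, div_mul_cancel₀ _ hK.ne']
      have h3 : (0 : ℝ) ≤ dist x y := dist_nonneg
      push_cast
      nlinarith)
    (fun x => ⟨div_nonneg (hf' x).1 hK.le, (div_le_one hK).2 ((hf' x).2.trans (by
      have := K.coe_nonneg
      linarith))⟩)
  rw [integral_div, integral_div, ← sub_div, abs_div, abs_of_pos hK, div_le_iff₀ hK] at this
  linarith

/-- The integrals of a Lipschitz function against a family of measures satisfying the gradient
estimate on a set form a Lipschitz function. -/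
theorem exists_lipschitz_integral {τ : ℝ≥0} {B : Set Z} {κ : Z → ProbabilityMeasure W}
    (h : ∀ a ∈ B, ∀ b ∈ B, HeatStep τ (dist a b) (κ a : Measure W) (κ b : Measure W))
    {f : W → ℝ} (hf : LipschitzWith 1 f) (hf' : ∀ x, f x ∈ Set.Icc (0 : ℝ) 1) :
    ∃ F : Z → ℝ, LipschitzWith heatConst F ∧ (∀ z, F z ∈ Set.Icc (0 : ℝ) 1) ∧
      ∀ z ∈ B, F z = ∫ x, f x ∂(κ z : Measure W) := by
  have hL : LipschitzOnWith heatConst (fun z => ∫ x, f x ∂(κ z : Measure W)) B := by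
    refine LipschitzOnWith.of_dist_le_mul fun a ha b hb => ?_
    exact (h a ha b hb).blClose (by rw [dist_comm]; exact h b hb a ha) dist_nonneg f hf hf'
  obtain ⟨F, hF, hFB⟩ := hL.extend_real
  -- Clamping an extension keeps its Lipschitz constant and changes nothing on `B`.
  refine ⟨fun z => max 0 (min 1 (F z)), (hF.const_min 1).const_max 0,
    fun z => ⟨le_max_left _ _, max_le zero_le_one (min_le_left _ _)⟩, fun z hz => ?_⟩
  have := integral_mem_Icc (α := (κ z : Measure W)) hf.continuous.aestronglyMeasurable hf'
  simp only [← hFB hz]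
  rw [min_eq_right this.2, max_eq_right this.1]

/-- `μ` is the limit of the measures `κ n (z n)` for all `z n ∈ B n` that converge to `x`. -/
def IsKernelLimit (B : ℕ → Set Z) (κ : ℕ → Z → ProbabilityMeasure W) (x : Z)
    (μ : ProbabilityMeasure W) : Prop :=
  ∀ z : ℕ → Z, (∀ᶠ n in atTop, z n ∈ B n) → Tendsto z atTop (𝓝 x) → ∀ ε > 0, ∀ᶠ n in atTop,
    BLClose ε (κ n (z n) : Measure W) (μ : Measure W)

theorem IsKernelLimit.tendsto {B : ℕ → Set Z} {κ : ℕ → Z → ProbabilityMeasure W} {x : Z}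
    {μ : ProbabilityMeasure W} (h : IsKernelLimit B κ x μ) {z : ℕ → Z}
    (hz : ∀ᶠ n in atTop, z n ∈ B n) (hzx : Tendsto z atTop (𝓝 x)) :
    Tendsto (fun n => κ n (z n)) atTop (𝓝 μ) :=
  tendsto_of_forall_blClose (h z hz hzx)

/-- The kernels are known to be Cauchy only along sequences `y` that stay near `x`. The gradient
estimate, uniform in `n`, transfers this to `z` up to an arbitrarily small error, and then
identifies the limits along all sequences converging to `x`. -/
theorem exists_isKernelLimit [SecondCountableTopology W] [CompleteSpace W] {τ : ℝ≥0}
    {B : ℕ → Set Z} {κ : ℕ → Z → ProbabilityMeasure W} (h : ∀ᶠ n in atTop,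
      ∀ a ∈ B n, ∀ b ∈ B n, HeatStep τ (dist a b) (κ n a : Measure W) (κ n b : Measure W))
    {x : Z} {z : ℕ → Z} (hz : ∀ᶠ n in atTop, z n ∈ B n) (hzx : Tendsto z atTop (𝓝 x))
    (hy : ∀ ε > 0, ∃ y : ℕ → Z, (∀ᶠ n in atTop, y n ∈ B n) ∧ (∀ᶠ n in atTop, dist (y n) x < ε) ∧
      ∀ ε > 0, ∃ N, ∀ n ≥ N, BLClose ε (κ N (y N) : Measure W) (κ n (y n) : Measure W)) :
    ∃ μ, IsKernelLimit B κ x μ := by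
  have hK := heatConst_pos
  have hbl : ∀ᶠ n in atTop, ∀ a ∈ B n, ∀ b ∈ B n, ∀ ε : ℝ, heatConst * dist a b ≤ ε →
      BLClose ε (κ n a : Measure W) (κ n b : Measure W) := by
    filter_upwards [h] with n hn a ha b hb ε hε
    exact ((hn a ha b hb).blClose (by rw [dist_comm]; exact hn b hb a ha) dist_nonneg).mono hε
  have hc : ∀ ε > 0, ∃ N, ∀ n ≥ N, BLClose ε (κ N (z N) : Measure W) (κ n (z n) : Measure W) := by
    intro ε hε
    set r : ℝ := ε / (12 * heatConst) with hr
    have hK' : (0 : ℝ) < heatConst := hK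
    have hr0 : 0 < r := by positivity
    obtain ⟨y, hy1, hy2, hy3⟩ := hy r hr0
    obtain ⟨N, hN⟩ := hy3 (ε / 6) (by positivity)
    have hev : ∀ᶠ n in atTop, BLClose (ε / 6) (κ n (y n) : Measure W) (κ n (z n) : Measure W) := by
      filter_upwards [hy1, hy2, hz, Metric.tendsto_nhds.1 hzx r hr0, hbl] with n h1 h2 h3 h4 h5
      refine h5 _ h1 _ h3 _ ?_
      have : dist (y n) (z n) ≤ 2 * r := (dist_triangle_right _ _ x).trans (by linarith)
      calc heatConst * dist (y n) (z n) ≤ heatConst * (2 * r) := by gcongr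
        _ = ε / 6 := by rw [hr]; field_simp; norm_num
    obtain ⟨M, hM⟩ := eventually_atTop.1 hev
    refine ⟨max N M, fun n hn => ?_⟩
    have a1 := hM _ (le_max_right N M)
    have a2 := hM n ((le_max_right N M).trans hn)
    have a3 := hN _ (le_max_left N M)
    have a4 := hN n ((le_max_left N M).trans hn)
    exact ((a1.symm.trans a3.symm).trans (a4.trans a2)).mono (by linarith)
  obtain ⟨μ, -, hμ⟩ := exists_tendsto_of_blClose hc
  refine ⟨μ, fun z' hz' hzx' ε hε => ?_⟩
  have hd : Tendsto (fun n => (heatConst : ℝ) * dist (z' n) (z n)) atTop (𝓝 0) := by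
    have := (hzx'.dist hzx).const_mul (heatConst : ℝ)
    simpa using this
  filter_upwards [hμ (ε / 2) (by positivity), hz, hz', hbl,
    hd.eventually_lt_const (show (0 : ℝ) < ε / 2 by positivity)] with n h1 h2 h3 h4 h5
  exact ((h4 _ h3 _ h2 _ h5.le).trans h1).mono (by linarith)

/-- A continuous family of probability measures as a kernel. -/
def continuousKernel {A : Type*} [MeasurableSpace A] [TopologicalSpace A]
    [OpensMeasurableSpace A] {κ : A → ProbabilityMeasure X} (hκ : Continuous κ) : Kernel A X :=
  ⟨fun a => κ a, measurable_of_continuous_probabilityMeasure hκ⟩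

instance isMarkovKernel_continuousKernel {A : Type*} [MeasurableSpace A] [TopologicalSpace A]
    [OpensMeasurableSpace A] {κ : A → ProbabilityMeasure X} (hκ : Continuous κ) :
    IsMarkovKernel (continuousKernel hκ) :=
  ⟨fun a => inferInstanceAs (IsProbabilityMeasure (κ a : Measure X))⟩

theorem integral_bind_continuousKernel {A : Type*} [MeasurableSpace A] [TopologicalSpace A]
    [OpensMeasurableSpace A] {κ : A → ProbabilityMeasure X} (hκ : Continuous κ) (m : Measure A)
    [IsProbabilityMeasure m] {f : X → ℝ} (hf : Continuous f)
    (hf' : ∀ x, f x ∈ Set.Icc (0 : ℝ) 1) :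
    ∫ x, f x ∂(m.bind (continuousKernel hκ)) = ∫ a, ∫ x, f x ∂(κ a : Measure X) ∂m := by
  have h := Kernel.integral_comp (κ := Kernel.const Unit m) (η := continuousKernel hκ) (a := ())
    (f := f)
  rw [← Measure.comp_eq_comp_const_apply] at h
  exact h (Integrable.of_mem_Icc 0 1 hf.aemeasurable (ae_of_all _ hf'))

/-- Disintegration identities may be tested on Lipschitz functions. -/
theorem apply_eq_lintegral_of_forall_lipschitz {A : Type*} [MeasurableSpace A] [TopologicalSpace A]
    [OpensMeasurableSpace A] {κ : A → ProbabilityMeasure X} (hκ : Continuous κ) {m : Measure A}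
    [IsProbabilityMeasure m] {ν : Measure X} [IsProbabilityMeasure ν]
    (h : ∀ f : X → ℝ, LipschitzWith 1 f → (∀ x, f x ∈ Set.Icc (0 : ℝ) 1) →
      ∫ x, f x ∂ν = ∫ a, ∫ x, f x ∂(κ a : Measure X) ∂m) {S : Set X} (hS : MeasurableSet S) :
    ν S = ∫⁻ a, (κ a : Measure X) S ∂m := by
  have hb : ν = m.bind (continuousKernel hκ) :=
    ext_of_forall_lipschitzWith_one fun f hf hf' => by
      rw [h f hf hf', integral_bind_continuousKernel hκ m hf.continuous hf']
  rw [hb, Measure.bind_apply hS (continuousKernel hκ).measurable.aemeasurable]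
  rfl

theorem integral_eq_of_forall_apply {A : Type*} [MeasurableSpace A] [TopologicalSpace A]
    [OpensMeasurableSpace A] {κ : A → ProbabilityMeasure X} (hκ : Continuous κ) {m : Measure A}
    [IsProbabilityMeasure m] {ν : Measure X}
    (h : ∀ S, MeasurableSet S → ν S = ∫⁻ a, (κ a : Measure X) S ∂m) {f : X → ℝ} (hf : Continuous f)
    (hf' : ∀ x, f x ∈ Set.Icc (0 : ℝ) 1) :
    ∫ x, f x ∂ν = ∫ a, ∫ x, f x ∂(κ a : Measure X) ∂m := by
  rw [← integral_bind_continuousKernel hκ m hf hf']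
  congr 1
  ext S hS
  rw [h S hS, Measure.bind_apply hS (continuousKernel hκ).measurable.aemeasurable]
  rfl

end Kernel

/-! ### The Wasserstein distance on a Polish space -/

section Wasserstein

variable {Z : Type*} [MetricSpace Z] [MeasurableSpace Z] [BorelSpace Z] [CompleteSpace Z]
  [SecondCountableTopology Z]

theorem W1_triangle (μ ν ρ : Measure Z) [IsProbabilityMeasure ν] :
    W1 μ ρ ≤ W1 μ ν + W1 ν ρ :=
  otCost_triangle (c₁ := fun x y : Z => edist x y) (c₂ := fun x y : Z => edist x y)
    (c := fun x y : Z => edist x y) (by unfold Function.uncurry; fun_prop)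
    (by unfold Function.uncurry; fun_prop) edist_triangle μ ν ρ

theorem edist_le_W1_dirac {Z : Type*} [MetricSpace Z] [MeasurableSpace Z] [BorelSpace Z] (x y : Z) : edist x y ≤ W1 (Measure.dirac x) (Measure.dirac y) :=
  otCost_dirac (fun x y : Z => edist x y) x y

theorem W1_le_sum (μ : ℕ → Measure Z) [∀ n, IsProbabilityMeasure (μ n)] (n k : ℕ) :
    W1 (μ n) (μ (n + (k + 1))) ≤ ∑ i ∈ Finset.range (k + 1), W1 (μ (n + i)) (μ (n + i + 1)) := by
  induction k with
  | zero => simp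
  | succ k ih =>
    rw [Finset.sum_range_succ]
    exact (W1_triangle _ (μ (n + (k + 1))) _).trans (add_le_add ih le_rfl)

/-- The triangle inequality for finite stretches, followed by weak lower semicontinuity of the
Wasserstein distance. -/
theorem W1_le_tsum_of_tendsto {μ : ℕ → ProbabilityMeasure Z} {μ' : ProbabilityMeasure Z}
    (h : Tendsto μ atTop (𝓝 μ')) (n : ℕ) :
    W1 (μ n : Measure Z) (μ' : Measure Z) ≤
      ∑' i, W1 (μ (n + i) : Measure Z) (μ (n + i + 1) : Measure Z) := by
  have hlsc := lowerSemicontinuous_otCost (X := Z) (Y := Z) (c := fun x y : Z => edist x y)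
    (by unfold Function.uncurry; fun_prop) (μ n, μ')
  refine le_of_forall_lt fun a ha => ?_
  have ht : Tendsto (fun k => (μ n, μ (n + (k + 1)))) atTop (𝓝 (μ n, μ')) :=
    tendsto_const_nhds.prodMk_nhds
      (h.comp (tendsto_atTop_mono (fun k => (by omega : k ≤ n + (k + 1))) tendsto_id))
  obtain ⟨k, hk⟩ := (ht.eventually (hlsc a ha)).exists
  exact hk.trans_le ((W1_le_sum (fun n => (μ n : Measure Z)) n k).trans (ENNReal.sum_le_tsum _))

end Wasserstein

/-- The majorants `D` supply the measurability needed to exchange sum and integral; it is not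
assumed of `w`, which will be Wasserstein distances of arbitrarily extended kernels. -/
theorem lintegral_tsum_le_of_ae_le {Ω : Type*} [MeasurableSpace Ω] {P : Measure Ω}
    {w : ℕ → Ω → ℝ≥0∞} {a : ℕ → ℝ≥0∞}
    (h : ∀ n, ∃ D : Ω → ℝ≥0∞, Measurable D ∧ (∀ᵐ y ∂P, w n y ≤ D y) ∧ ∫⁻ y, D y ∂P ≤ a n) :
    ∫⁻ y, ∑' n, w n y ∂P ≤ ∑' n, a n ∧ (∑' n, a n ≠ ∞ → ∀ᵐ y ∂P, ∑' n, w n y ≠ ∞) := by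
  choose D hD hwD hDa using h
  have hle : ∀ᵐ y ∂P, ∑' n, w n y ≤ ∑' n, D n y := by
    filter_upwards [ae_all_iff.2 hwD] with y hy
    exact ENNReal.tsum_le_tsum hy
  have hint : ∫⁻ y, ∑' n, D n y ∂P ≤ ∑' n, a n := by
    rw [lintegral_tsum fun n => (hD n).aemeasurable]
    exact ENNReal.tsum_le_tsum hDa
  refine ⟨(lintegral_mono_ae hle).trans hint, fun ha => ?_⟩
  filter_upwards [hle, ae_lt_top (Measurable.tsum hD) (hint.trans_lt ha.lt_top).ne]
    with y h1 h2
  exact (h1.trans_lt h2).ne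

theorem tsum_geometric_add_ofReal (n : ℕ) :
    ∑' k : ℕ, ENNReal.ofReal ((1 / 2) ^ (n + k)) = ENNReal.ofReal (2 * (1 / 2) ^ n) := by
  have : ∀ k : ℕ, (0 : ℝ) ≤ (1 / 2) ^ (n + k) := fun k => by positivity
  rw [← ENNReal.ofReal_tsum_of_nonneg this]
  · congr 1
    simp only [pow_add]
    rw [tsum_mul_left, tsum_geometric_two, mul_comm]
  · simp only [pow_add]
    exact summable_geometric_two.mul_left _

/-! ### Sequences of metric flows in common ambient spaces and their limits -/

/-- A sequence of metric flow pairs whose time-slices are embedded in common spaces `Z t` as the sets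
`B t n` for `n ≥ N t`. The couplings between successive members are realized by random sequences
with laws `ℙ t`. -/
structure AmbientSequence (A : Set ℝ) where
  Z : A → Type u
  [metric : ∀ t, MetricSpace (Z t)]
  [meas : ∀ t, MeasurableSpace (Z t)]
  [borel : ∀ t, BorelSpace (Z t)]
  [complete : ∀ t, CompleteSpace (Z t)]
  [secondCountable : ∀ t, SecondCountableTopology (Z t)]
  N : A → ℕ
  B : ∀ t, ℕ → Set (Z t)
  κ : ∀ {s t : A}, s ≤ t → ℕ → Z t → ProbabilityMeasure (Z s)
  law : ∀ t, Measure (ℕ → Z t)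
  prob : ∀ t, IsProbabilityMeasure (law t)
  ae_mem : ∀ t n, N t ≤ n → ∀ᵐ y ∂(law t), y n ∈ B t n
  κ_self : ∀ t n, N t ≤ n → ∀ z ∈ B t n,
    (κ (le_refl t) n z : Measure (Z t)) = Measure.dirac z
  heatStep : ∀ {s t : A} (h : s ≤ t) n, N s ≤ n → N t ≤ n → ∀ a ∈ B t n, ∀ b ∈ B t n,
    HeatStep (Real.toNNReal ((t : ℝ) - (s : ℝ))) (dist a b) (κ h n a : Measure (Z s))
      (κ h n b : Measure (Z s))
  ae_κ_mem : ∀ {s t : A} (h : s ≤ t) n, N s ≤ n → N t ≤ n → ∀ a ∈ B t n,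
    ∀ᵐ z ∂(κ h n a : Measure (Z s)), z ∈ B s n
  reproduction : ∀ {t₁ t₂ t₃ : A} (h₁₂ : t₁ ≤ t₂) (h₂₃ : t₂ ≤ t₃) n, N t₁ ≤ n → N t₂ ≤ n →
    N t₃ ≤ n → ∀ a ∈ B t₃ n, ∀ f : Z t₁ → ℝ, LipschitzWith 1 f → (∀ x, f x ∈ Set.Icc (0 : ℝ) 1) →
    ∫ x, f x ∂(κ (h₁₂.trans h₂₃) n a : Measure (Z t₁)) =
      ∫ y, ∫ x, f x ∂(κ h₁₂ n y : Measure (Z t₁)) ∂(κ h₂₃ n a : Measure (Z t₂))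
  conj : ∀ {s t : A} (h : s ≤ t) n, N s ≤ n → N t ≤ n → ∀ f : Z s → ℝ, LipschitzWith 1 f →
    (∀ x, f x ∈ Set.Icc (0 : ℝ) 1) →
    ∫ y, f (y n) ∂(law s) = ∫ y, ∫ x, f x ∂(κ h n (y n) : Measure (Z s)) ∂(law t)
  step : ∀ {s t : A} (h : s ≤ t) n, N s ≤ n → N t ≤ n → ∃ D : (ℕ → Z t) → ℝ≥0∞, Measurable D ∧
    (∀ᵐ y ∂(law t),
      W1 (κ h n (y n) : Measure (Z s)) (κ h (n + 1) (y (n + 1)) : Measure (Z s)) ≤ D y) ∧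
    ∫⁻ y, D y ∂(law t) ≤ ENNReal.ofReal ((1 / 2) ^ n)

attribute [instance] AmbientSequence.metric AmbientSequence.meas AmbientSequence.borel
  AmbientSequence.complete AmbientSequence.secondCountable AmbientSequence.prob

namespace AmbientSequence

variable {A : Set ℝ} (S : AmbientSequence.{u} A)

theorem eventually_of_le {s t : A} {p : ℕ → Prop} (h : ∀ n, S.N s ≤ n → S.N t ≤ n → p n) :
    ∀ᶠ n in atTop, p n := by
  filter_upwards [eventually_ge_atTop (S.N s), eventually_ge_atTop (S.N t)] with n h₁ h₂
  exact h n h₁ h₂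

theorem lintegral_tsum_W1_le {s t : A} (h : s ≤ t) {n : ℕ} (hs : S.N s ≤ n) (ht : S.N t ≤ n) :
    ∫⁻ y, ∑' i, W1 (S.κ h (n + i) (y (n + i)) : Measure (S.Z s))
        (S.κ h (n + i + 1) (y (n + i + 1)) : Measure (S.Z s)) ∂(S.law t) ≤
      ENNReal.ofReal (2 * (1 / 2) ^ n) ∧
    ∀ᵐ y ∂(S.law t), ∑' i, W1 (S.κ h (n + i) (y (n + i)) : Measure (S.Z s))
        (S.κ h (n + i + 1) (y (n + i + 1)) : Measure (S.Z s)) ≠ ∞ := by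
  have := lintegral_tsum_le_of_ae_le (P := S.law t)
    (a := fun i => ENNReal.ofReal ((1 / 2) ^ (n + i)))
    fun i => S.step h (n + i) (hs.trans (Nat.le_add_right n i)) (ht.trans (Nat.le_add_right n i))
  rw [tsum_geometric_add_ofReal] at this
  exact ⟨this.1, this.2 ENNReal.ofReal_ne_top⟩

theorem ae_eventually_mem (t : A) : ∀ᵐ y ∂(S.law t), ∀ n, S.N t ≤ n → y n ∈ S.B t n :=
  ae_all_iff.2 fun n => by
    by_cases h : S.N t ≤ n
    · exact (S.ae_mem t n h).mono fun y hy _ => hy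
    · exact ae_of_all _ fun y hn => absurd hn h

/-- For `s = t` the kernels are Dirac, so `lintegral_tsum_W1_le` says that almost every path has
finite total length. -/
theorem ae_exists_tendsto (t : A) : ∀ᵐ y ∂(S.law t), ∃ x, Tendsto y atTop (𝓝 x) := by
  filter_upwards [(S.lintegral_tsum_W1_le (le_refl t) (le_refl _) (le_refl _)).2,
    S.ae_eventually_mem t] with y hy hmem
  have hle : ∀ i, edist (y (i + S.N t)) (y (i + 1 + S.N t)) ≤
      W1 (S.κ (le_refl t) (S.N t + i) (y (S.N t + i)) : Measure (S.Z t))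
        (S.κ (le_refl t) (S.N t + i + 1) (y (S.N t + i + 1)) : Measure (S.Z t)) := by
    intro i
    rw [S.κ_self t _ (by omega) _ (hmem _ (by omega)), S.κ_self t _ (by omega) _ (hmem _ (by omega)),
      add_comm i, show i + 1 + S.N t = S.N t + i + 1 by omega]
    exact edist_le_W1_dirac _ _
  have hc := cauchySeq_of_edist_le_of_tsum_ne_top (f := fun i => y (i + S.N t)) _ hle hy
  obtain ⟨x, hx⟩ := cauchySeq_tendsto_of_complete hc
  exact ⟨x, (tendsto_add_atTop_iff_nat (S.N t)).1 hx⟩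

theorem exists_limit (t : A) : ∃ f : (ℕ → S.Z t) → S.Z t, Measurable f ∧
    ∀ᵐ y ∂(S.law t), Tendsto y atTop (𝓝 (f y)) := by
  obtain ⟨f, hf, hf'⟩ := measurable_limit_of_tendsto_metrizable_ae (μ := S.law t) (L := atTop)
    (f := fun n (y : ℕ → S.Z t) => y n) (fun n => (measurable_pi_apply n).aemeasurable)
    (S.ae_exists_tendsto t)
  exact ⟨f, hf, hf'⟩

/-- The almost sure limit of the random sequence. -/
noncomputable def limit (t : A) : (ℕ → S.Z t) → S.Z t := (S.exists_limit t).choose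

theorem measurable_limit (t : A) : Measurable (S.limit t) := (S.exists_limit t).choose_spec.1

theorem ae_tendsto_limit (t : A) : ∀ᵐ y ∂(S.law t), Tendsto y atTop (𝓝 (S.limit t y)) :=
  (S.exists_limit t).choose_spec.2

/-- The law of the limit. -/
noncomputable def m (t : A) : Measure (S.Z t) := (S.law t).map (S.limit t)

instance isProbabilityMeasure_m (t : A) : IsProbabilityMeasure (S.m t) :=
  Measure.isProbabilityMeasure_map (S.measurable_limit t).aemeasurable

theorem ae_limit_mem_support (t : A) : ∀ᵐ y ∂(S.law t), S.limit t y ∈ (S.m t).support :=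
  ae_of_ae_map (S.measurable_limit t).aemeasurable Measure.support_mem_ae

/-- The limit falls into each ball around a point of the support with positive probability, so some
path doing so also has any prescribed almost sure property. -/
theorem exists_near {t : A} {x : S.Z t} (hx : x ∈ (S.m t).support) {ε : ℝ} (hε : 0 < ε)
    {p : (ℕ → S.Z t) → Prop} (hp : ∀ᵐ y ∂(S.law t), p y) :
    ∃ y : ℕ → S.Z t, (∀ᶠ n in atTop, y n ∈ S.B t n) ∧ (∀ᶠ n in atTop, dist (y n) x < ε) ∧ p y := by
  have hpos := (Measure.mem_support_iff_forall _).1 hx _ (Metric.ball_mem_nhds x hε)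
  rw [m, Measure.map_apply (S.measurable_limit t) measurableSet_ball] at hpos
  obtain ⟨y, hy, h1, h2, h3⟩ := ((frequently_ae_mem_iff.2 hpos.ne').and_eventually
    ((S.ae_eventually_mem t).and ((S.ae_tendsto_limit t).and hp))).exists
  exact ⟨y, (eventually_ge_atTop _).mono h1, h2.eventually (Metric.isOpen_ball.mem_nhds hy), h3⟩

/-- The paths of `exists_near` depend on `ε`, but they show that the distance from `x` to `B t n`
tends to 0; near-minimizers then converge to `x`. -/
theorem exists_approx {t : A} {x : S.Z t} (hx : x ∈ (S.m t).support) :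
    ∃ z : ℕ → S.Z t, (∀ᶠ n in atTop, z n ∈ S.B t n) ∧ Tendsto z atTop (𝓝 x) := by
  have h : ∀ n, ∃ z, S.N t ≤ n → z ∈ S.B t n ∧
      dist x z < Metric.infDist x (S.B t n) + 1 / ((n : ℝ) + 1) := by
    intro n
    by_cases hn : S.N t ≤ n
    · obtain ⟨y, hy⟩ := (S.ae_mem t n hn).exists
      obtain ⟨z, hz, hz'⟩ := (Metric.infDist_lt_iff ⟨_, hy⟩).1
        (lt_add_of_pos_right (Metric.infDist x (S.B t n)) (Nat.one_div_pos_of_nat (n := n)))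
      exact ⟨z, fun _ => ⟨hz, hz'⟩⟩
    · exact ⟨x, fun h => absurd h hn⟩
  choose z hz using h
  refine ⟨z, (eventually_ge_atTop _).mono fun n hn => (hz n hn).1, ?_⟩
  rw [Metric.tendsto_nhds]
  intro ε hε
  obtain ⟨y, hy1, hy2, -⟩ := S.exists_near hx (half_pos hε) (ae_of_all _ fun _ => trivial)
  filter_upwards [hy1, hy2, eventually_ge_atTop (S.N t),
    tendsto_one_div_add_atTop_nhds_zero_nat.eventually_lt_const (half_pos hε)] with n h1 h2 h3 h4
  have h5 : Metric.infDist x (S.B t n) ≤ dist x (y n) := Metric.infDist_le_dist_of_mem h1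
  rw [dist_comm x] at h5
  rw [dist_comm]
  linarith [(hz n h3).2]

theorem eventually_heatStep {s t : A} (h : s ≤ t) : ∀ᶠ n in atTop, ∀ a ∈ S.B t n, ∀ b ∈ S.B t n,
    HeatStep (Real.toNNReal ((t : ℝ) - (s : ℝ))) (dist a b) (S.κ h n a : Measure (S.Z s))
      (S.κ h n b : Measure (S.Z s)) :=
  S.eventually_of_le fun n hs ht => S.heatStep h n hs ht

/-- The auxiliary sequences are sample paths ending near `x` for which the Wasserstein distances of
successive kernels are summable. -/
theorem exists_isKernelLimit {s t : A} (h : s ≤ t) {x : S.Z t} (hx : x ∈ (S.m t).support) :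
    ∃ μ, IsKernelLimit (S.B t) (S.κ h) x μ := by
  obtain ⟨z, hz, hzx⟩ := S.exists_approx hx
  refine _root_.exists_isKernelLimit (S.eventually_heatStep h) hz hzx fun ε hε => ?_
  set M := max (S.N s) (S.N t) with hM
  obtain ⟨y, h1, h2, h3⟩ := S.exists_near hx hε
    (S.lintegral_tsum_W1_le h (le_max_left _ _ : S.N s ≤ M) (le_max_right _ _)).2
  refine ⟨y, h1, h2, fun δ hδ => ?_⟩
  have hδ' : 0 < ENNReal.ofReal δ := by simpa using hδ
  obtain ⟨k, hk⟩ := ((ENNReal.tendsto_sum_nat_add _ h3).eventually_lt_const hδ').exists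
  refine ⟨M + k, fun n hn => ?_⟩
  obtain ⟨j, rfl⟩ := Nat.exists_eq_add_of_le hn
  cases j with
  | zero => exact fun f _ _ => by simpa using hδ.le
  | succ j =>
    refine blClose_of_W1_le ?_ hδ.le
    refine (W1_le_sum (fun n => (S.κ h n (y n) : Measure (S.Z s))) (M + k) j).trans
      ((ENNReal.sum_le_tsum _).trans (le_trans (le_of_eq ?_) hk.le))
    refine tsum_congr fun i => ?_
    rw [show M + k + i = M + (i + k) by omega]

/-- The limit of the conjugate heat kernels. -/
noncomputable def lim {s t : A} (h : s ≤ t) (x : S.Z t) : ProbabilityMeasure (S.Z s) :=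
  @Classical.epsilon _ ⟨S.κ h 0 x⟩ (IsKernelLimit (S.B t) (S.κ h) x)

theorem isKernelLimit_lim {s t : A} (h : s ≤ t) {x : S.Z t} (hx : x ∈ (S.m t).support) :
    IsKernelLimit (S.B t) (S.κ h) x (S.lim h x) :=
  Classical.epsilon_spec (S.exists_isKernelLimit h hx)

theorem ae_tendsto_lim {s t : A} (h : s ≤ t) : ∀ᵐ y ∂(S.law t),
    Tendsto (fun n => S.κ h n (y n)) atTop (𝓝 (S.lim h (S.limit t y))) := by
  filter_upwards [S.ae_eventually_mem t, S.ae_tendsto_limit t, S.ae_limit_mem_support t]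
    with y h1 h2 h3
  exact (S.isKernelLimit_lim h h3).tendsto ((eventually_ge_atTop _).mono h1) h2

theorem heatStep_lim {s t : A} (h : s ≤ t) {a b : S.Z t} (ha : a ∈ (S.m t).support)
    (hb : b ∈ (S.m t).support) :
    HeatStep (Real.toNNReal ((t : ℝ) - (s : ℝ))) (dist a b) (S.lim h a : Measure (S.Z s))
      (S.lim h b : Measure (S.Z s)) := by
  obtain ⟨z, hz, hza⟩ := S.exists_approx ha
  obtain ⟨w, hw, hwb⟩ := S.exists_approx hb
  refine HeatStep.of_tendsto (hza.dist hwb) ((S.isKernelLimit_lim h ha).tendsto hz hza)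
    ((S.isKernelLimit_lim h hb).tendsto hw hwb) ?_
  filter_upwards [S.eventually_heatStep h, hz, hw] with n h1 h2 h3
  exact h1 _ h2 _ h3

theorem lim_self {t : A} {x : S.Z t} (hx : x ∈ (S.m t).support) :
    (S.lim (le_refl t) x : Measure (S.Z t)) = Measure.dirac x := by
  obtain ⟨z, hz, hzx⟩ := S.exists_approx hx
  refine ext_of_forall_lipschitzWith_one fun f hf hf' => ?_
  have h1 := tendsto_integral_of_bounded ((S.isKernelLimit_lim (le_refl t) hx).tendsto hz hzx)
    hf.continuous hf'
  rw [integral_dirac]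
  refine tendsto_nhds_unique (h1.congr' ?_) ((hf.continuous.tendsto x).comp hzx)
  filter_upwards [hz, eventually_ge_atTop (S.N t)] with n h2 h3
  rw [S.κ_self t n h3 _ h2, integral_dirac]
  rfl

/-- The integrals of a Lipschitz function against the kernels converge. -/
theorem exists_lipschitz_tendsto {s t : A} (h : s ≤ t) {f : S.Z s → ℝ} (hf : LipschitzWith 1 f)
    (hf' : ∀ x, f x ∈ Set.Icc (0 : ℝ) 1) :
    ∃ (F : ℕ → S.Z t → ℝ) (G : S.Z t → ℝ), (∀ n, LipschitzWith heatConst (F n)) ∧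
      LipschitzWith heatConst G ∧ (∀ n z, F n z ∈ Set.Icc (0 : ℝ) 1) ∧
      (∀ z, G z ∈ Set.Icc (0 : ℝ) 1) ∧
      (∀ n, S.N s ≤ n → S.N t ≤ n → ∀ z ∈ S.B t n,
        F n z = ∫ x, f x ∂(S.κ h n z : Measure (S.Z s))) ∧
      (∀ z ∈ (S.m t).support, G z = ∫ x, f x ∂(S.lim h z : Measure (S.Z s))) ∧
      ∀ z ∈ (S.m t).support, Tendsto (fun n => F n z) atTop (𝓝 (G z)) := by
  -- The kernels are meaningful only on `B t n`, which need not contain the limit point;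
  -- equi-Lipschitz extensions can be evaluated there.
  have hF : ∀ n, ∃ F : S.Z t → ℝ, LipschitzWith heatConst F ∧ (∀ z, F z ∈ Set.Icc (0 : ℝ) 1) ∧
      (S.N s ≤ n → S.N t ≤ n → ∀ z ∈ S.B t n, F z = ∫ x, f x ∂(S.κ h n z : Measure (S.Z s))) := by
    intro n
    by_cases hn : S.N s ≤ n ∧ S.N t ≤ n
    · obtain ⟨F, h1, h2, h3⟩ := exists_lipschitz_integral (S.heatStep h n hn.1 hn.2) hf hf'
      exact ⟨F, h1, h2, fun _ _ => h3⟩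
    · exact ⟨fun _ => 0, LipschitzWith.const' 0, fun z => by simp,
        fun h1 h2 => absurd ⟨h1, h2⟩ hn⟩
  choose F hF1 hF2 hF3 using hF
  obtain ⟨G, hG1, hG2, hG3⟩ := exists_lipschitz_integral (B := (S.m t).support)
    (fun a ha b hb => S.heatStep_lim h ha hb) hf hf'
  refine ⟨F, G, hF1, hG1, hF2, hG2, hF3, hG3, fun x hx => ?_⟩
  obtain ⟨z, hz, hzx⟩ := S.exists_approx hx
  have h1 := tendsto_integral_of_bounded ((S.isKernelLimit_lim h hx).tendsto hz hzx)
    hf.continuous hf'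
  rw [hG3 x hx]
  have h2 : Tendsto (fun n => (heatConst : ℝ) * dist x (z n)) atTop (𝓝 0) := by
    simpa using ((tendsto_const_nhds (x := x)).dist hzx).const_mul (heatConst : ℝ)
  refine tendsto_of_tendsto_of_dist (h1.congr' ?_) (squeeze_zero (fun n => dist_nonneg)
    (fun n => ?_) h2) (f₁ := fun n => F n (z n))
  · filter_upwards [hz, S.eventually_of_le (s := s) (t := t) hF3] with n h2 h3
    exact (h3 _ h2).symm
  · rw [dist_comm x]
    exact (hF1 n).dist_le_mul _ _

/-- Dominated convergence along the random sequences on both sides of `conj`; the common Lipschitz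
constant absorbs the moving argument `y n`. -/
theorem conj_lim {s t : A} (h : s ≤ t) {f : S.Z s → ℝ} (hf : LipschitzWith 1 f)
    (hf' : ∀ x, f x ∈ Set.Icc (0 : ℝ) 1) :
    ∫ x, f x ∂(S.m s) = ∫ z, ∫ x, f x ∂(S.lim h z : Measure (S.Z s)) ∂(S.m t) := by
  obtain ⟨F, G, hF, hG, hF', hG', hFκ, hGl, hlim⟩ := S.exists_lipschitz_tendsto h hf hf'
  have e1 : ∫ z, ∫ x, f x ∂(S.lim h z : Measure (S.Z s)) ∂(S.m t) = ∫ z, G z ∂(S.m t) :=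
    integral_congr_ae (by
      filter_upwards [Measure.support_mem_ae (μ := S.m t)] with z hz
      exact (hGl z hz).symm)
  rw [e1, m, m, integral_map (S.measurable_limit s).aemeasurable hf.continuous.aestronglyMeasurable,
    integral_map (S.measurable_limit t).aemeasurable hG.continuous.aestronglyMeasurable]
  have h1 : Tendsto (fun n => ∫ y, f (y n) ∂(S.law s)) atTop
      (𝓝 (∫ y, f (S.limit s y) ∂(S.law s))) := by
    refine tendsto_integral_of_dominated_convergence (fun _ => 1)
      (fun n => (hf.continuous.measurable.comp (measurable_pi_apply n)).aestronglyMeasurable)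
      (integrable_const _) (fun n => ae_of_all _ fun y => ?_) ?_
    · rw [Real.norm_eq_abs, abs_of_nonneg (hf' _).1]
      exact (hf' _).2
    · filter_upwards [S.ae_tendsto_limit s] with y hy
      exact (hf.continuous.tendsto _).comp hy
  have h2 : Tendsto (fun n => ∫ y, F n (y n) ∂(S.law t)) atTop
      (𝓝 (∫ y, G (S.limit t y) ∂(S.law t))) := by
    refine tendsto_integral_of_dominated_convergence (fun _ => 1)
      (fun n => ((hF n).continuous.measurable.comp (measurable_pi_apply n)).aestronglyMeasurable)
      (integrable_const _) (fun n => ae_of_all _ fun y => ?_) ?_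
    · rw [Real.norm_eq_abs, abs_of_nonneg (hF' _ _).1]
      exact (hF' _ _).2
    · filter_upwards [S.ae_tendsto_limit t, S.ae_limit_mem_support t] with y h3 h4
      have h5 : Tendsto (fun n => (heatConst : ℝ) * dist (y n) (S.limit t y)) atTop (𝓝 0) := by
        simpa using (h3.dist (tendsto_const_nhds (x := S.limit t y))).const_mul (heatConst : ℝ)
      refine tendsto_of_tendsto_of_dist (hlim _ h4) (squeeze_zero (fun n => dist_nonneg)
        (fun n => ?_) h5)
      rw [dist_comm (y n)]
      exact (hF n).dist_le_mul _ _
  refine tendsto_nhds_unique h1 (h2.congr' ?_)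
  refine S.eventually_of_le (s := s) (t := t) fun n hs ht => ?_
  refine Eq.trans (integral_congr_ae ?_) (S.conj h n hs ht f hf hf').symm
  filter_upwards [S.ae_mem t n ht] with y hy
  exact hFκ n hs ht _ hy

/-- Testing `conj_lim` with the truncated distance to the support shows that the limit kernels leave
the support with probability 0 for almost every base point. The continuous function `G` makes this
hold at every point of the support. -/
theorem ae_lim_mem_support {s t : A} (h : s ≤ t) {x : S.Z t} (hx : x ∈ (S.m t).support) :
    ∀ᵐ z ∂(S.lim h x : Measure (S.Z s)), z ∈ (S.m s).support := by
  set X := (S.m s).support with hX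
  have hXc : IsClosed X := Measure.isClosed_support
  have hXne : X.Nonempty := Measure.nonempty_support (IsProbabilityMeasure.ne_zero _)
  let f : S.Z s → ℝ := fun z => min 1 (Metric.infDist z X)
  have hf : LipschitzWith 1 f := (Metric.lipschitz_infDist_pt X).const_min 1
  have hf' : ∀ z, f z ∈ Set.Icc (0 : ℝ) 1 := fun z =>
    ⟨le_min zero_le_one Metric.infDist_nonneg, min_le_left _ _⟩
  have hf0 : ∀ z, f z = 0 ↔ z ∈ X := fun z => by
    rw [hXc.mem_iff_infDist_zero hXne]
    refine ⟨fun h => ?_, fun h => by simp [f, h]⟩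
    rcases min_cases 1 (Metric.infDist z X) with ⟨h1, -⟩ | ⟨h1, -⟩
    · simp only [f] at h; linarith
    · simp only [f] at h; linarith
  have hzero : ∀ μ : Measure (S.Z s), IsProbabilityMeasure μ →
      (∫ z, f z ∂μ = 0 ↔ ∀ᵐ z ∂μ, z ∈ X) := fun μ _ => by
    rw [integral_eq_zero_iff_of_nonneg (fun z => (hf' z).1)
      (Integrable.of_mem_Icc 0 1 hf.continuous.aemeasurable (ae_of_all _ hf'))]
    exact eventually_congr (Eventually.of_forall fun z => hf0 z)
  rw [← hzero _ inferInstance]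
  obtain ⟨F, G, hF, hG, hF', hG', hFκ, hGl, hlim⟩ := S.exists_lipschitz_tendsto h hf hf'
  have e0 := S.conj_lim h hf hf'
  rw [(hzero _ inferInstance).2 Measure.support_mem_ae] at e0
  have e1 : ∫ z, ∫ x, f x ∂(S.lim h z : Measure (S.Z s)) ∂(S.m t) = ∫ z, G z ∂(S.m t) :=
    integral_congr_ae (by
      filter_upwards [Measure.support_mem_ae (μ := S.m t)] with z hz
      exact (hGl z hz).symm)
  rw [e1] at e0
  have e2 := (integral_eq_zero_iff_of_nonneg (fun z => (hG' z).1)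
    (Integrable.of_mem_Icc 0 1 hG.continuous.aemeasurable (ae_of_all _ hG'))).1 e0.symm
  have e3 : (S.m t).support ⊆ {z | G z = 0} :=
    Measure.support_subset_of_isClosed (isClosed_eq hG.continuous continuous_const) e2
  rw [← hGl x hx]
  exact e3 hx

/-- Both integrand and measure vary with `n`. Pointwise convergence of `F n` settles the fixed limit
measure, and the uniform Lipschitz bound makes the change of measure negligible for all `F n` alike.
-/
theorem reproduction_lim {t₁ t₂ t₃ : A} (h₁₂ : t₁ ≤ t₂) (h₂₃ : t₂ ≤ t₃) {x : S.Z t₃}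
    (hx : x ∈ (S.m t₃).support) {f : S.Z t₁ → ℝ} (hf : LipschitzWith 1 f)
    (hf' : ∀ x, f x ∈ Set.Icc (0 : ℝ) 1) :
    ∫ z, f z ∂(S.lim (h₁₂.trans h₂₃) x : Measure (S.Z t₁)) =
      ∫ y, ∫ z, f z ∂(S.lim h₁₂ y : Measure (S.Z t₁)) ∂(S.lim h₂₃ x : Measure (S.Z t₂)) := by
  obtain ⟨F, G, hF, hG, hF', hG', hFκ, hGl, hlim⟩ := S.exists_lipschitz_tendsto h₁₂ hf hf'
  obtain ⟨z, hz, hzx⟩ := S.exists_approx hx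
  have e1 : ∫ y, ∫ z, f z ∂(S.lim h₁₂ y : Measure (S.Z t₁)) ∂(S.lim h₂₃ x : Measure (S.Z t₂)) =
      ∫ y, G y ∂(S.lim h₂₃ x : Measure (S.Z t₂)) :=
    integral_congr_ae (by
      filter_upwards [S.ae_lim_mem_support h₂₃ hx] with y hy
      exact (hGl y hy).symm)
  rw [e1]
  have h1 := tendsto_integral_of_bounded ((S.isKernelLimit_lim (h₁₂.trans h₂₃) hx).tendsto hz hzx)
    hf.continuous hf'
  have h2 : Tendsto (fun n => ∫ y, F n y ∂(S.lim h₂₃ x : Measure (S.Z t₂))) atTop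
      (𝓝 (∫ y, G y ∂(S.lim h₂₃ x : Measure (S.Z t₂)))) := by
    refine tendsto_integral_of_dominated_convergence (fun _ => 1)
      (fun n => (hF n).continuous.aestronglyMeasurable)
      (integrable_const _) (fun n => ae_of_all _ fun y => ?_) ?_
    · rw [Real.norm_eq_abs, abs_of_nonneg (hF' _ _).1]
      exact (hF' _ _).2
    · filter_upwards [S.ae_lim_mem_support h₂₃ hx] with y hy
      exact hlim y hy
  have h3 : Tendsto (fun n => ∫ y, F n y ∂(S.κ h₂₃ n (z n) : Measure (S.Z t₂))) atTop
      (𝓝 (∫ y, G y ∂(S.lim h₂₃ x : Measure (S.Z t₂)))) := by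
    refine tendsto_of_tendsto_of_dist h2 ?_
    rw [Metric.tendsto_nhds]
    intro ε hε
    have hK : (0 : ℝ) < heatConst + 1 := by positivity
    filter_upwards [S.isKernelLimit_lim h₂₃ hx z hz hzx (ε / (2 * (heatConst + 1)))
      (by positivity)] with n hn
    have h4 := hn.symm.abs_integral_sub_le (hF n) (hF' n)
    rw [Real.dist_eq, sub_zero, abs_of_nonneg dist_nonneg, Real.dist_eq]
    refine h4.trans_lt ?_
    rw [mul_div_assoc', div_lt_iff₀ (by positivity)]
    nlinarith
  refine tendsto_nhds_unique h1 (h3.congr' ?_)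
  filter_upwards [hz, eventually_ge_atTop (S.N t₁), eventually_ge_atTop (S.N t₂),
    eventually_ge_atTop (S.N t₃)] with n hzn hn₁ hn₂ hn₃
  rw [S.reproduction h₁₂ h₂₃ n hn₁ hn₂ hn₃ _ hzn f hf hf']
  refine integral_congr_ae ?_
  filter_upwards [S.ae_κ_mem h₂₃ n hn₂ hn₃ _ hzn] with y hy
  exact hFκ n hn₁ hn₂ _ hy

theorem lintegral_W1_lim_le {s t : A} (h : s ≤ t) {n : ℕ} (hs : S.N s ≤ n) (ht : S.N t ≤ n) :
    ∫⁻ y, W1 (S.κ h n (y n) : Measure (S.Z s)) (S.lim h (S.limit t y) : Measure (S.Z s))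
      ∂(S.law t) ≤ ENNReal.ofReal (2 * (1 / 2) ^ n) := by
  refine (lintegral_mono_ae ?_).trans (S.lintegral_tsum_W1_le h hs ht).1
  filter_upwards [S.ae_tendsto_lim h] with y hy
  exact W1_le_tsum_of_tendsto hy n

end AmbientSequence

/-! ### The limit of an ambient sequence as a metric flow pair -/

theorem map_val_comap_val {Z : Type*} [MeasurableSpace Z] {X : Set Z} (hX : MeasurableSet X)
    {μ : Measure Z} (h : ∀ᵐ z ∂μ, z ∈ X) :
    (μ.comap ((↑) : X → Z)).map ((↑) : X → Z) = μ := by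
  rw [(MeasurableEmbedding.subtype_coe hX).map_comap, Subtype.range_coe,
    Measure.restrict_eq_self_of_ae_mem h]

theorem eq_of_map_val_eq {Z : Type*} [MeasurableSpace Z] {X : Set Z} (hX : MeasurableSet X)
    {μ ν : Measure X} (h : μ.map ((↑) : X → Z) = ν.map ((↑) : X → Z)) : μ = ν := by
  rw [← (MeasurableEmbedding.subtype_coe hX).comap_map μ, h,
    (MeasurableEmbedding.subtype_coe hX).comap_map]

theorem isProbabilityMeasure_comap_val {Z : Type*} [MeasurableSpace Z] {X : Set Z}
    (hX : MeasurableSet X) {μ : Measure Z} [IsProbabilityMeasure μ] (h : ∀ᵐ z ∂μ, z ∈ X) :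
    IsProbabilityMeasure (μ.comap ((↑) : X → Z)) := by
  constructor
  have := measure_univ (μ := μ)
  rw [← map_val_comap_val hX h, Measure.map_apply measurable_subtype_coe MeasurableSet.univ] at this
  simpa using this

theorem Isometry.exists_lipschitz_extension_Icc {X Y : Type*} [PseudoMetricSpace Y] [MetricSpace X]
    {g : X → Y} (hg : Isometry g) {K : ℝ≥0} {f : X → ℝ}
    (hf : LipschitzWith K f) (hf' : ∀ x, f x ∈ Set.Icc (0 : ℝ) 1) :
    ∃ h : Y → ℝ, LipschitzWith K h ∧ (∀ y, h y ∈ Set.Icc (0 : ℝ) 1) ∧ ∀ x, h (g x) = f x := by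
  obtain ⟨F, hF, hFf⟩ := hg.exists_lipschitz_extension hf
  refine ⟨fun z => max 0 (min 1 (F z)), (hF.const_min 1).const_max 0,
    fun z => ⟨le_max_left _ _, max_le zero_le_one (min_le_left _ _)⟩, fun z => ?_⟩
  simp only [hFf]
  rw [min_eq_right (hf' z).2, max_eq_right (hf' z).1]

theorem support_comap_val_eq_univ {Z : Type*} [MetricSpace Z] [MeasurableSpace Z] [BorelSpace Z]
    [SecondCountableTopology Z] (μ : Measure Z) :
    (μ.comap ((↑) : μ.support → Z)).support = Set.univ := by
  refine Set.eq_univ_of_forall fun x => (Measure.mem_support_iff_forall _).2 fun U hU => ?_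
  obtain ⟨V, hV, hVU⟩ := mem_nhds_subtype _ _ _ |>.1 hU
  obtain ⟨V', hV'V, hV'o, hxV'⟩ := mem_nhds_iff.1 hV
  have hpos := (Measure.mem_support_iff_forall _).1 x.2 V' (hV'o.mem_nhds hxV')
  have hm : MeasurableSet μ.support := Measure.isClosed_support.measurableSet
  rw [← map_val_comap_val hm Measure.support_mem_ae,
    Measure.map_apply measurable_subtype_coe hV'o.measurableSet] at hpos
  exact hpos.trans_le (measure_mono fun y hy => hVU (hV'V hy))

namespace AmbientSequence

variable {A : Set ℝ} (S : AmbientSequence.{u} A)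

theorem measurableSet_support (t : A) : MeasurableSet (S.m t).support :=
  Measure.isClosed_support.measurableSet

/-- The limit of the conjugate heat kernels, as a family of measures on the limit slices. -/
noncomputable def kernel {s t : A} (h : s ≤ t) (x : (S.m t).support) :
    ProbabilityMeasure (S.m s).support :=
  ⟨(S.lim h x : Measure (S.Z s)).comap (↑), isProbabilityMeasure_comap_val
    (S.measurableSet_support s) (S.ae_lim_mem_support h x.2)⟩

theorem map_kernel {s t : A} (h : s ≤ t) (x : (S.m t).support) :
    (S.kernel h x : Measure (S.m s).support).map (↑) = (S.lim h x : Measure (S.Z s)) :=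
  map_val_comap_val (S.measurableSet_support s) (S.ae_lim_mem_support h x.2)

theorem heatStep_kernel {s t : A} (h : s ≤ t) (x y : (S.m t).support) :
    HeatStep (Real.toNNReal ((t : ℝ) - (s : ℝ))) (dist x y)
      (S.kernel h x : Measure (S.m s).support) (S.kernel h y : Measure (S.m s).support) := by
  refine HeatStep.of_map isometry_subtype_coe ?_
  rw [S.map_kernel, S.map_kernel]
  exact S.heatStep_lim h x.2 y.2

theorem continuous_kernel {s t : A} (h : s ≤ t) : Continuous (S.kernel h) :=
  continuous_of_heatStep (S.heatStep_kernel h)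

theorem integral_kernel {s t : A} (h : s ≤ t) (x : (S.m t).support) {f : S.Z s → ℝ}
    (hf : Continuous f) :
    ∫ z, f z ∂(S.kernel h x : Measure (S.m s).support) =
      ∫ z, f z ∂(S.lim h x : Measure (S.Z s)) := by
  rw [← S.map_kernel h x,
    integral_map measurable_subtype_coe.aemeasurable hf.aestronglyMeasurable]

/-- The limit metric flow. -/
noncomputable def flow : MetricFlow.{u} A where
  slice t := (S.m t).support
  complete t := (Measure.isClosed_support (μ := S.m t)).completeSpace_coe
  separable t := inferInstance
  ν h x := S.kernel h x
  prob h x := inferInstance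
  ν_self t x := by
    refine eq_of_map_val_eq (S.measurableSet_support t) ?_
    exact (S.map_kernel (le_refl t) x).trans
      ((S.lim_self x.2).trans (Measure.map_dirac' measurable_subtype_coe x).symm)
  gradient := by
    intro s t h T v hv hv' hT
    have hτ : 0 < Real.toNNReal ((t : ℝ) - (s : ℝ)) :=
      Real.toNNReal_pos.2 (sub_pos.2 h)
    refine (phi_dichotomy_iff (u := fun x => ∫ y, v y ∂(S.kernel h.le x : Measure _)) fun x =>
      -- The estimate is now a two-point condition; `T = 0` is the case of functions that are merely
      -- measurable.
      integral_mem_Icc hv.aestronglyMeasurable hv').2 fun x y => ?_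
    rcases eq_or_lt_of_le (zero_le (a := T)) with rfl | hT'
    · rw [add_zero]
      exact (S.heatStep_kernel h.le x y).phiStep_of_measurable hτ dist_nonneg hv hv'
    · obtain ⟨f, hf, hfv⟩ := hT hT'
      simp only [hfv]
      exact S.heatStep_kernel h.le x y T hT' f hf
  reproduction := by
    intro t₁ t₂ t₃ h₁₂ h₂₃ x U hU
    refine apply_eq_lintegral_of_forall_lipschitz (S.continuous_kernel h₁₂) (fun f hf hf' => ?_) hU
    obtain ⟨F, hF, hF', hFf⟩ := isometry_subtype_coe.exists_lipschitz_extension_Icc hf hf'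
    -- Off the support `lim` is an arbitrary choice; `G` replaces the inner integral by a continuous
    -- function on the whole space.
    obtain ⟨-, G, -, hG, -, -, -, hGl, -⟩ := S.exists_lipschitz_tendsto h₁₂ hF hF'
    have e := S.reproduction_lim h₁₂ h₂₃ x.2 hF hF'
    have e1 : ∫ y, ∫ z, F z ∂(S.lim h₁₂ y : Measure (S.Z t₁)) ∂(S.lim h₂₃ x : Measure (S.Z t₂)) =
        ∫ y, G y ∂(S.lim h₂₃ x : Measure (S.Z t₂)) :=
      integral_congr_ae (by
        filter_upwards [S.ae_lim_mem_support h₂₃ x.2] with y hy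
        exact (hGl y hy).symm)
    rw [e1, ← S.integral_kernel _ x hF.continuous, ← S.integral_kernel _ x hG.continuous] at e
    simp only [hFf] at e
    rw [e]
    refine integral_congr_ae (ae_of_all _ fun y => ?_)
    simp only
    rw [hGl y y.2, ← S.integral_kernel _ y hF.continuous]
    simp only [hFf]

/-- The limit conjugate heat flow. -/
noncomputable def limitMeasure (t : A) : Measure (S.m t).support := (S.m t).comap (↑)

theorem map_limitMeasure (t : A) : (S.limitMeasure t).map (↑) = S.m t :=
  map_val_comap_val (S.measurableSet_support t) Measure.support_mem_ae

instance isProbabilityMeasure_limitMeasure (t : A) : IsProbabilityMeasure (S.limitMeasure t) :=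
  isProbabilityMeasure_comap_val (S.measurableSet_support t) Measure.support_mem_ae

theorem integral_limitMeasure (t : A) {f : S.Z t → ℝ} (hf : Continuous f) :
    ∫ z, f z ∂(S.limitMeasure t) = ∫ z, f z ∂(S.m t) := by
  have := integral_map (μ := S.limitMeasure t) (f := f)
    measurable_subtype_coe.aemeasurable hf.aestronglyMeasurable
  rw [S.map_limitMeasure t] at this
  exact this.symm

/-- The limit metric flow pair. -/
noncomputable def pair {I : Set ℝ} (hA : A ⊆ I) (hI : volume (I \ A) = 0) :
    MetricFlowPair.{u} I where
  dom := A
  dom_subset := hA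
  null := hI
  flow := S.flow
  μ := S.limitMeasure
  conj := by
    refine ⟨S.isProbabilityMeasure_limitMeasure, fun s t h U hU => ?_⟩
    refine apply_eq_lintegral_of_forall_lipschitz (S.continuous_kernel h) (fun f hf hf' => ?_) hU
    obtain ⟨F, hF, hF', hFf⟩ := isometry_subtype_coe.exists_lipschitz_extension_Icc hf hf'
    obtain ⟨-, G, -, hG, -, -, -, hGl, -⟩ := S.exists_lipschitz_tendsto h hF hF'
    have e := S.conj_lim h hF hF'
    have e1 : ∫ y, ∫ z, F z ∂(S.lim h y : Measure (S.Z s)) ∂(S.m t) = ∫ y, G y ∂(S.m t) :=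
      integral_congr_ae (by
        filter_upwards [Measure.support_mem_ae (μ := S.m t)] with y hy
        exact (hGl y hy).symm)
    rw [e1, ← S.integral_limitMeasure s hF.continuous, ← S.integral_limitMeasure t hG.continuous]
      at e
    simp only [hFf] at e
    rw [e]
    refine integral_congr_ae (ae_of_all _ fun y => ?_)
    simp only
    rw [hGl y y.2, ← S.integral_kernel _ y hF.continuous]
    simp only [hFf]
  full_support t := support_comap_val_eq_univ (S.m t)

end AmbientSequence

/-! ### Embedding a sequence of metric flow pairs into common spaces -/

theorem exists_chain_from {Z : Type*} [MeasurableSpace Z] [StandardBorelSpace Z] [Nonempty Z]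
    (N : ℕ) {m : ∀ n, N ≤ n → Measure Z} (hm : ∀ n h, IsProbabilityMeasure (m n h))
    {q : ∀ n, N ≤ n → Measure (Z × Z)}
    (hq : ∀ n h, IsCoupling (q n h) (m n h) (m (n + 1) (h.trans n.le_succ))) :
    ∃ P : Measure (ℕ → Z), IsProbabilityMeasure P ∧
      ∀ n h, P.map (fun y => (y n, y (n + 1))) = q n h := by
  obtain ⟨P, hP, h⟩ := exists_chain (m := fun k => m (N + k) (Nat.le_add_right N k))
    (q := fun k => q (N + k) (Nat.le_add_right N k)) fun k => hq (N + k) (Nat.le_add_right N k)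
  -- The chain is shifted to start at `N`; by truncated subtraction the coordinates below `N` just
  -- repeat the first term.
  have hs : Measurable fun (y : ℕ → Z) n => y (n - N) :=
    measurable_pi_lambda _ fun n => measurable_pi_apply _
  refine ⟨P.map fun y n => y (n - N), Measure.isProbabilityMeasure_map hs.aemeasurable,
    fun n hn => ?_⟩
  obtain ⟨k, rfl⟩ := Nat.exists_eq_add_of_le hn
  rw [Measure.map_map ((measurable_pi_apply _).prodMk (measurable_pi_apply _)) hs, ← h k]
  congr 1
  funext y
  simp only [Function.comp_apply, Nat.add_sub_cancel_left, add_assoc]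

/-- Isometric embeddings of the time-slices of a sequence of metric flow pairs into common spaces,
such that successive members are close to each other. -/
structure EmbeddedSequence {I : Set ℝ} (P : ℕ → MetricFlowPair.{u} I) (A : Set ℝ) where
  N : A → ℕ
  mem : ∀ (t : A) n, N t ≤ n → (t : ℝ) ∈ (P n).dom
  Z : A → Type u
  [metric : ∀ t, MetricSpace (Z t)]
  [meas : ∀ t, MeasurableSpace (Z t)]
  [borel : ∀ t, BorelSpace (Z t)]
  [complete : ∀ t, CompleteSpace (Z t)]
  [secondCountable : ∀ t, SecondCountableTopology (Z t)]
  ι : ∀ (t : A) n (h : N t ≤ n), (P n).flow.slice ⟨t, mem t n h⟩ → Z t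
  isom : ∀ t n h, Isometry (ι t n h)
  q : ∀ (t : A) n (h : N t ≤ n), Measure ((P n).flow.slice ⟨t, mem t n h⟩ ×
    (P (n + 1)).flow.slice ⟨t, mem t (n + 1) (h.trans n.le_succ)⟩)
  coupling : ∀ (t : A) n (h : N t ≤ n), IsCoupling (q t n h) ((P n).μ ⟨t, mem t n h⟩)
    ((P (n + 1)).μ ⟨t, mem t (n + 1) (h.trans n.le_succ)⟩)
  step : ∀ (s t : A) (h : s ≤ t) n (hs : N s ≤ n) (ht : N t ≤ n),
    ∫⁻ p, otCost (fun x y => edist (ι s n hs x) (ι s (n + 1) (hs.trans n.le_succ) y))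
      ((P n).flow.ν (s := ⟨s, mem s n hs⟩) (t := ⟨t, mem t n ht⟩) h p.1)
      ((P (n + 1)).flow.ν (s := ⟨s, mem s (n + 1) (hs.trans n.le_succ)⟩)
        (t := ⟨t, mem t (n + 1) (ht.trans n.le_succ)⟩) h p.2) ∂(q t n ht) ≤
      ENNReal.ofReal ((1 / 2) ^ n)

attribute [instance] EmbeddedSequence.metric EmbeddedSequence.meas EmbeddedSequence.borel
  EmbeddedSequence.complete EmbeddedSequence.secondCountable

namespace EmbeddedSequence

variable {I : Set ℝ} {P : ℕ → MetricFlowPair.{u} I} {A : Set ℝ} (E : EmbeddedSequence P A)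

theorem nonempty_Z (t : A) : Nonempty (E.Z t) :=
  (P (E.N t)).nonempty_slice ⟨t, E.mem t _ le_rfl⟩ |>.map (E.ι t _ le_rfl)

theorem measurable_ι (t : A) (n : ℕ) (h : E.N t ≤ n) : Measurable (E.ι t n h) :=
  (E.isom t n h).continuous.measurable

theorem exists_law (t : A) : ∃ L : Measure (ℕ → E.Z t), IsProbabilityMeasure L ∧
    ∀ n h, L.map (fun y => (y n, y (n + 1))) =
      (E.q t n h).map (Prod.map (E.ι t n h) (E.ι t (n + 1) (h.trans n.le_succ))) :=
  have := E.nonempty_Z t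
  exists_chain_from (E.N t) (m := fun n h => ((P n).μ ⟨t, E.mem t n h⟩).map (E.ι t n h))
    (fun n h => Measure.isProbabilityMeasure_map (E.measurable_ι t n h).aemeasurable)
    fun n h => (E.coupling t n h).map (E.measurable_ι t n h) (E.measurable_ι t (n + 1) _)

/-- The law of a random sequence that realizes the couplings. -/
noncomputable def law (t : A) : Measure (ℕ → E.Z t) := (E.exists_law t).choose

instance isProbabilityMeasure_law (t : A) : IsProbabilityMeasure (E.law t) :=
  (E.exists_law t).choose_spec.1

theorem map_law (t : A) (n : ℕ) (h : E.N t ≤ n) : (E.law t).map (fun y => (y n, y (n + 1))) =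
    (E.q t n h).map (Prod.map (E.ι t n h) (E.ι t (n + 1) (h.trans n.le_succ))) :=
  (E.exists_law t).choose_spec.2 n h

theorem map_law_apply (t : A) (n : ℕ) (h : E.N t ≤ n) : (E.law t).map (fun y => y n) =
    ((P n).μ ⟨t, E.mem t n h⟩).map (E.ι t n h) := by
  have h1 := ((E.coupling t n h).map (E.measurable_ι t n h)
    (E.measurable_ι t (n + 1) (h.trans n.le_succ))).1
  rw [← E.map_law t n h, Measure.map_map measurable_fst (by fun_prop)] at h1
  exact h1

/-- Injectivity of the embedding makes the transported kernel well defined on the image; elsewhere,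
and for small `n`, it is an arbitrary Dirac measure. -/
theorem exists_κ {s t : A} (h : s ≤ t) (n : ℕ) : ∃ k : E.Z t → ProbabilityMeasure (E.Z s),
    ∀ (hs : E.N s ≤ n) (ht : E.N t ≤ n) (x : (P n).flow.slice ⟨t, E.mem t n ht⟩),
      (k (E.ι t n ht x) : Measure (E.Z s)) =
        ((P n).flow.ν (s := ⟨s, E.mem s n hs⟩) (t := ⟨t, E.mem t n ht⟩) h x).map (E.ι s n hs) := by
  obtain ⟨z₀⟩ := E.nonempty_Z s
  let k₀ : E.Z t → ProbabilityMeasure (E.Z s) := fun _ => ⟨Measure.dirac z₀, inferInstance⟩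
  by_cases hn : E.N s ≤ n ∧ E.N t ≤ n
  · refine ⟨Function.extend (E.ι t n hn.2) (fun x => ((P n).flow.kernel (s := ⟨s, E.mem s n hn.1⟩)
      (t := ⟨t, E.mem t n hn.2⟩) h x).map (E.measurable_ι s n hn.1).aemeasurable) k₀,
      fun hs ht x => ?_⟩
    rw [(E.isom t n ht).injective.extend_apply]
    rfl
  · exact ⟨k₀, fun hs ht => absurd ⟨hs, ht⟩ hn⟩

/-- The conjugate heat kernels, transported to the common spaces. -/
noncomputable def κ {s t : A} (h : s ≤ t) (n : ℕ) : E.Z t → ProbabilityMeasure (E.Z s) :=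
  (E.exists_κ h n).choose

theorem κ_ι {s t : A} (h : s ≤ t) (n : ℕ) (hs : E.N s ≤ n) (ht : E.N t ≤ n)
    (x : (P n).flow.slice ⟨t, E.mem t n ht⟩) :
    (E.κ h n (E.ι t n ht x) : Measure (E.Z s)) =
      ((P n).flow.ν (s := ⟨s, E.mem s n hs⟩) (t := ⟨t, E.mem t n ht⟩) h x).map (E.ι s n hs) :=
  (E.exists_κ h n).choose_spec hs ht x

theorem integral_κ_ι {s t : A} (h : s ≤ t) (n : ℕ) (hs : E.N s ≤ n) (ht : E.N t ≤ n)
    (x : (P n).flow.slice ⟨t, E.mem t n ht⟩) (f : E.Z s → ℝ) :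
    ∫ z, f z ∂(E.κ h n (E.ι t n ht x) : Measure (E.Z s)) =
      ∫ y, f (E.ι s n hs y) ∂((P n).flow.ν (s := ⟨s, E.mem s n hs⟩) (t := ⟨t, E.mem t n ht⟩) h x) := by
  rw [E.κ_ι h n hs ht x]
  exact (E.isom s n hs).measurableEmbedding.integral_map f

theorem heatStep_κ {s t : A} (h : s ≤ t) (n : ℕ) (hs : E.N s ≤ n) (ht : E.N t ≤ n)
    (x y : (P n).flow.slice ⟨t, E.mem t n ht⟩) :
    HeatStep (Real.toNNReal ((t : ℝ) - (s : ℝ))) (dist (E.ι t n ht x) (E.ι t n ht y))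
      (E.κ h n (E.ι t n ht x) : Measure (E.Z s)) (E.κ h n (E.ι t n ht y) : Measure (E.Z s)) := by
  rw [E.κ_ι h n hs ht x, E.κ_ι h n hs ht y, (E.isom t n ht).dist_eq]
  exact ((P n).flow.heatStep (s := ⟨s, E.mem s n hs⟩) (t := ⟨t, E.mem t n ht⟩) h x y).map
    (E.isom s n hs)

/-- The image of the time-slice of the `n`-th metric flow. -/
def B (t : A) (n : ℕ) : Set (E.Z t) := {z | ∃ h x, E.ι t n h x = z}

theorem ae_mem_B (t : A) (n : ℕ) (h : E.N t ≤ n) : ∀ᵐ y ∂(E.law t), y n ∈ E.B t n := by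
  have : ∀ᵐ z ∂((E.law t).map fun y => y n), z ∈ E.B t n := by
    rw [E.map_law_apply t n h, (E.isom t n h).measurableEmbedding.ae_map_iff]
    exact ae_of_all _ fun x => ⟨h, x, rfl⟩
  exact ae_of_ae_map (measurable_pi_apply n).aemeasurable this

theorem integral_law {t : A} {n : ℕ} (h : E.N t ≤ n) {f : E.Z t → ℝ} (hf : Continuous f) :
    ∫ y, f (y n) ∂(E.law t) = ∫ x, f (E.ι t n h x) ∂((P n).μ ⟨t, E.mem t n h⟩) := by
  have h1 := integral_map (μ := E.law t) (measurable_pi_apply n).aemeasurable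
    (f := f) hf.aestronglyMeasurable
  rw [E.map_law_apply t n h, (E.isom t n h).measurableEmbedding.integral_map] at h1
  exact h1.symm

theorem conj_κ {s t : A} (h : s ≤ t) (n : ℕ) (hs : E.N s ≤ n) (ht : E.N t ≤ n) {f : E.Z s → ℝ}
    (hf : LipschitzWith 1 f) (hf' : ∀ x, f x ∈ Set.Icc (0 : ℝ) 1) :
    ∫ y, f (y n) ∂(E.law s) = ∫ y, ∫ x, f x ∂(E.κ h n (y n) : Measure (E.Z s)) ∂(E.law t) := by
  obtain ⟨F, hF, hF', hFκ⟩ := exists_lipschitz_integral (κ := E.κ h n) (B := E.B t n)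
    (by
      rintro _ ⟨_, x, rfl⟩ _ ⟨_, y, rfl⟩
      exact E.heatStep_κ h n hs ht x y) hf hf'
  have e1 : ∫ y, ∫ x, f x ∂(E.κ h n (y n) : Measure (E.Z s)) ∂(E.law t) =
      ∫ y, F (y n) ∂(E.law t) := integral_congr_ae (by
    filter_upwards [E.ae_mem_B t n ht] with y hy
    exact (hFκ _ hy).symm)
  rw [e1, E.integral_law hs hf.continuous, E.integral_law ht hF.continuous,
    integral_eq_of_forall_apply ((P n).flow.continuous_kernel (s := ⟨s, E.mem s n hs⟩)
      (t := ⟨t, E.mem t n ht⟩) h) ((P n).conj.2 _ _ h) (f := fun x => f (E.ι s n hs x))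
      (hf.continuous.comp (E.isom s n hs).continuous) fun x => hf' _]
  refine integral_congr_ae (ae_of_all _ fun x => ?_)
  simp only
  rw [hFκ _ ⟨ht, x, rfl⟩, E.integral_κ_ι h n hs ht x]
  rfl

theorem reproduction_κ {t₁ t₂ t₃ : A} (h₁₂ : t₁ ≤ t₂) (h₂₃ : t₂ ≤ t₃) (n : ℕ) (hn₁ : E.N t₁ ≤ n)
    (hn₂ : E.N t₂ ≤ n) (hn₃ : E.N t₃ ≤ n) (x : (P n).flow.slice ⟨t₃, E.mem t₃ n hn₃⟩)
    {f : E.Z t₁ → ℝ} (hf : LipschitzWith 1 f) (hf' : ∀ x, f x ∈ Set.Icc (0 : ℝ) 1) :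
    ∫ z, f z ∂(E.κ (h₁₂.trans h₂₃) n (E.ι t₃ n hn₃ x) : Measure (E.Z t₁)) =
      ∫ y, ∫ z, f z ∂(E.κ h₁₂ n y : Measure (E.Z t₁))
        ∂(E.κ h₂₃ n (E.ι t₃ n hn₃ x) : Measure (E.Z t₂)) := by
  rw [E.integral_κ_ι _ n hn₁ hn₃, E.integral_κ_ι _ n hn₂ hn₃,
    integral_eq_of_forall_apply ((P n).flow.continuous_kernel (s := ⟨t₁, E.mem t₁ n hn₁⟩)
      (t := ⟨t₂, E.mem t₂ n hn₂⟩) h₁₂)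
      ((P n).flow.reproduction (t₁ := ⟨t₁, E.mem t₁ n hn₁⟩) (t₂ := ⟨t₂, E.mem t₂ n hn₂⟩)
        (t₃ := ⟨t₃, E.mem t₃ n hn₃⟩) h₁₂ h₂₃ x) (f := fun x => f (E.ι t₁ n hn₁ x))
      (hf.continuous.comp (E.isom t₁ n hn₁).continuous) fun x => hf' _]
  refine integral_congr_ae (ae_of_all _ fun y => ?_)
  simp only
  rw [E.integral_κ_ι _ n hn₁ hn₂]
  rfl

theorem W1_κ {s t : A} (h : s ≤ t) {n n' : ℕ} (hs : E.N s ≤ n) (ht : E.N t ≤ n) (hs' : E.N s ≤ n')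
    (ht' : E.N t ≤ n') (x : (P n).flow.slice ⟨t, E.mem t n ht⟩)
    (y : (P n').flow.slice ⟨t, E.mem t n' ht'⟩) :
    W1 (E.κ h n (E.ι t n ht x) : Measure (E.Z s)) (E.κ h n' (E.ι t n' ht' y) : Measure (E.Z s)) =
      otCost (fun x y => edist (E.ι s n hs x) (E.ι s n' hs' y))
        ((P n).flow.ν (s := ⟨s, E.mem s n hs⟩) (t := ⟨t, E.mem t n ht⟩) h x)
        ((P n').flow.ν (s := ⟨s, E.mem s n' hs'⟩) (t := ⟨t, E.mem t n' ht'⟩) h y) := by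
  rw [E.κ_ι h n hs ht, E.κ_ι h n' hs' ht', W1_map_eq_otCost (E.isom s n hs) (E.isom s n' hs')]

/-- On the slices the transport cost is measurable. `D` is a measurable extension of it, which
almost every path sees only on the images of the slices. -/
theorem exists_step_bound {s t : A} (h : s ≤ t) (n : ℕ) (hs : E.N s ≤ n) (ht : E.N t ≤ n) :
    ∃ D : (ℕ → E.Z t) → ℝ≥0∞, Measurable D ∧
      (∀ᵐ y ∂(E.law t), W1 (E.κ h n (y n) : Measure (E.Z s))
        (E.κ h (n + 1) (y (n + 1)) : Measure (E.Z s)) ≤ D y) ∧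
      ∫⁻ y, D y ∂(E.law t) ≤ ENNReal.ofReal ((1 / 2) ^ n) := by
  have hs' : E.N s ≤ n + 1 := hs.trans n.le_succ
  have ht' : E.N t ≤ n + 1 := ht.trans n.le_succ
  have hc : Continuous (Function.uncurry fun x y =>
      edist (E.ι s n hs x) (E.ι s (n + 1) hs' y)) :=
    ((E.isom s n hs).continuous.comp continuous_fst).edist
      ((E.isom s (n + 1) hs').continuous.comp continuous_snd)
  have hd := measurable_otCost hc ((P n).flow.continuous_kernel (s := ⟨s, E.mem s n hs⟩)
    (t := ⟨t, E.mem t n ht⟩) h) ((P (n + 1)).flow.continuous_kernel (s := ⟨s, E.mem s _ hs'⟩)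
    (t := ⟨t, E.mem t _ ht'⟩) h)
  have hemb := (E.isom t n ht).measurableEmbedding.prodMap
    (E.isom t (n + 1) ht').measurableEmbedding
  obtain ⟨D, hD, hDd⟩ := hemb.exists_measurable_extend hd fun _ => ⟨0⟩
  have hm : Measurable fun y : ℕ → E.Z t => (y n, y (n + 1)) := by fun_prop
  refine ⟨fun y => D (y n, y (n + 1)), hD.comp hm, ?_, ?_⟩
  · have : ∀ᵐ z ∂((E.law t).map fun y => (y n, y (n + 1))), W1 (E.κ h n z.1 : Measure (E.Z s))
        (E.κ h (n + 1) z.2 : Measure (E.Z s)) ≤ D z := by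
      rw [E.map_law t n ht, hemb.ae_map_iff]
      refine ae_of_all _ fun p => ?_
      refine (E.W1_κ h hs ht hs' ht' p.1 p.2).le.trans (le_of_eq ?_)
      exact (congrFun hDd p).symm
    exact ae_of_ae_map hm.aemeasurable this
  · rw [← lintegral_map hD hm, E.map_law t n ht, hemb.lintegral_map]
    refine (le_of_eq ?_).trans (E.step s t h n hs ht)
    exact lintegral_congr fun p => congrFun hDd p

/-- The associated sequence in the ambient spaces. -/
noncomputable abbrev ambient : AmbientSequence.{u} A where
  Z := E.Z
  N := E.N
  B := E.B
  κ := E.κ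
  law := E.law
  prob := E.isProbabilityMeasure_law
  ae_mem := E.ae_mem_B
  κ_self := by
    rintro t n hn _ ⟨h, x, rfl⟩
    have h1 := (P n).flow.ν_self ⟨t, E.mem t n hn⟩ x
    rw [E.κ_ι (le_refl t) n hn hn x]
    exact (congrArg (Measure.map (E.ι t n hn)) h1).trans
      (Measure.map_dirac' (E.measurable_ι t n hn) x)
  heatStep := by
    rintro s t h n hs ht _ ⟨_, x, rfl⟩ _ ⟨_, y, rfl⟩
    exact E.heatStep_κ h n hs ht x y
  ae_κ_mem := by
    rintro s t h n hs ht _ ⟨_, x, rfl⟩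
    rw [E.κ_ι h n hs ht x, (E.isom s n hs).measurableEmbedding.ae_map_iff]
    exact ae_of_all _ fun y => ⟨hs, y, rfl⟩
  reproduction := by
    rintro t₁ t₂ t₃ h₁₂ h₂₃ n hn₁ hn₂ hn₃ _ ⟨_, x, rfl⟩ f hf hf'
    exact E.reproduction_κ h₁₂ h₂₃ n hn₁ hn₂ hn₃ x hf hf'
  conj := fun h n hs ht f hf hf' => E.conj_κ h n hs ht hf hf'
  step := E.exists_step_bound

end EmbeddedSequence

/-! ### Completeness -/

/-- The tail is at most 2 · 4⁻ⁿ, so the bad sets from `n` on fit the measure bound for radius 2 ·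
2⁻ⁿ. -/
theorem tsum_half_pow_sq_le (n : ℕ) :
    ∑' k : ℕ, ENNReal.ofReal (((1 / 2) ^ (n + k)) ^ 2) ≤ ENNReal.ofReal ((2 * (1 / 2) ^ n) ^ 2) := by
  have hs : Summable fun k : ℕ => ((1 / 2 : ℝ) ^ (n + k)) ^ 2 := by
    simp only [pow_add, mul_pow]
    exact summable_half_pow_sq.mul_left _
  rw [← ENNReal.ofReal_tsum_of_nonneg (fun k => by positivity) hs]
  refine ENNReal.ofReal_le_ofReal ?_
  calc ∑' k : ℕ, ((1 / 2 : ℝ) ^ (n + k)) ^ 2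
      ≤ ∑' k : ℕ, ((1 / 2 : ℝ) ^ n) ^ 2 * (1 / 2) ^ k := by
        refine hs.tsum_le_tsum (fun k => ?_) (summable_geometric_two.mul_left _)
        rw [pow_add, mul_pow]
        gcongr
        rw [sq]
        exact mul_le_of_le_one_right (by positivity) (pow_le_one₀ (by norm_num) (by norm_num))
    _ = ((1 / 2 : ℝ) ^ n) ^ 2 * 2 := by rw [tsum_mul_left, tsum_geometric_two]
    _ ≤ (2 * (1 / 2) ^ n) ^ 2 := by rw [mul_pow]; nlinarith [sq_nonneg ((1 / 2 : ℝ) ^ n)]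

theorem exists_embeddedSequence {I J : Set ℝ} {P : ℕ → MetricFlowPair.{u} I}
    (h : ∀ n, FClose J (P n) (P (n + 1)) ((1 / 2) ^ n)) :
    ∃ (A : Set ℝ) (E : EmbeddedSequence P A), A ⊆ I ∧ volume (I \ A) = 0 ∧
      ∀ n, J ⊆ {t | ∃ ht : t ∈ A, E.N ⟨t, ht⟩ ≤ n} ∧
        NullMeasurableSet (I \ {t | ∃ ht : t ∈ A, E.N ⟨t, ht⟩ ≤ n}) volume ∧
        volume (I \ {t | ∃ ht : t ∈ A, E.N ⟨t, ht⟩ ≤ n}) ≤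
          ENNReal.ofReal ((2 * (1 / 2) ^ n) ^ 2) := by
  classical
  choose T h₁ h₂ c q hJ hm hv hc hq hr using h
  set A : Set ℝ := {t | ∃ N, ∀ n ≥ N, t ∈ T n} with hA
  have hAI : A ⊆ I := fun t ⟨N, hN⟩ => (P N).dom_subset (h₁ N (hN N le_rfl))
  -- Minimality makes `{t | N t ≤ n}` the intersection of the `T (n + k)`, whose complement is a
  -- countable union of null-measurable sets.
  let N : A → ℕ := fun t => Nat.find t.2
  have hN : ∀ (t : A) n, N t ≤ n → (t : ℝ) ∈ T n := fun t n hn => Nat.find_spec t.2 n hn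
  have hset : ∀ n, {t | ∃ ht : t ∈ A, N ⟨t, ht⟩ ≤ n} = {t | ∀ k, t ∈ T (n + k)} := by
    intro n
    ext t
    refine ⟨fun ⟨ht, hn⟩ k => hN ⟨t, ht⟩ _ (hn.trans (Nat.le_add_right n k)), fun ht => ?_⟩
    have hn : ∀ m ≥ n, t ∈ T m := fun m hm => by
      obtain ⟨k, rfl⟩ := Nat.exists_eq_add_of_le hm
      exact ht k
    exact ⟨⟨n, hn⟩, Nat.find_min' _ hn⟩
  have hcompl : ∀ n, I \ {t | ∀ k, t ∈ T (n + k)} = ⋃ k, I \ T (n + k) := fun n => by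
    ext t
    simp only [Set.mem_sdiff, Set.mem_ofPred_eq, not_forall, Set.mem_iUnion, exists_and_left]
  choose Z mZ cZ sZ ι hι hd using fun t : A =>
    exists_isometries_of_bridges_from (N t)
    (X := fun n hn => (P n).flow.slice ⟨t, h₁ n (hN t n hn)⟩)
    (c := fun n hn => c n t (hN t n hn)) fun n hn => hc n t (hN t n hn)
  let E : EmbeddedSequence P A :=
    { N := N
      mem := fun t n hn => h₁ n (hN t n hn)
      Z := Z
      meas := fun t => borel (Z t)
      borel := fun t => @BorelSpace.mk _ _ (borel (Z t)) rfl
      secondCountable := fun t => UniformSpace.secondCountable_of_separable _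
      ι := ι
      isom := hι
      q := fun t n hn => q n t (hN t n hn)
      coupling := fun t n hn => hq n t (hN t n hn)
      step := fun s t hst n hs ht => by
        refine le_trans (le_of_eq (lintegral_congr fun p => ?_))
          (hr n s t (hN s n hs) (hN t n ht) hst)
        congr 1
        funext x y
        rw [edist_dist, hd s n hs x y] }
  refine ⟨A, E, hAI, FClose.dom_null_of_summable hv summable_half_pow_sq, fun n => ?_⟩
  change J ⊆ {t | ∃ ht : t ∈ A, N ⟨t, ht⟩ ≤ n} ∧
    NullMeasurableSet (I \ {t | ∃ ht : t ∈ A, N ⟨t, ht⟩ ≤ n}) volume ∧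
    volume (I \ {t | ∃ ht : t ∈ A, N ⟨t, ht⟩ ≤ n}) ≤ _
  rw [hset n, hcompl n]
  refine ⟨fun t ht k => hJ _ ht, NullMeasurableSet.iUnion fun k => hm _, ?_⟩
  exact (measure_iUnion_le _).trans
    ((ENNReal.tsum_le_tsum fun k => hv _).trans (tsum_half_pow_sq_le n))

namespace EmbeddedSequence

variable {I : Set ℝ} {P : ℕ → MetricFlowPair.{u} I} {A : Set ℝ} (E : EmbeddedSequence P A)

/-- The joint law of the `n`-th term and the limit has marginals carried by the two embedded slices,
so it pulls back to them. -/
theorem exists_limit_coupling (t : A) (n : ℕ) (h : E.N t ≤ n) :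
    ∃ p : Measure ((P n).flow.slice ⟨t, E.mem t n h⟩ × (E.ambient.m t).support),
      IsCoupling p ((P n).μ ⟨t, E.mem t n h⟩) (E.ambient.limitMeasure t) ∧
      p.map (Prod.map (E.ι t n h) (↑)) =
        (E.law t).map fun y => (y n, E.ambient.limit t y) := by
  have hm : Measurable fun y : ℕ → E.Z t => (y n, E.ambient.limit t y) :=
    (measurable_pi_apply n).prodMk (E.ambient.measurable_limit t)
  refine IsCoupling.exists_map_eq (E.isom t n h).measurableEmbedding
    (MeasurableEmbedding.subtype_coe (E.ambient.measurableSet_support t)) ⟨?_, ?_⟩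
  · rw [Measure.map_map measurable_fst hm]
    exact E.map_law_apply t n h
  · rw [Measure.map_map measurable_snd hm]
    exact (E.ambient.map_limitMeasure t).symm

/-- The distance of the common space is the bridge, and `lintegral_W1_lim_le` is the cost bound once
everything is expressed through the random sequence. -/
theorem fClose_limit {J : Set ℝ} (hA : A ⊆ I) (hI : volume (I \ A) = 0) (n : ℕ)
    (hJ : J ⊆ {t | ∃ ht : t ∈ A, E.N ⟨t, ht⟩ ≤ n})
    (hm : NullMeasurableSet (I \ {t | ∃ ht : t ∈ A, E.N ⟨t, ht⟩ ≤ n}) volume)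
    (hv : volume (I \ {t | ∃ ht : t ∈ A, E.N ⟨t, ht⟩ ≤ n}) ≤
      ENNReal.ofReal ((2 * (1 / 2) ^ n) ^ 2)) :
    FClose J (P n) (E.ambient.pair hA hI) (2 * (1 / 2) ^ n) := by
  choose p hp hp' using fun t : A => E.exists_limit_coupling t n
  refine ⟨_, fun t ht => E.mem ⟨t, ht.1⟩ n ht.2, fun t ht => ht.1,
    fun t ht x y => dist (E.ι ⟨t, ht.1⟩ n ht.2 x)
      (Subtype.val (p := fun z => z ∈ (E.ambient.m ⟨t, ht.1⟩).support) y),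
    fun t ht => p ⟨t, ht.1⟩ ht.2, hJ, hm, hv,
    fun t ht => ⟨E.Z ⟨t, ht.1⟩, inferInstance, _, _, E.isom _ _ _, isometry_subtype_coe,
      fun _ _ => rfl⟩,
    fun t ht => hp ⟨t, ht.1⟩ ht.2, fun s t hs ht hst => ?_⟩
  have hst' : (⟨s, hs.1⟩ : A) ≤ ⟨t, ht.1⟩ := hst
  have hemb := (E.isom ⟨t, ht.1⟩ n ht.2).measurableEmbedding.prodMap
    (MeasurableEmbedding.subtype_coe (E.ambient.measurableSet_support ⟨t, ht.1⟩))
  have key := E.ambient.lintegral_W1_lim_le hst' (n := n) hs.2 ht.2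
  have h1 := hemb.lintegral_map (μ := p ⟨t, ht.1⟩ ht.2) fun z =>
    W1 (E.κ hst' n z.1 : Measure (E.Z ⟨s, hs.1⟩)) (E.ambient.lim hst' z.2 : Measure (E.Z ⟨s, hs.1⟩))
  refine le_trans (le_of_eq ?_) ((le_of_eq h1.symm).trans ?_)
  · refine lintegral_congr fun (z : (P n).flow.slice ⟨t, E.mem ⟨t, ht.1⟩ n ht.2⟩ ×
      (E.ambient.m ⟨t, ht.1⟩).support) => ?_
    have := (Measure.isClosed_support (μ := E.ambient.m ⟨s, hs.1⟩)).completeSpace_coe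
    have e1 := E.κ_ι hst' n hs.2 ht.2 z.1
    have e2 := E.ambient.map_kernel hst' z.2
    have e3 := W1_map_eq_otCost (E.isom ⟨s, hs.1⟩ n hs.2)
      (isometry_subtype_coe (s := (E.ambient.m ⟨s, hs.1⟩).support))
      ((P n).flow.ν (s := ⟨s, E.mem ⟨s, hs.1⟩ n hs.2⟩) (t := ⟨t, E.mem ⟨t, ht.1⟩ n ht.2⟩) hst z.1)
      (E.ambient.kernel hst' z.2 : Measure (E.ambient.m ⟨s, hs.1⟩).support)
    have e4 : W1 (E.κ hst' n (E.ι ⟨t, ht.1⟩ n ht.2 z.1) : Measure (E.Z ⟨s, hs.1⟩))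
        (E.ambient.lim hst' z.2 : Measure (E.Z ⟨s, hs.1⟩)) = _ :=
      (congrArg₂ W1 e1 e2.symm).trans e3
    refine Eq.trans ?_ e4.symm
    simp only [edist_dist]
    rfl
  · rw [hp']
    exact (lintegral_map_le _ _).trans key

end EmbeddedSequence

theorem exists_limit_of_fClose {I J : Set ℝ} {P : ℕ → MetricFlowPair.{u} I}
    (h : ∀ n, FClose J (P n) (P (n + 1)) ((1 / 2) ^ n)) :
    ∃ Q : MetricFlowPair.{u} I, Q.FullyDefined J ∧ ∀ n, FClose J (P n) Q (2 * (1 / 2) ^ n) := by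
  obtain ⟨A, E, hA, hI, hn⟩ := exists_embeddedSequence h
  exact ⟨E.ambient.pair hA hI, fun t ht => ((hn 0).1 ht).1,
    fun n => E.fClose_limit hA hI n (hn n).1 (hn n).2.1 (hn n).2.2⟩

/-! ### The complete metric space of equivalence classes -/

/-- The class of a metric flow pair. -/
def FSpace.mk {I J : Set ℝ} (P : {P : MetricFlowPair.{u} I // P.FullyDefined J}) :
    FSpace.{u} I J := Quotient.mk (pairSetoid.{u} I J) P

theorem dF_mk {I J : Set ℝ} (P Q : {P : MetricFlowPair.{u} I // P.FullyDefined J}) :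
    dF (FSpace.mk P) (FSpace.mk Q) = dFPair J P.1 Q.1 := rfl

/-- The `𝔽`-distance as an extended metric. -/
@[reducible]
noncomputable def fSpaceEMetricSpace (I J : Set ℝ) : EMetricSpace (FSpace.{u} I J) where
  edist := dF
  edist_self := by
    rintro ⟨P⟩
    exact dFPair_self P.2
  edist_comm := by
    rintro ⟨P⟩ ⟨Q⟩
    exact dFPair_comm P.1 Q.1
  edist_triangle := by
    rintro ⟨P⟩ ⟨Q⟩ ⟨R⟩
    exact dFPair_triangle P.1 Q.1 R.1
  eq_of_edist_eq_zero := by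
    rintro ⟨P⟩ ⟨Q⟩ h
    refine Quotient.sound (nonempty_isometry_of_forall_fClose fun r hr => ?_)
    have h' : dFPair J P.1 Q.1 = 0 := h
    obtain ⟨r', hr'0, hr', hc⟩ := exists_fClose_of_dFPair_lt
      (show dFPair J P.1 Q.1 < ENNReal.ofReal r by rw [h']; simpa using hr)
    exact hc.mono hr'0.le ((ENNReal.ofReal_lt_ofReal_iff hr).1 hr').le

theorem completeSpace_fSpace (I J : Set ℝ) :
    @CompleteSpace (FSpace.{u} I J) (fSpaceEMetricSpace I J).toUniformSpace := by
  let _ := fSpaceEMetricSpace.{u} I J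
  -- Only sequences with distances below 2⁻ᴺ from index `N` on need limits, which gives exactly the
  -- closeness of successive representatives required above.
  refine EMetric.complete_of_convergent_controlled_sequences
    (fun n => ENNReal.ofReal ((1 / 2) ^ n)) (fun n => ENNReal.ofReal_pos.2 (by positivity))
    fun u hu => ?_
  obtain ⟨P, hP⟩ : ∃ P : ℕ → {P : MetricFlowPair.{u} I // P.FullyDefined J},
      ∀ n, u n = FSpace.mk (P n) :=
    ⟨fun n => Quotient.out (u n), fun n => (Quotient.out_eq (u n)).symm⟩
  have hc : ∀ n, FClose J (P n).1 (P (n + 1)).1 ((1 / 2) ^ n) := by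
    intro n
    have h := hu n n (n + 1) le_rfl n.le_succ
    rw [hP, hP] at h
    have h : dF (FSpace.mk (P n)) (FSpace.mk (P (n + 1))) < ENNReal.ofReal ((1 / 2) ^ n) := h
    rw [dF_mk] at h
    obtain ⟨r, hr0, hr, h⟩ := exists_fClose_of_dFPair_lt h
    exact h.mono hr0.le ((ENNReal.ofReal_lt_ofReal_iff (by positivity)).1 hr).le
  obtain ⟨Q, hQ, hlim⟩ := exists_limit_of_fClose hc
  refine ⟨FSpace.mk ⟨Q, hQ⟩, ?_⟩
  rw [tendsto_iff_edist_tendsto_0]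
  have h0 : Tendsto (fun n : ℕ => ENNReal.ofReal (2 * (1 / 2) ^ n)) atTop (𝓝 0) := by
    rw [← ENNReal.ofReal_zero, ← mul_zero (2 : ℝ)]
    exact ENNReal.tendsto_ofReal ((tendsto_pow_atTop_nhds_zero_of_lt_one (by norm_num)
      (by norm_num)).const_mul 2)
  refine tendsto_of_tendsto_of_tendsto_of_le_of_le tendsto_const_nhds h0 (fun _ => zero_le)
    fun n => ?_
  rw [hP]
  exact dFPair_le_of_fClose (by positivity) (hlim n)

/-- For every interval `I ⊆ ℝ` and every `J ⊆ I`, the function `d_𝔽^J` is a metric on `𝔽_I^J`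
(with the value `∞` allowed), and the metric space `(𝔽_I^J, d_𝔽^J)` is complete. -/
theorem theorem5 (I J : Set ℝ) (hI : I.OrdConnected) (hJ : J ⊆ I) :
    ∃ m : EMetricSpace (FSpace.{u} I J),
      (∀ x y : FSpace.{u} I J, m.edist x y = dF x y) ∧
        @CompleteSpace (FSpace.{u} I J) m.toUniformSpace :=
  ⟨fSpaceEMetricSpace I J, fun _ _ => rfl, completeSpace_fSpace I J⟩
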